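/- **Setting.** Let $d\ge 1$ and $N,M\ge 1$ be integers, $\beta>0$, $\lambda_S,\lambda_R,\mu\ge 0$, and let $\rho$ be a probability measure on the unit sphere $\mathbb S^{d-1}\subset\mathbb R^d$ with $\int\sigma\otimes\sigma\,d\rho(\sigma)=\frac1d\mathbb 1_d$. For $\sigma\in\mathbb S^{d-1}$ and $i\ne j$ let $M_\sigma^{(i,j)}$ be the linear map of $\mathbb R^{d(N+M)}$ that replaces the components $u_i,u_j$ of $\boldsymbol u=(u_1,\dots,u_{N+M})$ by $u_i-(\sigma\cdot(u_i-u_j))\sigma$ and $u_j+(\sigma\cdot(u_i-u_j))\sigma$ and keeps the others. Put $R_{ij}[F](\boldsymbol u)=\int_{\mathbb S^{d-1}}F(M_\sigma^{(i,j)}\boldsymbol u)\,d\rho(\sigma)$ and $$\mathcal L=\frac{\lambda_S}{N-1}\sum_{1\le i<j\le N}(R_{ij}-\mathbb 1)+\frac{\lambda_R}{M-1}\sum_{N<i<j\le N+M}(R_{ij}-\mathbb 1)+\frac{\mu}{M}\sum_{i=1}^{N}\sum_{j=N+1}^{N+M}(R_{ij}-\mathbb 1)$$ (an empty sum is $0$).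 On $\mathbb R^{n}$ let $\gamma(\boldsymbol x)=(\beta/2\pi)^{n/2}e^{-\beta|\boldsymbol x|^2/2}$ (the dimension $n$ is clear from the argument). $\mathcal L$ is a bounded operator on $L^1(\mathbb R^{d(N+M)},d\boldsymbol u)$ and on $L^1(\mathbb R^{d(N+M)},\gamma\,d\boldsymbol u)$, and $e^{\mathcal Lt}$ is its exponential. Write $\boldsymbol u=(\boldsymbol v,\boldsymbol w)$ with $\boldsymbol v\in\mathbb R^{dN}$ (the Kac system) and $\boldsymbol w\in\mathbb R^{dM}$ (the heat reservoir). Let $\Pi_\gamma\varphi(\boldsymbol v)=\int\varphi(\boldsymbol v,\boldsymbol w)\gamma(\boldsymbol w)\,d\boldsymbol w$ be the Gaussian marginal, and for $s\ge 0$ let $P_sh(\boldsymbol v)=\int h(e^{-s}\boldsymbol v+\sqrt{1-e^{-2s}}\,\boldsymbol x)\gamma(\boldsymbol x)\,d\boldsymbol x$ be the Ornstein–Uhlenbeck semigroup on $L^1(\mathbb R^{dN},\gamma\,d\boldsymbol v)$. A function of $\boldsymbol v$ is also regarded as a function of $(\boldsymbol v,\boldsymbol w)$. Let $S(f|\gamma)=\int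 f\ln(f/\gamma)\,d\boldsymbol v$, and for $h\ge0$ let $I(h)=\int\frac{|\nabla h|^2}{h}\gamma\,d\boldsymbol v$ with the weak gradient $\nabla h$ ($I(h)=\infty$ if it does not exist). **Theorem.** Let $(F_t)_{t\ge0}$ in $L^1(\mathbb R^{d(N+M)})$ solve the Kac master equation $\partial_tF_t=\mathcal LF_t$ with initial condition $F_0(\boldsymbol v,\boldsymbol w)=f_0(\boldsymbol v)\gamma(\boldsymbol w)$, where $f_0$ is a probability density on $\mathbb R^{dN}$ with $\sqrt{f_0}\in H^1(\mathbb R^{dN})$ and the kinetic energy $\frac12\int|\boldsymbol u|^2F_0(\boldsymbol u)\,d\boldsymbol u$ is finite. Put $f_t(\boldsymbol v)=\int F_t(\boldsymbol v,\boldsymbol w)\,d\boldsymbol w$ and $h_0=f_0/\gamma$. Let $c:\mathbb R\to\mathbb R$ and $t\ge 0$. If $$I(\Pi_\gamma e^{\mathcal Lt}P_sh_0)\le c(t)\,I(P_sh_0)\qquad\text{for all }s\ge0,$$ then $$S(f_t|\gamma)\le c(t)\,S(f_0|\gamma).$$ -/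

import Mathlib

open MeasureTheory
open scoped ENNReal NNReal ContDiff

namespace KacModel

noncomputable section

/-! ### Averaging operators on `L¹` -/

section Average

variable {X Y Z : Type*} [MeasurableSpace X] [MeasurableSpace Y] [MeasurableSpace Z]
  {μ : Measure X} {ν : Measure Y} {κ : Measure Z}

theorem integrable_comp_prod (A : X × Y → Z) (hA : MeasurePreserving A (μ.prod ν) κ)
    (φ : Lp ℝ 1 κ) : Integrable (fun p => φ (A p)) (μ.prod ν) :=
  hA.integrable_comp_of_integrable (L1.integrable_coeFn φ)

variable [SFinite μ] [SFinite ν]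

/-- The bounded operator `L¹(κ) → L¹(μ)`, `φ ↦ (x ↦ ∫ φ (A (x, y)) dν(y))`, where `A` pushes
`μ ⊗ ν` forward to `κ`. -/
def averageOp (A : X × Y → Z) (hA : MeasurePreserving A (μ.prod ν) κ) :
    Lp ℝ 1 κ →L[ℝ] Lp ℝ 1 μ :=
  LinearMap.mkContinuous
    { toFun := fun φ => (integrable_comp_prod A hA φ).integral_prod_left.toL1
        (fun x => ∫ y, φ (A (x, y)) ∂ν)
      map_add' := by
        intro φ ψ
        rw [← Integrable.toL1_add]
        rw [Integrable.toL1_eq_toL1_iff]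
        have h0 : (fun p => (φ + ψ : Lp ℝ 1 κ) (A p)) =ᵐ[μ.prod ν]
            fun p => φ (A p) + ψ (A p) :=
          hA.quasiMeasurePreserving.ae_eq_comp (Lp.coeFn_add φ ψ)
        filter_upwards [Measure.ae_ae_of_ae_prod h0,
          (integrable_comp_prod A hA φ).prod_right_ae,
          (integrable_comp_prod A hA ψ).prod_right_ae] with x hx h1 h2
        rw [integral_congr_ae hx, integral_add h1 h2]
        rfl
      map_smul' := by
        intro c φ
        rw [RingHom.id_apply, ← Integrable.toL1_smul]
        rw [Integrable.toL1_eq_toL1_iff]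
        have h0 : (fun p => (c • φ : Lp ℝ 1 κ) (A p)) =ᵐ[μ.prod ν]
            fun p => c • φ (A p) :=
          hA.quasiMeasurePreserving.ae_eq_comp (Lp.coeFn_smul c φ)
        filter_upwards [Measure.ae_ae_of_ae_prod h0] with x hx
        rw [integral_congr_ae hx, integral_smul] }
    1 (by
      intro φ
      have hint := integrable_comp_prod A hA φ
      rw [one_mul]
      change ‖hint.integral_prod_left.toL1 _‖ ≤ ‖φ‖
      rw [L1.norm_of_fun_eq_integral_norm, L1.norm_eq_integral_norm]
      calc ∫ x, ‖∫ y, φ (A (x, y)) ∂ν‖ ∂μ ≤ ∫ x, ∫ y, ‖φ (A (x, y))‖ ∂ν ∂μ :=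
            integral_mono hint.integral_prod_left.norm hint.norm.integral_prod_left
              (fun x => norm_integral_le_integral_norm _)
        _ = ∫ p, ‖φ (A p)‖ ∂(μ.prod ν) := (integral_prod _ hint.norm).symm
        _ = ∫ z, ‖φ z‖ ∂κ := by
            have hm := (Lp.aestronglyMeasurable φ).norm
            have h := integral_map (φ := A) (f := fun z => ‖φ z‖) hA.aemeasurable
              (hA.map_eq.symm ▸ hm)
            rw [← h]
            exact congrArg (fun m : Measure Z => ∫ z, ‖φ z‖ ∂m) hA.map_eq)

theorem averageOp_ae (A : X × Y → Z) (hA : MeasurePreserving A (μ.prod ν) κ) (φ : Lp ℝ 1 κ) :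
    averageOp A hA φ =ᵐ[μ] fun x => ∫ y, φ (A (x, y)) ∂ν :=
  Integrable.coeFn_toL1 (integrable_comp_prod A hA φ).integral_prod_left

end Average

/-! ### Gaussian measures and the Ornstein-Uhlenbeck semigroup -/

section Gauss

variable {E : Type*} [NormedAddCommGroup E] [InnerProductSpace ℝ E]

/-- The Maxwell distribution `γ(x) = (β / 2π)^{dim E / 2} exp (-β |x|² / 2)` with inverse
temperature `β`. -/
def maxwell (β : ℝ) (x : E) : ℝ :=
  (β / (2 * Real.pi)) ^ ((Module.finrank ℝ E : ℝ) / 2) * Real.exp (-(β / 2) * ‖x‖ ^ 2)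

theorem maxwell_continuous (β : ℝ) : Continuous (maxwell (E := E) β) := by
  unfold maxwell; fun_prop

theorem maxwell_pos {β : ℝ} (hβ : 0 < β) (x : E) : 0 < maxwell β x := by
  unfold maxwell; positivity

variable [FiniteDimensional ℝ E] [MeasurableSpace E] [BorelSpace E]

variable (E) in
/-- The measure `γ(x) dx` with `γ` the Maxwell distribution. -/
def gaussMeasure (β : ℝ) : Measure E :=
  (volume : Measure E).withDensity (fun x => ENNReal.ofReal (maxwell β x))

instance (β : ℝ) : SFinite (gaussMeasure E β) := by
  unfold gaussMeasure; infer_instance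

theorem isProbabilityMeasure_gaussMeasure {β : ℝ} (hβ : 0 < β) :
    IsProbabilityMeasure (gaussMeasure E β) := by
  have hint : ∫ x : E, maxwell β x = 1 := by
    unfold maxwell
    rw [integral_const_mul, GaussianFourier.integral_rexp_neg_mul_sq_norm (by positivity),
      ← Real.mul_rpow (by positivity) (by positivity)]
    have : β / (2 * Real.pi) * (Real.pi / (β / 2)) = 1 := by
      have := Real.pi_pos; field_simp
    rw [this, Real.one_rpow]
  have hi : Integrable (maxwell (E := E) β) := by
    by_contra h
    rw [integral_undef h] at hint
    exact zero_ne_one hint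
  constructor
  rw [gaussMeasure, withDensity_apply _ MeasurableSet.univ, Measure.restrict_univ,
    ← ofReal_integral_eq_lintegral_ofReal hi (.of_forall fun x => (maxwell_pos hβ x).le), hint,
    ENNReal.ofReal_one]

/-- Measures that are invariant under all linear isometries. -/
class RotationInvariant (μ : Measure E) : Prop where
  measurePreserving : ∀ e : E ≃ₗᵢ[ℝ] E, MeasurePreserving e μ μ

instance : RotationInvariant (volume : Measure E) := ⟨fun e => e.measurePreserving⟩

theorem gaussMeasure_isometry {F : Type*} [NormedAddCommGroup F] [InnerProductSpace ℝ F]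
    [FiniteDimensional ℝ F] [MeasurableSpace F] [BorelSpace F] (β : ℝ) (e : E ≃ₗᵢ[ℝ] F) :
    MeasurePreserving e (gaussMeasure E β) (gaussMeasure F β) := by
  refine ⟨e.continuous.measurable, ?_⟩
  ext s hs
  have hm : MeasurableSet (e ⁻¹' s) := e.continuous.measurable hs
  rw [Measure.map_apply e.continuous.measurable hs, gaussMeasure, gaussMeasure,
    withDensity_apply _ hm, withDensity_apply _ hs,
    ← e.measurePreserving.setLIntegral_comp_preimage hs
      ((maxwell_continuous β).measurable.ennreal_ofReal)]
  simp [maxwell, e.toLinearEquiv.finrank_eq]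

instance (β : ℝ) : RotationInvariant (gaussMeasure E β) := ⟨fun e => gaussMeasure_isometry β e⟩

theorem gaussMeasure_prod {F : Type*} [NormedAddCommGroup F] [InnerProductSpace ℝ F]
    [FiniteDimensional ℝ F] [MeasurableSpace F] [BorelSpace F] {β : ℝ} (hβ : 0 < β) :
    MeasurePreserving (WithLp.toLp 2 : E × F → WithLp 2 (E × F))
      ((gaussMeasure E β).prod (gaussMeasure F β)) (gaussMeasure (WithLp 2 (E × F)) β) := by
  have hv := WithLp.volume_preserving_toLp E F
  refine ⟨hv.measurable, ?_⟩
  have hd : ∀ p : E × F, maxwell β p.1 * maxwell β p.2 = maxwell β (WithLp.toLp 2 p) := by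
    intro p
    have hfin : Module.finrank ℝ (WithLp 2 (E × F))
        = Module.finrank ℝ E + Module.finrank ℝ F := by
      rw [(WithLp.linearEquiv 2 ℝ (E × F)).finrank_eq, Module.finrank_prod]
    have hp : 0 < β / (2 * Real.pi) := by positivity
    simp only [maxwell]
    rw [hfin, WithLp.prod_norm_sq_eq_of_L2, mul_mul_mul_comm, ← Real.rpow_add hp, ← Real.exp_add]
    push_cast
    congr 2
    · ring
    · change _ = -(β / 2) * (‖p.1‖ ^ 2 + ‖p.2‖ ^ 2)
      ring
  rw [gaussMeasure, gaussMeasure, prod_withDensity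
    (maxwell_continuous β).measurable.ennreal_ofReal
    (maxwell_continuous β).measurable.ennreal_ofReal]
  ext s hs
  rw [Measure.map_apply hv.measurable hs, gaussMeasure, withDensity_apply _ (hv.measurable hs),
    withDensity_apply _ hs, ← hv.setLIntegral_comp_preimage hs
      ((maxwell_continuous β).measurable.ennreal_ofReal)]
  refine lintegral_congr fun p => ?_
  rw [← ENNReal.ofReal_mul (maxwell_pos hβ _).le, hd p]

/-- The map `(v, x) ↦ e^{-s} v + √(1 - e^{-2s}) x`. -/
def ouMap (s : ℝ≥0) (p : E × E) : E :=
  Real.exp (-(s : ℝ)) • p.1 + √(1 - Real.exp (-2 * (s : ℝ))) • p.2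

theorem ouMap_measurePreserving {β : ℝ} (hβ : 0 < β) (s : ℝ≥0) :
    MeasurePreserving (ouMap s) ((gaussMeasure E β).prod (gaussMeasure E β))
      (gaussMeasure E β) := by
  have := isProbabilityMeasure_gaussMeasure (E := E) hβ
  set a : ℝ := Real.exp (-(s : ℝ)) with ha
  set b : ℝ := √(1 - Real.exp (-2 * (s : ℝ))) with hb
  have hab : a ^ 2 + b ^ 2 = 1 := by
    rw [hb, Real.sq_sqrt, ha, ← Real.exp_nat_mul]
    · push_cast; ring_nf
    · have : Real.exp (-2 * (s : ℝ)) ≤ 1 := Real.exp_le_one_iff.2 (by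
        have := s.2
        have h' : (0 : ℝ) ≤ (s : ℝ) := this
        linarith)
      linarith
  let r : WithLp 2 (E × E) →ₗᵢ[ℝ] WithLp 2 (E × E) :=
    { toFun := fun z => WithLp.toLp 2 (a • z.fst + b • z.snd, -b • z.fst + a • z.snd)
      map_add' := by
        intro x y
        apply (WithLp.equiv 2 (E × E)).injective
        ext <;> simp <;> abel
      map_smul' := by
        intro c x
        apply (WithLp.equiv 2 (E × E)).injective
        ext <;> simp [smul_smul, mul_comm]
      norm_map' := by
        intro z
        rw [← sq_eq_sq₀ (norm_nonneg _) (norm_nonneg _), WithLp.prod_norm_sq_eq_of_L2,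
          WithLp.prod_norm_sq_eq_of_L2]
        simp only [LinearMap.coe_mk, AddHom.coe_mk, WithLp.toLp_fst, WithLp.toLp_snd]
        rw [norm_add_sq_real, norm_add_sq_real]
        simp only [norm_smul, inner_smul_left, inner_smul_right, mul_pow, norm_neg,
          Real.norm_eq_abs, sq_abs]
        simp
        linear_combination (‖z.fst‖ ^ 2 + ‖z.snd‖ ^ 2) * hab }
  have h1 := gaussMeasure_isometry β (r.toLinearIsometryEquiv rfl)
  have h2 : MeasurePreserving (WithLp.ofLp : WithLp 2 (E × E) → E × E)
      (gaussMeasure (WithLp 2 (E × E)) β) ((gaussMeasure E β).prod (gaussMeasure E β)) := by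
    have h := gaussMeasure_prod (E := E) (F := E) hβ
    exact h.symm (MeasurableEquiv.toLp 2 (E × E))
  have h3 := (measurePreserving_fst (μ := gaussMeasure E β) (ν := gaussMeasure E β)).comp
    (h2.comp (h1.comp (gaussMeasure_prod (E := E) (F := E) hβ)))
  exact h3

/-- The Ornstein-Uhlenbeck semigroup `P_s h(v) = ∫ h(e^{-s} v + √(1 - e^{-2s}) x) γ(x) dx` on
`L¹(γ(v) dv)`. -/
def ornsteinUhlenbeck {β : ℝ} (hβ : 0 < β) (s : ℝ≥0) :
    Lp ℝ 1 (gaussMeasure E β) →L[ℝ] Lp ℝ 1 (gaussMeasure E β) :=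
  averageOp (ouMap s) (ouMap_measurePreserving hβ s)

theorem integrable_div_maxwell {β : ℝ} (hβ : 0 < β) (f : Lp ℝ 1 (volume : Measure E)) :
    Integrable (fun v => f v / maxwell β v) (gaussMeasure E β) := by
  rw [gaussMeasure, integrable_withDensity_iff_integrable_smul'
    (maxwell_continuous β).measurable.ennreal_ofReal (.of_forall fun _ => ENNReal.ofReal_lt_top)]
  refine (L1.integrable_coeFn f).congr (.of_forall fun v => ?_)
  have := maxwell_pos hβ v
  simp only [smul_eq_mul]
  rw [ENNReal.toReal_ofReal this.le]
  field_simp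

/-- The ground state transformation `f ↦ h = f / γ` from `L¹(dv)` to `L¹(γ(v) dv)`. -/
def groundState {β : ℝ} (hβ : 0 < β) (f : Lp ℝ 1 (volume : Measure E)) :
    Lp ℝ 1 (gaussMeasure E β) :=
  (integrable_div_maxwell hβ f).toL1 (fun v => f v / maxwell β v)

end Gauss

/-! ### Weak derivatives, entropy and information -/

section Functionals

variable {E : Type*} [NormedAddCommGroup E] [InnerProductSpace ℝ E] [FiniteDimensional ℝ E]
  [MeasurableSpace E] [BorelSpace E]

/-- `g` is a weak (distributional) gradient of `u`. -/
def HasWeakGradient (u : E → ℝ) (g : E → E) : Prop :=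
  LocallyIntegrable u volume ∧ LocallyIntegrable g volume ∧
    ∀ φ : E → ℝ, ContDiff ℝ ∞ φ → HasCompactSupport φ → ∀ w : E,
      ∫ x, u x * fderiv ℝ φ x w = -∫ x, φ x * inner ℝ (g x) w

/-- Membership in the Sobolev space `H¹` over the Lebesgue measure. -/
def MemH1 (u : E → ℝ) : Prop :=
  MemLp u 2 volume ∧ ∃ g : E → E, HasWeakGradient u g ∧ MemLp g 2 volume

/-- The Fisher information `∫ |∇h|² / h γ dv` of `h ≥ 0`, where `∇h` is the weak gradient of `h`
(which is unique up to null sets). The value is `∞` if there is no weak gradient or if the integral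
diverges, so that it is finite exactly if `√h` lies in `H¹(γ dv)`, for `h` in `L¹(γ dv)`. -/
def fisherInfo (β : ℝ) (h : E → ℝ) : ℝ≥0∞ :=
  ⨅ (g : E → E) (_ : HasWeakGradient h g),
    ∫⁻ v, ‖g v‖ₑ ^ 2 / ENNReal.ofReal (h v) ∂(gaussMeasure E β)

/-- The relative entropy `∫ f ln (f / g) dv`, as an extended real number: the integral of the
positive part minus the integral of the negative part of the integrand. -/
def relEntropy (f g : E → ℝ) : EReal :=
  ((∫⁻ v, ENNReal.ofReal (f v * Real.log (f v / g v)) : ℝ≥0∞) : EReal) -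
    ((∫⁻ v, ENNReal.ofReal (-(f v * Real.log (f v / g v))) : ℝ≥0∞) : EReal)

/-- The kinetic energy `½ ∫ |u|² F(u) du` of a density `F ≥ 0`. -/
def kineticEnergy (F : E → ℝ) : ℝ≥0∞ :=
  2⁻¹ * ∫⁻ u, ENNReal.ofReal (‖u‖ ^ 2 * F u)

end Functionals

/-! ### The collision model -/

/-- Velocities in `ℝᵈ`. -/
abbrev Velocity (d : ℕ) : Type := EuclideanSpace ℝ (Fin d)

/-- The velocities of particles labelled by `ι`, with the Euclidean norm. -/
abbrev State (d : ℕ) (ι : Type) [Fintype ι] : Type := PiLp 2 (fun _ : ι => Velocity d)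

/-- The set of scattering angles. -/
abbrev ScatSphere (d : ℕ) : Type := Metric.sphere (0 : Velocity d) 1

/-- The condition `∫ σ ⊗ σ dρ(σ) = (1 / d) 1`. -/
def IsSymmetricScattering {d : ℕ} (ρ : Measure (ScatSphere d)) : Prop :=
  ∀ a b : Fin d, ∫ σ, (σ : Velocity d) a * (σ : Velocity d) b ∂ρ =
    ((1 / (d : ℝ)) • (1 : Matrix (Fin d) (Fin d) ℝ)) a b

section Collision

variable {d : ℕ} {ι : Type} [Fintype ι] [DecidableEq ι]

/-- The collision of the particles `i` and `j` with scattering angle `σ`. -/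
def collide (i j : ι) (σ : ScatSphere d) (u : State d ι) : State d ι :=
  WithLp.toLp 2 fun k =>
    if k = i then u i - inner ℝ (σ : Velocity d) (u i - u j) • (σ : Velocity d)
    else if k = j then u j + inner ℝ (σ : Velocity d) (u i - u j) • (σ : Velocity d)
    else u k

theorem collide_norm (i j : ι) (σ : ScatSphere d) (u : State d ι) :
    ‖collide i j σ u‖ = ‖u‖ := by
  have hσ : ‖(σ : Velocity d)‖ = 1 := by simp
  rw [← sq_eq_sq₀ (norm_nonneg _) (norm_nonneg _), PiLp.norm_sq_eq_of_L2, PiLp.norm_sq_eq_of_L2]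
  by_cases hij : i = j
  · subst hij
    refine Finset.sum_congr rfl fun k _ => ?_
    by_cases hk : k = i <;> simp [collide, hk]
  · rw [← Finset.add_sum_erase _ _ (Finset.mem_univ i),
      ← Finset.add_sum_erase _ (fun k => ‖u k‖ ^ 2) (Finset.mem_univ i),
      ← Finset.add_sum_erase (Finset.univ.erase i) _ (Finset.mem_erase.2
        ⟨fun h => hij h.symm, Finset.mem_univ j⟩),
      ← Finset.add_sum_erase (Finset.univ.erase i) (fun k => ‖u k‖ ^ 2) (Finset.mem_erase.2
        ⟨fun h => hij h.symm, Finset.mem_univ j⟩), ← add_assoc, ← add_assoc]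
    congr 1
    · have hji : j ≠ i := fun h => hij h.symm
      simp only [collide, if_true, if_neg hji]
      rw [norm_sub_sq_real, norm_add_sq_real]
      simp only [norm_smul, hσ, inner_smul_right, real_inner_comm, inner_sub_right, mul_one,
        Real.norm_eq_abs, sq_abs]
      ring
    · refine Finset.sum_congr rfl fun k hk => ?_
      simp only [Finset.mem_erase, Finset.mem_univ, and_true] at hk
      simp [collide, hk.1, hk.2]

/-- The collision as a linear isometry. -/
def collideIsometry (i j : ι) (σ : ScatSphere d) : State d ι ≃ₗᵢ[ℝ] State d ι :=
  LinearIsometry.toLinearIsometryEquiv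
    { toFun := collide i j σ
      map_add' := by
        intro u v
        ext1 k
        simp only [collide, PiLp.add_apply]
        split_ifs <;> simp only [inner_sub_right, inner_add_right, add_smul, sub_smul] <;> abel
      map_smul' := by
        intro c u
        ext1 k
        simp only [collide, PiLp.smul_apply, RingHom.id_apply]
        split_ifs <;>
          simp only [inner_sub_right, inner_smul_right, smul_sub, smul_add, smul_smul, mul_sub]
      norm_map' := collide_norm i j σ } rfl

/-- The map `(u, σ) ↦ M_σ^{(i,j)} u`. -/
def collideMap (i j : ι) (p : State d ι × ScatSphere d) : State d ι := collide i j p.2 p.1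

theorem collideMap_continuous (i j : ι) : Continuous (collideMap (d := d) i j) := by
  unfold collideMap collide
  refine (PiLp.continuous_toLp 2 _).comp (continuous_pi fun k => ?_)
  split_ifs <;> fun_prop

theorem collideMap_measurePreserving (μ : Measure (State d ι)) [SFinite μ] [RotationInvariant μ]
    (ρ : Measure (ScatSphere d)) [IsProbabilityMeasure ρ] (i j : ι) :
    MeasurePreserving (collideMap i j) (μ.prod ρ) μ := by
  have h1 : MeasurePreserving
      (fun p : ScatSphere d × State d ι => (id p.1, collide i j p.1 p.2))
      (ρ.prod μ) (ρ.prod μ) := by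
    refine (MeasurePreserving.id ρ).skew_product (g := fun σ u => collide i j σ u) ?_ ?_
    · exact ((collideMap_continuous i j).comp continuous_swap).measurable
    · exact .of_forall fun σ =>
        (RotationInvariant.measurePreserving (μ := μ) (collideIsometry i j σ)).map_eq
  exact measurePreserving_snd.comp (h1.comp Measure.measurePreserving_swap)

/-- The collision operator `R_{ij}[F](u) = ∫ F(M_σ^{(i,j)} u) dρ(σ)` on `L¹(μ)`, for a rotation
invariant reference measure `μ` (the Lebesgue measure or a centred Gaussian). -/
def collisionOp (μ : Measure (State d ι)) [SFinite μ] [RotationInvariant μ]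
    (ρ : Measure (ScatSphere d)) [IsProbabilityMeasure ρ] (i j : ι) :
    Lp ℝ 1 μ →L[ℝ] Lp ℝ 1 μ :=
  averageOp (collideMap i j) (collideMap_measurePreserving μ ρ i j)

end Collision

/-! ### The system of `N` particles coupled to a heat reservoir of `M` particles -/

section HeatReservoir

variable {d N M : ℕ}

/-- The velocities of all particles: the Kac system `Fin N`, the heat reservoir `Fin M`. -/
abbrev FullState (d N M : ℕ) : Type := State d (Fin N ⊕ Fin M)

/-- The generator of the time evolution, acting on `L¹(μ)`:
`λ_S / (N - 1) ∑_{i < j ≤ N} (R_{ij} - 1) + λ_R / (M - 1) ∑_{N < i < j} (R_{ij} - 1)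
  + μ₀ / M ∑_{i ≤ N < j} (R_{ij} - 1)`. -/
def kacGenerator (lamS lamR mu0 : ℝ) (μ : Measure (FullState d N M)) [SFinite μ]
    [RotationInvariant μ] (ρ : Measure (ScatSphere d)) [IsProbabilityMeasure ρ] :
    Lp ℝ 1 μ →L[ℝ] Lp ℝ 1 μ :=
  (lamS / ((N : ℝ) - 1)) • ∑ i : Fin N, ∑ j ∈ Finset.univ.filter (fun j : Fin N => i < j),
      (collisionOp μ ρ (Sum.inl i) (Sum.inl j) - 1)
  + (lamR / ((M : ℝ) - 1)) • ∑ i : Fin M, ∑ j ∈ Finset.univ.filter (fun j : Fin M => i < j),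
      (collisionOp μ ρ (Sum.inr i) (Sum.inr j) - 1)
  + (mu0 / (M : ℝ)) • ∑ i : Fin N, ∑ j : Fin M,
      (collisionOp μ ρ (Sum.inl i) (Sum.inr j) - 1)

/-- The semigroup `e^{L t}` of bounded operators on `L¹(μ)`. -/
def kacSemigroup (lamS lamR mu0 : ℝ) (μ : Measure (FullState d N M)) [SFinite μ]
    [RotationInvariant μ] (ρ : Measure (ScatSphere d)) [IsProbabilityMeasure ρ] (t : ℝ) :
    Lp ℝ 1 μ →L[ℝ] Lp ℝ 1 μ :=
  NormedSpace.exp (t • kacGenerator lamS lamR mu0 μ ρ)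

/-- `F` solves the Kac master equation `∂_t F_t = L F_t`, `t ≥ 0`, in `L¹(du)`. -/
def IsKacSolution (lamS lamR mu0 : ℝ) (ρ : Measure (ScatSphere d)) [IsProbabilityMeasure ρ]
    (F : ℝ → Lp ℝ 1 (volume : Measure (FullState d N M))) : Prop :=
  ∀ t : ℝ, 0 ≤ t →
    HasDerivWithinAt F (kacGenerator lamS lamR mu0 volume ρ (F t)) (Set.Ici 0) t

/-- The velocities of the Kac system. -/
def kacPart (u : FullState d N M) : State d (Fin N) := WithLp.toLp 2 fun i => u (Sum.inl i)

/-- The velocities of the heat reservoir. -/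
def reservoirPart (u : FullState d N M) : State d (Fin M) := WithLp.toLp 2 fun j => u (Sum.inr j)

/-- The state `(v, w)` of all particles. -/
def joinState (p : State d (Fin N) × State d (Fin M)) : FullState d N M :=
  WithLp.toLp 2 (Sum.elim p.1 p.2)

/-- `joinState` as a linear isometry. -/
def joinIsometry : WithLp 2 (State d (Fin N) × State d (Fin M)) ≃ₗᵢ[ℝ] FullState d N M where
  toFun z := joinState (z.fst, z.snd)
  invFun u := WithLp.toLp 2 (kacPart u, reservoirPart u)
  left_inv z := rfl
  right_inv u := by
    ext1 k
    cases k <;> rfl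
  map_add' x y := by
    ext1 k
    cases k <;> rfl
  map_smul' c x := by
    ext1 k
    cases k <;> rfl
  norm_map' z := by
    rw [← sq_eq_sq₀ (norm_nonneg _) (norm_nonneg _), WithLp.prod_norm_sq_eq_of_L2]
    simp only [PiLp.norm_sq_eq_of_L2]
    simp [joinState]

theorem joinState_volume : MeasurePreserving (joinState (d := d) (N := N) (M := M))
    ((volume : Measure (State d (Fin N))).prod (volume : Measure (State d (Fin M)))) volume :=
  joinIsometry.measurePreserving.comp (WithLp.volume_preserving_toLp _ _)

theorem joinState_gauss {β : ℝ} (hβ : 0 < β) :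
    MeasurePreserving (joinState (d := d) (N := N) (M := M))
      ((gaussMeasure _ β).prod (gaussMeasure _ β)) (gaussMeasure _ β) :=
  (gaussMeasure_isometry β joinIsometry).comp (gaussMeasure_prod hβ)

theorem kacPart_gauss {β : ℝ} (hβ : 0 < β) :
    MeasurePreserving (kacPart (d := d) (N := N) (M := M))
      (gaussMeasure _ β) (gaussMeasure _ β) := by
  have := isProbabilityMeasure_gaussMeasure (E := State d (Fin M)) hβ
  have h1 := (gaussMeasure_prod (E := State d (Fin N)) (F := State d (Fin M)) hβ).symm
    (MeasurableEquiv.toLp 2 (State d (Fin N) × State d (Fin M)))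
  exact measurePreserving_fst.comp
    (h1.comp (gaussMeasure_isometry β (joinIsometry (d := d) (N := N) (M := M)).symm))

/-- The marginal `f(v) = ∫ F(v, w) dw` on the Kac system. -/
def marginal : Lp ℝ 1 (volume : Measure (FullState d N M)) →L[ℝ]
    Lp ℝ 1 (volume : Measure (State d (Fin N))) :=
  averageOp joinState joinState_volume

/-- The Gaussian marginal `Π_γ φ(v) = ∫ φ(v, w) γ(w) dw`. -/
def gaussMarginal {β : ℝ} (hβ : 0 < β) : Lp ℝ 1 (gaussMeasure (FullState d N M) β) →L[ℝ]
    Lp ℝ 1 (gaussMeasure (State d (Fin N)) β) :=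
  averageOp joinState (joinState_gauss hβ)

/-- A function `h` of the velocities `v` of the Kac system, regarded as the function
`(v, w) ↦ h(v)` of all velocities. -/
def extendState (M : ℕ) {β : ℝ} (hβ : 0 < β) : Lp ℝ 1 (gaussMeasure (State d (Fin N)) β) →ₗᵢ[ℝ]
    Lp ℝ 1 (gaussMeasure (FullState d N M) β) :=
  Lp.compMeasurePreservingₗᵢ ℝ kacPart (kacPart_gauss hβ)

end HeatReservoir

end

end KacModel

open KacModel

/-! Put `h₀ = f₀/γ` and `q = Π_γ e^{Lt} h₀`. The proof has two independent halves.

The model half. Collisions are linear isometries, so they preserve `γ`. Division by `γ` therefore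
intertwines the generators on `L¹(du)` and `L¹(γ du)`, and `q = f_t/γ`
(`groundState_eq_kacSemigroup`, `gaussMarginal_groundState`). Isometry also makes every `R_ij`
commute with the Ornstein-Uhlenbeck semigroup `P_s`: an isometry acts on both arguments of `e^{-s}u
+ √(1-e^{-2s})x` and leaves the law of `x` unchanged. Extension to all velocities and `Π_γ` are
compatible with `P_s` as well, hence `Π_γ e^{Lt} P_s h₀ = P_s q`, and the assumption reads `I(P_s q)
≤ c I(P_s h₀)`.

The analytic half. Formally `d/ds Ent(P_s h) = -I(P_s h)/β` and `Ent(P_s h) → 0`, so the entropy is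
`β⁻¹ ∫ I(P_s h) ds` and the inequality is integrated over `s`. Instead of this identity two
one-sided finite-difference bounds are used: `Ent(P_{r+s} h) + (s/β) I(P_{r+s} h) ≤ Ent(P_r h)`
(`entropy_ouFun_add_le`) and `Ent(P_r h) ≤ Ent(P_{r+s} h) + (s/β) I(P_r h)` (`entropy_ouFun_le`).
The first comes from the duality between entropy and exponential moments, tested with a linear
function. The second is the logarithmic Sobolev inequality applied to the law of `a v + b x` for
each fixed `v`. On a grid of mesh `δ`, the second bound for `q`, started at `δ`, and the first for
`h₀`, started at `0`, involve the information at the same grid points. The sums compare term by term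
and no convergence of Riemann sums is needed. The logarithmic Sobolev inequality also makes the tail
vanish, and `δ → 0` follows from lower semicontinuity of the entropy
(`entropy_le_mul_of_information_le`).

The logarithmic Sobolev inequality is proved by following `θ ↦ Ent` of `v ↦ ∫ f(cos θ v + sin θ x)
γ(x) dx` from `f` at `θ = 0` to its mean at `θ = π/2`. The derivative is computed by rotating the
Gaussian pair and integrating by parts (`IsRegular.angular_derivative_eq`). All entropies use the
nonnegative integrand `klFun h = h ln h + 1 - h`, which permits values in `[0,∞]` and Fatou's lemma.
-/

namespace KacModel

open Filter Topology InformationTheory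

noncomputable section

set_option linter.unusedSectionVars false

section GaussTools

variable {E : Type*} [NormedAddCommGroup E] [InnerProductSpace ℝ E] [FiniteDimensional ℝ E]
  [MeasurableSpace E] [BorelSpace E] {β : ℝ}

/-! ### Integration against the Gaussian measure -/

theorem lintegral_gaussMeasure (f : E → ℝ≥0∞) (hf : Measurable f) :
    ∫⁻ x, f x ∂gaussMeasure E β = ∫⁻ x, ENNReal.ofReal (maxwell β x) * f x := by
  rw [gaussMeasure, lintegral_withDensity_eq_lintegral_mul _
    (maxwell_continuous β).measurable.ennreal_ofReal hf]
  rfl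

theorem integral_gaussMeasure {F : Type*} [NormedAddCommGroup F] [NormedSpace ℝ F] (hβ : 0 < β)
    (f : E → F) : ∫ x, f x ∂gaussMeasure E β = ∫ x, maxwell β x • f x := by
  rw [gaussMeasure, integral_withDensity_eq_integral_toReal_smul
    (maxwell_continuous β).measurable.ennreal_ofReal (.of_forall fun _ => ENNReal.ofReal_lt_top)]
  refine integral_congr_ae (.of_forall fun x => ?_)
  simp only [ENNReal.toReal_ofReal (maxwell_pos hβ x).le]

theorem integrable_gaussMeasure {F : Type*} [NormedAddCommGroup F] [NormedSpace ℝ F] (hβ : 0 < β)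
    (f : E → F) : Integrable f (gaussMeasure E β) ↔ Integrable (fun x => maxwell β x • f x) := by
  rw [gaussMeasure, integrable_withDensity_iff_integrable_smul'
    (maxwell_continuous β).measurable.ennreal_ofReal (.of_forall fun _ => ENNReal.ofReal_lt_top)]
  refine integrable_congr (.of_forall fun x => ?_)
  simp only [ENNReal.toReal_ofReal (maxwell_pos hβ x).le]

theorem gaussMeasure_absolutelyContinuous : gaussMeasure E β ≪ (volume : Measure E) :=
  withDensity_absolutelyContinuous _ _

theorem absolutelyContinuous_gaussMeasure (hβ : 0 < β) :
    (volume : Measure E) ≪ gaussMeasure E β :=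
  withDensity_absolutelyContinuous' (maxwell_continuous β).measurable.ennreal_ofReal.aemeasurable
    (.of_forall fun x => by simp [maxwell_pos hβ x])

/-- Absorbs one factor of the norm into part of a Gaussian. The constant is not optimal; only its
independence of `t` matters. -/
theorem mul_exp_neg_sq_le {c t : ℝ} (hc : 0 < c) (_ht : 0 ≤ t) :
    t * Real.exp (-(c * t ^ 2)) ≤ 1 + 1 / c := by
  have h1 : c * t ^ 2 + 1 ≤ Real.exp (c * t ^ 2) := Real.add_one_le_exp _
  have h2 : (0 : ℝ) ≤ c * t ^ 2 := by positivity
  rw [Real.exp_neg, ← div_eq_mul_inv, div_le_iff₀ (Real.exp_pos _)]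
  calc t ≤ 1 + t ^ 2 := by nlinarith [sq_nonneg (t - 1)]
    _ ≤ (1 + 1 / c) * (c * t ^ 2 + 1) := by
      have : (1 + 1 / c) * (c * t ^ 2 + 1) = c * t ^ 2 + 1 + t ^ 2 + 1 / c := by field_simp; ring
      have : 0 < 1 / c := by positivity
      linarith
    _ ≤ _ := by gcongr

theorem integrable_maxwell (hβ : 0 < β) : Integrable (maxwell (E := E) β) := by
  have := isProbabilityMeasure_gaussMeasure (E := E) hβ
  simpa using (integrable_gaussMeasure hβ (fun _ : E => (1 : ℝ))).1 (integrable_const _)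

theorem integrable_norm_gaussMeasure (hβ : 0 < β) :
    Integrable (fun x : E => ‖x‖) (gaussMeasure E β) := by
  rw [integrable_gaussMeasure hβ]
  have hβ2 : 0 < β / 2 := by positivity
  -- Half of the Gaussian exponent absorbs `‖x‖`, the other half is the Gaussian at inverse
  -- temperature `β/2`. `C` collects the ratio of the two normalisations and the constant of
  -- `mul_exp_neg_sq_le` with `c = β/4`.
  set C : ℝ := (β / (2 * Real.pi)) ^ ((Module.finrank ℝ E : ℝ) / 2) *
    ((β / 2 / (2 * Real.pi)) ^ ((Module.finrank ℝ E : ℝ) / 2))⁻¹ * (1 + 1 / (β / 4)) with hC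
  refine ((integrable_maxwell (E := E) hβ2).const_mul C).mono'
    (((maxwell_continuous β).smul continuous_norm).aestronglyMeasurable)
    (.of_forall fun x => ?_)
  have h := mul_exp_neg_sq_le (c := β / 4) (t := ‖x‖) (by positivity) (norm_nonneg x)
  have hp := maxwell_pos hβ x
  rw [norm_smul, Real.norm_of_nonneg hp.le, norm_norm]
  have hpos : 0 < (β / 2 / (2 * Real.pi)) ^ ((Module.finrank ℝ E : ℝ) / 2) := by positivity
  have e1 : Real.exp (-(β / 2) * ‖x‖ ^ 2)
      = Real.exp (-(β / 4 * ‖x‖ ^ 2)) * Real.exp (-(β / 2 / 2) * ‖x‖ ^ 2) := by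
    rw [← Real.exp_add]; ring_nf
  have e2 : C * maxwell (β / 2) x = (β / (2 * Real.pi)) ^ ((Module.finrank ℝ E : ℝ) / 2) *
      (1 + 1 / (β / 4)) * Real.exp (-(β / 2 / 2) * ‖x‖ ^ 2) := by
    rw [hC, maxwell]; field_simp
  rw [e2, maxwell, e1]
  calc _ = (β / (2 * Real.pi)) ^ ((Module.finrank ℝ E : ℝ) / 2) *
      (‖x‖ * Real.exp (-(β / 4 * ‖x‖ ^ 2))) * Real.exp (-(β / 2 / 2) * ‖x‖ ^ 2) := by ring
    _ ≤ _ := by gcongr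

/-- Completing the square: the normalised exponential tilt of `γ` is a translate of `γ`. -/
theorem maxwell_mul_exp_inner (hβ : 0 < β) (t x : E) :
    maxwell β x * Real.exp (inner ℝ t x - ‖t‖ ^ 2 / (2 * β)) = maxwell β (x - β⁻¹ • t) := by
  simp only [maxwell]
  rw [mul_assoc, ← Real.exp_add, norm_sub_sq_real, inner_smul_right, norm_smul, Real.norm_of_nonneg
    (by positivity), real_inner_comm]
  congr 2
  field_simp
  ring

theorem integral_exp_inner_gaussMeasure (hβ : 0 < β) (t : E) :
    ∫ x, Real.exp (inner ℝ t x - ‖t‖ ^ 2 / (2 * β)) ∂gaussMeasure E β = 1 := by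
  have := isProbabilityMeasure_gaussMeasure (E := E) hβ
  rw [integral_gaussMeasure hβ]
  simp only [smul_eq_mul, maxwell_mul_exp_inner hβ]
  rw [integral_sub_right_eq_self (fun x => maxwell β x)]
  simpa using (integral_gaussMeasure hβ (fun _ : E => (1 : ℝ))).symm

/-- The Bochner integral of a non-integrable function is `0`, so the value `1` forces integrability.
-/
theorem integrable_exp_inner_gaussMeasure (hβ : 0 < β) (t : E) :
    Integrable (fun x => Real.exp (inner ℝ t x - ‖t‖ ^ 2 / (2 * β))) (gaussMeasure E β) := by
  by_contra h
  have := integral_exp_inner_gaussMeasure hβ t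
  rw [integral_undef h] at this
  exact zero_ne_one this

/-- The Gaussian product measure is invariant under rotations in the plane of the two factors. -/
theorem gaussMeasure_rotation (hβ : 0 < β) {a b : ℝ} (hab : a ^ 2 + b ^ 2 = 1) :
    MeasurePreserving (fun p : E × E => (a • p.1 + b • p.2, -b • p.1 + a • p.2))
      ((gaussMeasure E β).prod (gaussMeasure E β))
      ((gaussMeasure E β).prod (gaussMeasure E β)) := by
  let r : WithLp 2 (E × E) →ₗᵢ[ℝ] WithLp 2 (E × E) :=
    { toFun := fun z => WithLp.toLp 2 (a • z.fst + b • z.snd, -b • z.fst + a • z.snd)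
      map_add' := by
        intro x y
        apply (WithLp.equiv 2 (E × E)).injective
        ext <;> simp <;> abel
      map_smul' := by
        intro c x
        apply (WithLp.equiv 2 (E × E)).injective
        ext <;> simp [smul_smul, mul_comm]
      norm_map' := by
        intro z
        rw [← sq_eq_sq₀ (norm_nonneg _) (norm_nonneg _), WithLp.prod_norm_sq_eq_of_L2,
          WithLp.prod_norm_sq_eq_of_L2]
        simp only [LinearMap.coe_mk, AddHom.coe_mk, WithLp.toLp_fst, WithLp.toLp_snd]
        rw [norm_add_sq_real, norm_add_sq_real]
        simp only [norm_smul, inner_smul_left, inner_smul_right, mul_pow, norm_neg,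
          Real.norm_eq_abs, sq_abs]
        simp
        linear_combination (‖z.fst‖ ^ 2 + ‖z.snd‖ ^ 2) * hab }
  have h1 := gaussMeasure_isometry β (r.toLinearIsometryEquiv rfl)
  have h2 : MeasurePreserving (WithLp.ofLp : WithLp 2 (E × E) → E × E)
      (gaussMeasure (WithLp 2 (E × E)) β) ((gaussMeasure E β).prod (gaussMeasure E β)) := by
    have h := gaussMeasure_prod (E := E) (F := E) hβ
    exact h.symm (MeasurableEquiv.toLp 2 (E × E))
  exact h2.comp (h1.comp (gaussMeasure_prod (E := E) (F := E) hβ))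

theorem measurePreserving_comb (hβ : 0 < β) {a b : ℝ} (hab : a ^ 2 + b ^ 2 = 1) :
    MeasurePreserving (fun p : E × E => a • p.1 + b • p.2)
      ((gaussMeasure E β).prod (gaussMeasure E β)) (gaussMeasure E β) := by
  have := isProbabilityMeasure_gaussMeasure (E := E) hβ
  exact measurePreserving_fst.comp (gaussMeasure_rotation hβ hab)

/-! ### The Mehler kernel -/

/-- The density with respect to `γ` of the law of `a v + b x`, where `x` has law `γ`. -/
def mehlerKernel (β a b : ℝ) (v y : E) : ℝ :=
  (b ^ Module.finrank ℝ E)⁻¹ *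
    Real.exp (β / 2 * ‖v‖ ^ 2 - β / (2 * b ^ 2) * ‖v - a • y‖ ^ 2)

theorem mehlerKernel_pos {a b : ℝ} (hb : 0 < b) (v y : E) : 0 < mehlerKernel β a b v y := by
  unfold mehlerKernel; positivity

theorem continuous_mehlerKernel (a b : ℝ) :
    Continuous (fun p : E × E => mehlerKernel β a b p.1 p.2) := by
  unfold mehlerKernel; fun_prop

/-- With `a² = 1 - b²` the quadratic forms in the exponents coincide. The right side is the Lebesgue
density at `y` of the law of `a v + b x`. -/
theorem maxwell_mul_mehlerKernel {a b : ℝ} (hb : 0 < b) (hab : a ^ 2 + b ^ 2 = 1) (v y : E) :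
    maxwell β y * mehlerKernel β a b v y =
      (b ^ Module.finrank ℝ E)⁻¹ * maxwell β (b⁻¹ • (y - a • v)) := by
  simp only [maxwell, mehlerKernel]
  rw [mul_mul_mul_comm, ← Real.exp_add, mul_left_comm, mul_assoc]
  congr 3
  simp only [norm_smul, mul_pow, Real.norm_eq_abs, sq_abs, norm_sub_sq_real, inner_smul_right,
    real_inner_comm v y]
  have h : a ^ 2 = 1 - b ^ 2 := by linarith
  rw [h]
  field_simp
  ring

theorem lintegral_affine {a b : ℝ} (hβ : 0 < β) (hb : 0 < b) (hab : a ^ 2 + b ^ 2 = 1) (v : E)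
    {f : E → ℝ≥0∞} (hf : Measurable f) :
    ∫⁻ x, f (a • v + b • x) ∂gaussMeasure E β =
      ∫⁻ y, ENNReal.ofReal (mehlerKernel β a b v y) * f y ∂gaussMeasure E β := by
  have hK : Continuous (mehlerKernel (E := E) β a b v) := by unfold mehlerKernel; fun_prop
  have hmap : Measure.map (fun x : E => a • v + b • x) volume =
      ENNReal.ofReal ((b ^ Module.finrank ℝ E)⁻¹) • (volume : Measure E) := by
    have h1 := Measure.map_addHaar_smul (volume : Measure E) hb.ne'
    have : (fun x : E => a • v + b • x) = (fun y => a • v + y) ∘ (fun x => b • x) := rfl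
    rw [this, ← Measure.map_map (by fun_prop) (by fun_prop), h1, Measure.map_smul,
      map_add_left_eq_self, abs_of_pos (by positivity)]
  rw [lintegral_gaussMeasure (fun x => f (a • v + b • x)) (hf.comp (by fun_prop)),
    lintegral_gaussMeasure (fun y => ENNReal.ofReal (mehlerKernel β a b v y) * f y)
      (hK.measurable.ennreal_ofReal.mul hf)]
  have e1 : ∀ x, ENNReal.ofReal (maxwell β x) * f (a • v + b • x) =
      (fun y => ENNReal.ofReal (maxwell β (b⁻¹ • (y - a • v))) * f y) (a • v + b • x) := by
    intro x
    simp [smul_smul, hb.ne']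
  have hm : Measurable (fun y : E => ENNReal.ofReal (maxwell β (b⁻¹ • (y - a • v))) * f y) :=
    (((maxwell_continuous β).comp (by fun_prop)).measurable.ennreal_ofReal).mul hf
  simp_rw [e1]
  rw [← lintegral_map hm (by fun_prop), hmap, lintegral_smul_measure, smul_eq_mul,
    ← lintegral_const_mul _ hm]
  refine lintegral_congr fun y => ?_
  rw [← mul_assoc, ← mul_assoc, ← ENNReal.ofReal_mul (by positivity),
    ← ENNReal.ofReal_mul (maxwell_pos hβ y).le, maxwell_mul_mehlerKernel hb hab]

theorem map_affine_gaussMeasure {a b : ℝ} (hβ : 0 < β) (hb : 0 < b) (hab : a ^ 2 + b ^ 2 = 1)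
    (v : E) : Measure.map (fun x : E => a • v + b • x) (gaussMeasure E β) =
      (gaussMeasure E β).withDensity (fun y => ENNReal.ofReal (mehlerKernel β a b v y)) := by
  ext s hs
  have h := lintegral_affine hβ hb hab v (f := s.indicator 1) (measurable_one.indicator hs)
  rw [Measure.map_apply (by fun_prop) hs, withDensity_apply _ hs, ← lintegral_indicator hs]
  have e : ∀ x : E, s.indicator (1 : E → ℝ≥0∞) (a • v + b • x) =
      ((fun x : E => a • v + b • x) ⁻¹' s).indicator 1 x := fun x => rfl
  simp_rw [e] at h
  rw [lintegral_indicator_one (hs.preimage (by fun_prop))] at h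
  rw [h]
  refine lintegral_congr fun y => ?_
  by_cases hy : y ∈ s <;> simp [hy]

theorem measurable_mehlerKernel (a b : ℝ) (v : E) : Measurable (mehlerKernel β a b v) :=
  ((continuous_mehlerKernel a b).comp (Continuous.prodMk_right v)).measurable

/-- For `b ≠ 0` the affine map is a homeomorphism, so the change of variables holds for every `f`,
without measurability or integrability. -/
theorem integral_affine {F : Type*} [NormedAddCommGroup F] [NormedSpace ℝ F] {a b : ℝ}
    (hβ : 0 < β) (hb : 0 < b) (hab : a ^ 2 + b ^ 2 = 1) (v : E) (f : E → F) :
    ∫ x, f (a • v + b • x) ∂gaussMeasure E β =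
      ∫ y, mehlerKernel β a b v y • f y ∂gaussMeasure E β := by
  have hemb : MeasurableEmbedding (fun x : E => a • v + b • x) :=
    ((Homeomorph.smulOfNeZero b hb.ne').trans (Homeomorph.addLeft (a • v))).measurableEmbedding
  rw [← hemb.integral_map, map_affine_gaussMeasure hβ hb hab,
    integral_withDensity_eq_integral_toReal_smul
    (measurable_mehlerKernel a b v).ennreal_ofReal (.of_forall fun _ => ENNReal.ofReal_lt_top)]
  refine integral_congr_ae (.of_forall fun x => ?_)
  simp only [ENNReal.toReal_ofReal (mehlerKernel_pos hb v x).le]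

theorem integrable_affine {F : Type*} [NormedAddCommGroup F] [NormedSpace ℝ F] {a b : ℝ}
    (hβ : 0 < β) (hb : 0 < b) (hab : a ^ 2 + b ^ 2 = 1) (v : E) (f : E → F) :
    Integrable (fun x => f (a • v + b • x)) (gaussMeasure E β) ↔
      Integrable (fun y => mehlerKernel β a b v y • f y) (gaussMeasure E β) := by
  have hemb : MeasurableEmbedding (fun x : E => a • v + b • x) :=
    ((Homeomorph.smulOfNeZero b hb.ne').trans (Homeomorph.addLeft (a • v))).measurableEmbedding
  have h := hemb.integrable_map_iff (μ := gaussMeasure E β) (g := f)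
  rw [Function.comp_def] at h
  rw [← h, map_affine_gaussMeasure hβ hb hab,
    integrable_withDensity_iff_integrable_smul'
    (measurable_mehlerKernel a b v).ennreal_ofReal (.of_forall fun _ => ENNReal.ofReal_lt_top)]
  refine integrable_congr (.of_forall fun x => ?_)
  simp only [ENNReal.toReal_ofReal (mehlerKernel_pos hb v x).le]

end GaussTools

section Mehler

variable {E : Type*} [NormedAddCommGroup E] [InnerProductSpace ℝ E] [FiniteDimensional ℝ E]
  [MeasurableSpace E] [BorelSpace E] {β : ℝ}

/-! ### Smoothing by the Mehler kernel -/

theorem hasGradientAt_integral_of_dominated {α : Type*} [MeasurableSpace α] {μ : Measure α}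
    {F : E → α → ℝ} {G : E → α → E} {bound : α → ℝ} {v₀ : E} {s : Set E} (hs : s ∈ 𝓝 v₀)
    (hF_meas : ∀ v, AEStronglyMeasurable (F v) μ) (hF_int : Integrable (F v₀) μ)
    (hG_meas : AEStronglyMeasurable (G v₀) μ)
    (h_bound : ∀ᵐ y ∂μ, ∀ v ∈ s, ‖G v y‖ ≤ bound y) (hbound : Integrable bound μ)
    (h_diff : ∀ᵐ y ∂μ, ∀ v ∈ s, HasGradientAt (fun v => F v y) (G v y) v) :
    HasGradientAt (fun v => ∫ y, F v y ∂μ) (∫ y, G v₀ y ∂μ) v₀ := by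
  have hcont := (InnerProductSpace.toDual ℝ E).continuous
  have hm : AEStronglyMeasurable (fun y => InnerProductSpace.toDual ℝ E (G v₀ y)) μ :=
    hcont.comp_aestronglyMeasurable hG_meas
  have hGint : Integrable (G v₀) μ := hbound.mono' hG_meas
    (h_bound.mono fun y hy => hy v₀ (mem_of_mem_nhds hs))
  have h := hasFDerivAt_integral_of_dominated_of_fderiv_le (𝕜 := ℝ) (μ := μ) (F := F)
    (F' := fun v y => InnerProductSpace.toDual ℝ E (G v y)) hs (.of_forall hF_meas) hF_int hm
    (h_bound.mono fun y hy v hv => by simpa using hy v hv) hbound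
    (h_diff.mono fun y hy v hv => (hy v hv).hasFDerivAt)
  rw [hasGradientAt_iff_hasFDerivAt]
  refine h.congr_fderiv ?_
  ext w
  have hi : Integrable (fun y => InnerProductSpace.toDual ℝ E (G v₀ y)) μ :=
    (hGint.norm.mono' hm (.of_forall fun y => by simp))
  rw [ContinuousLinearMap.integral_apply hi]
  simp only [InnerProductSpace.toDual_apply_apply]
  rw [real_inner_comm w, ← integral_inner hGint]
  exact integral_congr_ae (.of_forall fun y => real_inner_comm _ _)

/-- The average `∫ h (a v + b x) γ(x) dx`. -/
def mehler (β a b : ℝ) (h : E → ℝ) (v : E) : ℝ := ∫ x, h (a • v + b • x) ∂gaussMeasure E β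

/-- The gradient of `mehler β a b h`. -/
def mehlerGrad (β a b : ℝ) (h : E → ℝ) (v : E) : E :=
  (a * β / b) • ∫ x, h (a • v + b • x) • x ∂gaussMeasure E β

/-- The gradient of the Mehler kernel in its first argument. -/
def mehlerKernelGrad (β a b : ℝ) (v y : E) : E :=
  mehlerKernel β a b v y • (a * β / b ^ 2) • (y - a • v)

theorem hasGradientAt_mehlerKernel {a b : ℝ} (hb : 0 < b) (hab : a ^ 2 + b ^ 2 = 1) (v y : E) :
    HasGradientAt (fun v => mehlerKernel β a b v y) (mehlerKernelGrad β a b v y) v := by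
  rw [hasGradientAt_iff_hasFDerivAt]
  have h1 : HasFDerivAt (fun v : E => ‖v‖ ^ 2) (2 • innerSL ℝ v) v := by
    simpa using (hasFDerivAt_id (𝕜 := ℝ) v).norm_sq
  have h2 : HasFDerivAt (fun v : E => ‖v - a • y‖ ^ 2) (2 • innerSL ℝ (v - a • y)) v := by
    have := ((hasFDerivAt_id (𝕜 := ℝ) v).sub_const (a • y)).norm_sq
    simpa using this
  have h3 := (((h1.const_mul (β / 2)).sub (h2.const_mul (β / (2 * b ^ 2)))).exp).const_mul
    (b ^ Module.finrank ℝ E)⁻¹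
  refine h3.congr_fderiv ?_
  ext w
  simp only [mehlerKernelGrad, mehlerKernel, InnerProductSpace.toDual_apply_apply,
    smul_apply, sub_apply, innerSL_apply_apply,
    smul_eq_mul, inner_smul_left, inner_sub_left, nsmul_eq_mul, conj_trivial]
  have h : a ^ 2 = 1 - b ^ 2 := by linarith
  -- The two forms of the logarithmic derivative of the kernel agree because `a² = 1 - b²`.
  have e : a * β / b ^ 2 * (inner ℝ y w - a * inner ℝ v w) =
      β * inner ℝ v w - β / b ^ 2 * (inner ℝ v w - a * inner ℝ y w) := by
    field_simp
    linear_combination (-(β * inner ℝ v w)) * h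
  rw [e]
  simp only [Pi.sub_apply]
  push_cast
  field_simp

theorem continuous_mehlerKernelGrad (a b : ℝ) :
    Continuous (fun p : E × E => mehlerKernelGrad β a b p.1 p.2) := by
  unfold mehlerKernelGrad
  exact (continuous_mehlerKernel a b).smul (by fun_prop)

theorem mehlerKernel_le {a b R : ℝ} (hβ : 0 < β) (hb : 0 < b) {v : E} (hv : ‖v‖ ≤ R) (y : E) :
    mehlerKernel β a b v y ≤ (b ^ Module.finrank ℝ E)⁻¹ * Real.exp (β / 2 * R ^ 2) := by
  unfold mehlerKernel
  have : 0 ≤ β / (2 * b ^ 2) * ‖v - a • y‖ ^ 2 := by positivity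
  have : β / 2 * ‖v‖ ^ 2 ≤ β / 2 * R ^ 2 := by gcongr
  gcongr
  linarith

/-- Uniformity in `y` is the point: it lets the gradient be taken under the integral for every `h`
that is merely in `L¹(γ)`. -/
theorem exists_norm_mehlerKernelGrad_le {a b : ℝ} (hβ : 0 < β) (hb : 0 < b)
    (hab : a ^ 2 + b ^ 2 = 1) (R : ℝ) :
    ∃ C, ∀ v : E, ‖v‖ ≤ R → ∀ y, ‖mehlerKernelGrad β a b v y‖ ≤ C := by
  set B := (b ^ Module.finrank ℝ E)⁻¹ * Real.exp (β / 2 * R ^ 2)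
  set c := β / (2 * b ^ 2)
  have hc : 0 < c := by positivity
  refine ⟨B * (β * R) + B * (β / b ^ 2) * (1 + 1 / c), fun v hv y => ?_⟩
  have hR : 0 ≤ R := (norm_nonneg v).trans hv
  have hBpos : 0 ≤ B := by positivity
  -- The linear factor is expressed through `v`, which is bounded by `R`, and `v - a y`, which the
  -- kernel's own Gaussian decay controls.
  have e : (a * β / b ^ 2) • (y - a • v) = β • v - (β / b ^ 2) • (v - a • y) := by
    have h : a ^ 2 = 1 - b ^ 2 := by linarith
    have h1 : a * β / b ^ 2 * a = β / b ^ 2 - β := by field_simp; linear_combination h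
    rw [smul_sub, smul_smul, smul_sub, smul_smul, h1, sub_smul, mul_comm (β / b ^ 2) a,
      ← mul_div_assoc]
    abel
  have hK := mehlerKernel_le (a := a) hβ hb hv y
  have hKpos := mehlerKernel_pos (β := β) (a := a) hb v y
  have hz := mul_exp_neg_sq_le hc (norm_nonneg (v - a • y))
  have hKz : mehlerKernel β a b v y * ‖v - a • y‖ ≤ B * (1 + 1 / c) := by
    have : mehlerKernel β a b v y = (b ^ Module.finrank ℝ E)⁻¹ * Real.exp (β / 2 * ‖v‖ ^ 2) *
        Real.exp (-(c * ‖v - a • y‖ ^ 2)) := by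
      rw [mul_assoc, ← Real.exp_add]; rfl
    rw [this]
    calc _ = (b ^ Module.finrank ℝ E)⁻¹ * Real.exp (β / 2 * ‖v‖ ^ 2) *
        (‖v - a • y‖ * Real.exp (-(c * ‖v - a • y‖ ^ 2))) := by ring
      _ ≤ B * (1 + 1 / c) := by
        simp only [B]
        gcongr
  rw [mehlerKernelGrad, e, norm_smul, Real.norm_of_nonneg hKpos.le]
  calc mehlerKernel β a b v y * ‖β • v - (β / b ^ 2) • (v - a • y)‖
      ≤ mehlerKernel β a b v y * (β * ‖v‖ + (β / b ^ 2) * ‖v - a • y‖) := by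
        gcongr
        refine (norm_sub_le _ _).trans_eq ?_
        rw [norm_smul, norm_smul, Real.norm_of_nonneg hβ.le, Real.norm_of_nonneg (by positivity)]
    _ = mehlerKernel β a b v y * (β * ‖v‖) +
        (β / b ^ 2) * (mehlerKernel β a b v y * ‖v - a • y‖) := by ring
    _ ≤ B * (β * R) + (β / b ^ 2) * (B * (1 + 1 / c)) := by gcongr
    _ = _ := by ring

section

variable {a b : ℝ} {h : E → ℝ}

theorem integrable_mehlerKernel_mul (hβ : 0 < β) (hb : 0 < b)
    (hh : Integrable h (gaussMeasure E β)) (v : E) :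
    Integrable (fun y => mehlerKernel β a b v y * h y) (gaussMeasure E β) :=
  hh.bdd_mul (measurable_mehlerKernel a b v).aestronglyMeasurable
    (.of_forall fun y => by
      rw [Real.norm_of_nonneg (mehlerKernel_pos hb v y).le]
      exact mehlerKernel_le hβ hb le_rfl y)

theorem integrable_comp_affine (hβ : 0 < β) (hb : 0 < b) (hab : a ^ 2 + b ^ 2 = 1)
    (hh : Integrable h (gaussMeasure E β)) (v : E) :
    Integrable (fun x => h (a • v + b • x)) (gaussMeasure E β) :=
  (integrable_affine hβ hb hab v h).2 (integrable_mehlerKernel_mul hβ hb hh v)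

theorem mehler_eq (hβ : 0 < β) (hb : 0 < b) (hab : a ^ 2 + b ^ 2 = 1) (v : E) :
    mehler β a b h v = ∫ y, mehlerKernel β a b v y * h y ∂gaussMeasure E β :=
  integral_affine hβ hb hab v h

/-- The law of `a v + b x` has a density for every `v`. Hence almost everywhere equal functions have
averages that agree at every point. -/
theorem mehler_congr_ae (hβ : 0 < β) (hb : 0 < b) (hab : a ^ 2 + b ^ 2 = 1) {h' : E → ℝ}
    (hh : h =ᵐ[gaussMeasure E β] h') : mehler β a b h = mehler β a b h' := by
  ext v
  rw [mehler_eq hβ hb hab, mehler_eq hβ hb hab]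
  exact integral_congr_ae (hh.mono fun y hy => by simp only [hy])

theorem integrable_mehlerKernelGrad_smul (hβ : 0 < β) (hb : 0 < b) (hab : a ^ 2 + b ^ 2 = 1)
    (hh : Integrable h (gaussMeasure E β)) (v : E) :
    Integrable (fun y => h y • mehlerKernelGrad β a b v y) (gaussMeasure E β) := by
  obtain ⟨C, hC⟩ := exists_norm_mehlerKernelGrad_le (E := E) hβ hb hab ‖v‖
  have hm : AEStronglyMeasurable (fun y => mehlerKernelGrad β a b v y) (gaussMeasure E β) :=
    ((continuous_mehlerKernelGrad a b).comp (Continuous.prodMk_right v)).aestronglyMeasurable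
  refine (hh.norm.mul_const C).mono' (hh.aestronglyMeasurable.smul hm) (.of_forall fun y => ?_)
  rw [norm_smul]
  gcongr
  exact hC v le_rfl y

theorem mehlerGrad_eq (hβ : 0 < β) (hb : 0 < b) (hab : a ^ 2 + b ^ 2 = 1) (v : E) :
    mehlerGrad β a b h v = ∫ y, h y • mehlerKernelGrad β a b v y ∂gaussMeasure E β := by
  rw [mehlerGrad, ← integral_smul]
  have e : ∀ x : E, (a * β / b) • h (a • v + b • x) • x =
      (fun y => h y • (a * β / b ^ 2) • (y - a • v)) (a • v + b • x) := by
    intro x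
    simp only [add_sub_cancel_left, smul_smul]
    congr 1
    field_simp
  simp_rw [e]
  rw [integral_affine hβ hb hab v (fun y => h y • (a * β / b ^ 2) • (y - a • v))]
  refine integral_congr_ae (.of_forall fun y => ?_)
  simp only [mehlerKernelGrad]
  rw [smul_comm]

/-- Read off from integrability against the kernel gradient. That gradient carries a factor `a`,
whence the condition `a ≠ 0`. -/
theorem integrable_comp_affine_smul (hβ : 0 < β) (hb : 0 < b) (ha : a ≠ 0)
    (hab : a ^ 2 + b ^ 2 = 1) (hh : Integrable h (gaussMeasure E β)) (v : E) :
    Integrable (fun x => h (a • v + b • x) • x) (gaussMeasure E β) := by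
  have h1 := (integrable_affine hβ hb hab v (fun y => h y • (a * β / b ^ 2) • (y - a • v))).2 (by
    refine (integrable_mehlerKernelGrad_smul hβ hb hab hh v).congr (.of_forall fun y => ?_)
    simp only [mehlerKernelGrad]
    rw [smul_comm])
  refine (h1.smul (b / (a * β))).congr (.of_forall fun x => ?_)
  simp only [add_sub_cancel_left, smul_smul, Pi.smul_apply]
  congr 1
  field_simp

/-- All derivatives fall on the kernel, so no regularity of `h` is needed. -/
theorem hasGradientAt_mehler (hβ : 0 < β) (hb : 0 < b) (hab : a ^ 2 + b ^ 2 = 1)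
    (hh : Integrable h (gaussMeasure E β)) (v : E) :
    HasGradientAt (mehler β a b h) (mehlerGrad β a b h v) v := by
  obtain ⟨C, hC⟩ := exists_norm_mehlerKernelGrad_le (E := E) hβ hb hab (‖v‖ + 1)
  have e : mehler β a b h = fun v => ∫ y, mehlerKernel β a b v y * h y ∂gaussMeasure E β :=
    funext fun v => mehler_eq hβ hb hab v
  rw [e, mehlerGrad_eq hβ hb hab]
  refine hasGradientAt_integral_of_dominated (μ := gaussMeasure E β)
    (F := fun v y => mehlerKernel β a b v y * h y)
    (G := fun v y => h y • mehlerKernelGrad β a b v y) (bound := fun y => ‖h y‖ * C)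
    (Metric.ball_mem_nhds v one_pos)
    (fun w => (integrable_mehlerKernel_mul hβ hb hh w).aestronglyMeasurable)
    (integrable_mehlerKernel_mul hβ hb hh v)
    (integrable_mehlerKernelGrad_smul hβ hb hab hh v).aestronglyMeasurable
    (.of_forall fun y w hw => ?_) (hh.norm.mul_const C) (.of_forall fun y w _ => ?_)
  · rw [norm_smul]
    gcongr
    refine hC w ?_ y
    rw [Metric.mem_ball, dist_eq_norm] at hw
    calc ‖w‖ = ‖v + (w - v)‖ := by simp
      _ ≤ ‖v‖ + ‖w - v‖ := norm_add_le _ _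
      _ ≤ _ := by linarith
  · have := hasGradientAt_mehlerKernel (β := β) hb hab w y
    rw [hasGradientAt_iff_hasFDerivAt] at this ⊢
    rw [map_smul]
    exact this.mul_const _

theorem continuous_mehlerGrad (hβ : 0 < β) (hb : 0 < b) (hab : a ^ 2 + b ^ 2 = 1)
    (hh : Integrable h (gaussMeasure E β)) : Continuous (mehlerGrad β a b h) := by
  have e : mehlerGrad β a b h =
      fun v => ∫ y, h y • mehlerKernelGrad β a b v y ∂gaussMeasure E β :=
    funext fun v => mehlerGrad_eq hβ hb hab v
  rw [e, continuous_iff_continuousAt]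
  intro v
  obtain ⟨C, hC⟩ := exists_norm_mehlerKernelGrad_le (E := E) hβ hb hab (‖v‖ + 1)
  refine continuousAt_of_dominated (bound := fun y => ‖h y‖ * C)
    (.of_forall fun w => (integrable_mehlerKernelGrad_smul hβ hb hab hh w).aestronglyMeasurable)
    ?_ (hh.norm.mul_const C) (.of_forall fun y => ?_)
  · filter_upwards [Metric.ball_mem_nhds v one_pos] with w hw
    refine .of_forall fun y => ?_
    rw [norm_smul]
    gcongr
    refine hC w ?_ y
    rw [Metric.mem_ball, dist_eq_norm] at hw
    calc ‖w‖ = ‖v + (w - v)‖ := by simp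
      _ ≤ ‖v‖ + ‖w - v‖ := norm_add_le _ _
      _ ≤ _ := by linarith
  · exact (((continuous_mehlerKernelGrad a b).comp
      (Continuous.prodMk_left y)).const_smul (h y)).continuousAt

theorem continuous_mehler (hβ : 0 < β) (hb : 0 < b) (hab : a ^ 2 + b ^ 2 = 1)
    (hh : Integrable h (gaussMeasure E β)) : Continuous (mehler β a b h) :=
  continuous_iff_continuousAt.2 fun v => (hasGradientAt_mehler hβ hb hab hh v).continuousAt

theorem mehler_pos (hβ : 0 < β) (hb : 0 < b) (hab : a ^ 2 + b ^ 2 = 1)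
    (hh : Integrable h (gaussMeasure E β)) (h0 : 0 ≤ᵐ[gaussMeasure E β] h)
    (hpos : 0 < ∫ y, h y ∂gaussMeasure E β) (v : E) : 0 < mehler β a b h v := by
  rw [mehler_eq hβ hb hab]
  have h0' : 0 ≤ᵐ[gaussMeasure E β] fun y => mehlerKernel β a b v y * h y :=
    h0.mono fun y hy => mul_nonneg (mehlerKernel_pos hb v y).le hy
  rw [integral_pos_iff_support_of_nonneg_ae h0' (integrable_mehlerKernel_mul hβ hb hh v)]
  rw [integral_pos_iff_support_of_nonneg_ae h0 hh] at hpos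
  convert hpos using 2
  ext y
  simp [(mehlerKernel_pos (β := β) (a := a) hb v y).ne']

theorem integrable_mehler (hβ : 0 < β) (hab : a ^ 2 + b ^ 2 = 1)
    (hh : Integrable h (gaussMeasure E β)) : Integrable (mehler β a b h) (gaussMeasure E β) := by
  have := isProbabilityMeasure_gaussMeasure (E := E) hβ
  exact ((measurePreserving_comb hβ hab).integrable_comp_of_integrable hh).integral_prod_left

theorem integral_mehler (hβ : 0 < β) (hab : a ^ 2 + b ^ 2 = 1)
    (hh : Integrable h (gaussMeasure E β)) :
    ∫ v, mehler β a b h v ∂gaussMeasure E β = ∫ v, h v ∂gaussMeasure E β := by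
  have := isProbabilityMeasure_gaussMeasure (E := E) hβ
  have hp := measurePreserving_comb (E := E) hβ hab
  have h1 := integral_prod _ (hp.integrable_comp_of_integrable hh)
  rw [show (∫ v, mehler β a b h v ∂gaussMeasure E β) = _ from h1.symm]
  have h2 := integral_map (φ := fun p : E × E => a • p.1 + b • p.2) (f := h) hp.aemeasurable
    (hp.map_eq.symm ▸ hh.aestronglyMeasurable)
  rw [hp.map_eq] at h2
  exact h2.symm

theorem lintegral_lintegral_comb (hβ : 0 < β) (hab : a ^ 2 + b ^ 2 = 1) {f : E → ℝ≥0∞}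
    (hf : AEMeasurable f (gaussMeasure E β)) :
    ∫⁻ v, ∫⁻ x, f (a • v + b • x) ∂gaussMeasure E β ∂gaussMeasure E β =
      ∫⁻ v, f v ∂gaussMeasure E β := by
  have hp := measurePreserving_comb (E := E) hβ hab
  rw [← lintegral_prod (fun p : E × E => f (a • p.1 + b • p.2))
    (hf.comp_quasiMeasurePreserving hp.quasiMeasurePreserving)]
  exact (lintegral_map' (hp.map_eq.symm ▸ hf) hp.aemeasurable).symm.trans (by rw [hp.map_eq])

/-- Smoothing a bounded function gives a bounded gradient, the one property of `IsRegular` that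
truncation alone does not supply. -/
theorem norm_mehlerGrad_le (hβ : 0 < β) (hb : 0 < b) {K : ℝ} (hK : ∀ x, |h x| ≤ K) (v : E) :
    ‖mehlerGrad β a b h v‖ ≤ |a| * β / b * (K * ∫ x : E, ‖x‖ ∂gaussMeasure E β) := by
  rw [mehlerGrad, norm_smul, Real.norm_eq_abs, abs_div, abs_mul, abs_of_pos hβ, abs_of_pos hb]
  gcongr
  rw [← integral_const_mul]
  refine norm_integral_le_of_norm_le ((integrable_norm_gaussMeasure hβ).const_mul K)
    (.of_forall fun x => ?_)
  rw [norm_smul]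
  gcongr
  exact hK _

end

end Mehler

section Entropy

variable {E : Type*} [NormedAddCommGroup E] [InnerProductSpace ℝ E] [FiniteDimensional ℝ E]
  [MeasurableSpace E] [BorelSpace E] {β : ℝ}

/-! ### Entropy and information, and the decay of the entropy along the semigroup -/

/-- The relative entropy of `h γ` with respect to `γ`, with the nonnegative integrand
`h ln h - h + 1`. -/
def entropy (β : ℝ) (h : E → ℝ) : ℝ≥0∞ :=
  ∫⁻ v, ENNReal.ofReal (klFun (h v)) ∂gaussMeasure E β

/-- The Fisher information of a function `g` with gradient `g'`. -/
def information (β : ℝ) (g : E → ℝ) (g' : E → E) : ℝ≥0∞ :=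
  ∫⁻ v, ‖g' v‖ₑ ^ 2 / ENNReal.ofReal (g v) ∂gaussMeasure E β

theorem enorm_sq_div_ofReal {F : Type*} [NormedAddCommGroup F] (x : F) {m : ℝ} (hm : 0 < m) :
    ‖x‖ₑ ^ 2 / ENNReal.ofReal m = ENNReal.ofReal (‖x‖ ^ 2 / m) := by
  rw [ENNReal.ofReal_div_of_pos hm, ← ofReal_norm, ENNReal.ofReal_pow (norm_nonneg _)]

/-- No integrability is required: the integral of a non-integrable function is `0`. -/
theorem ofReal_integral_le_lintegral {α : Type*} [MeasurableSpace α] {μ : Measure α} (f : α → ℝ) :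
    ENNReal.ofReal (∫ x, f x ∂μ) ≤ ∫⁻ x, ENNReal.ofReal (f x) ∂μ := by
  by_cases hf : Integrable f μ
  · have h1 : ∫ x, f x ∂μ ≤ ∫ x, max (f x) 0 ∂μ :=
      integral_mono hf hf.pos_part fun x => le_max_left _ _
    refine (ENNReal.ofReal_le_ofReal h1).trans ?_
    rw [ofReal_integral_eq_lintegral_ofReal hf.pos_part (.of_forall fun x => le_max_right _ _)]
    refine lintegral_mono fun x => ?_
    simp [ENNReal.ofReal_max]
  · simp [integral_undef hf]

/-- The Fenchel-Young inequality for `klFun`, whose convex conjugate is `l ↦ e^l - 1`. It reduces to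
`1 + y ≤ e^y` at `y = l - ln x`. -/
theorem mul_sub_exp_le_klFun {x : ℝ} (hx : 0 ≤ x) (l : ℝ) :
    x * l - (Real.exp l - 1) ≤ klFun x := by
  rw [klFun_apply]
  rcases hx.eq_or_lt with rfl | hx
  · have := Real.exp_pos l
    simp
    linarith
  · have h1 : x * (l - Real.log x + 1) ≤ x * Real.exp (l - Real.log x) := by
      gcongr
      exact Real.add_one_le_exp _
    rw [Real.exp_sub, Real.exp_log hx] at h1
    have h2 : x * (Real.exp l / x) = Real.exp l := by field_simp
    nlinarith

/-- `m klFun (g/m)` is the gap between `klFun` and its tangent at `m`. Fenchel-Young at `g/m` bounds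
this gap from below. When `m` is the mean of `g` and `e^l` has mean `1`, integration leaves `klFun m
+ ∫ g l`. -/
theorem klFun_tangent_le {g m : ℝ} (hg : 0 ≤ g) (hm : 0 < m) (l : ℝ) :
    klFun m + Real.log m * (g - m) + (g * l - m * (Real.exp l - 1)) ≤ klFun g := by
  have h := mul_le_mul_of_nonneg_left (mul_sub_exp_le_klFun (div_nonneg hg hm.le) l) hm.le
  have e1 : m * (g / m * l - (Real.exp l - 1)) = g * l - m * (Real.exp l - 1) := by field_simp
  have e2 : m * klFun (g / m) = klFun g - klFun m - Real.log m * (g - m) := by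
    simp only [klFun_apply]
    rcases hg.eq_or_lt with rfl | hg
    · simp; ring
    · rw [Real.log_div hg.ne' hm.ne']
      field_simp
      ring
  rw [e1, e2] at h
  linarith

/-- For fixed `v` let `g(x) = h(a v + b x)`, with mass `m` and first moment `ξ` under `γ`. Among
such densities the shifted Gaussian has the least entropy, which yields the excess `β|ξ|²/(2m)` over
`klFun m`. Since the gradient of the average is `(aβ/b) ξ`, this excess is a multiple of the
information integrand at `v`. -/
theorem ofReal_klFun_mehler_add_le {a b : ℝ} {h : E → ℝ} (hβ : 0 < β) (ha : 0 < a) (hb : 0 < b)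
    (hab : a ^ 2 + b ^ 2 = 1) (hh : Integrable h (gaussMeasure E β)) (h0 : ∀ x, 0 ≤ h x)
    (hpos : 0 < ∫ y, h y ∂gaussMeasure E β) (v : E) :
    ENNReal.ofReal (klFun (mehler β a b h v)) + ENNReal.ofReal (b ^ 2 / (2 * a ^ 2 * β)) *
        (‖mehlerGrad β a b h v‖ₑ ^ 2 / ENNReal.ofReal (mehler β a b h v)) ≤
      ∫⁻ x, ENNReal.ofReal (klFun (h (a • v + b • x))) ∂gaussMeasure E β := by
  have := isProbabilityMeasure_gaussMeasure (E := E) hβ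
  set m := mehler β a b h v with hm
  have hmpos : 0 < m := mehler_pos hβ hb hab hh (.of_forall h0) hpos v
  set g : E → ℝ := fun x => h (a • v + b • x) with hg
  have hgi : Integrable g (gaussMeasure E β) := integrable_comp_affine hβ hb hab hh v
  have hgx : Integrable (fun x => g x • x) (gaussMeasure E β) :=
    integrable_comp_affine_smul hβ hb ha.ne' hab hh v
  set ξ : E := ∫ x, g x • x ∂gaussMeasure E β with hξ
  -- The slope that maximises `⟨t, ξ⟩ - m|t|²/(2β)`; the maximum is `β|ξ|²/(2m)`.
  set t : E := (β / m) • ξ with ht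
  have hgm : ∫ x, g x ∂gaussMeasure E β = m := rfl
  have e := integrable_exp_inner_gaussMeasure hβ t
  have e' := integral_exp_inner_gaussMeasure hβ t
  have hgin : Integrable (fun x => inner ℝ t (g x • x)) (gaussMeasure E β) := hgx.const_inner t
  have i1 : Integrable (fun x => Real.log m * (g x - m)) (gaussMeasure E β) :=
    (hgi.sub (integrable_const m)).const_mul _
  have i2 : Integrable (fun x => inner ℝ t (g x • x) - g x * (‖t‖ ^ 2 / (2 * β)))
    (gaussMeasure E β) := hgin.sub (hgi.mul_const _)
  have i3 : Integrable (fun x => m * (Real.exp (inner ℝ t x - ‖t‖ ^ 2 / (2 * β)) - 1))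
    (gaussMeasure E β) := (e.sub (integrable_const 1)).const_mul _
  have key : ∫ x, (klFun m + Real.log m * (g x - m) + ((inner ℝ t (g x • x) -
      g x * (‖t‖ ^ 2 / (2 * β))) - m * (Real.exp (inner ℝ t x - ‖t‖ ^ 2 / (2 * β)) - 1)))
      ∂gaussMeasure E β = klFun m + β * ‖ξ‖ ^ 2 / (2 * m) := by
    have i01 : Integrable (fun x => klFun m + Real.log m * (g x - m)) (gaussMeasure E β) :=
      (integrable_const _).add i1
    have i23 : Integrable (fun x => (inner ℝ t (g x • x) - g x * (‖t‖ ^ 2 / (2 * β))) -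
      m * (Real.exp (inner ℝ t x - ‖t‖ ^ 2 / (2 * β)) - 1)) (gaussMeasure E β) := i2.sub i3
    rw [integral_add i01 i23,
      integral_add (integrable_const _) i1, integral_sub i2 i3, integral_sub hgin (hgi.mul_const _),
      integral_const_mul, integral_const_mul, integral_sub hgi (integrable_const _),
      integral_sub e (integrable_const _), e', integral_inner hgx, integral_mul_const, hgm]
    simp only [integral_const, probReal_univ, one_smul, sub_self, mul_zero, add_zero, sub_zero]
    rw [← hξ, ht, inner_smul_left, real_inner_self_eq_norm_sq, norm_smul, Real.norm_of_nonneg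
      (by positivity)]
    simp only [conj_trivial]
    field_simp
    ring
  have hgrad : ‖mehlerGrad β a b h v‖ ^ 2 = (a * β / b) ^ 2 * ‖ξ‖ ^ 2 := by
    rw [mehlerGrad, norm_smul, mul_pow, Real.norm_eq_abs, sq_abs]
  rw [enorm_sq_div_ofReal _ hmpos, hgrad, ← ENNReal.ofReal_mul (by positivity),
    ← ENNReal.ofReal_add (klFun_nonneg hmpos.le) (by positivity)]
  have e3 : klFun m + b ^ 2 / (2 * a ^ 2 * β) * ((a * β / b) ^ 2 * ‖ξ‖ ^ 2 / m) =
      klFun m + β * ‖ξ‖ ^ 2 / (2 * m) := by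
    field_simp
  rw [e3, ← key]
  refine (ofReal_integral_le_lintegral _).trans (lintegral_mono fun x => ?_)
  refine ENNReal.ofReal_le_ofReal ?_
  have := klFun_tangent_le (h0 (a • v + b • x)) hmpos (inner ℝ t x - ‖t‖ ^ 2 / (2 * β))
  refine le_trans (le_of_eq ?_) this
  rw [inner_smul_right]
  ring

/-- The entropy decreases along the Ornstein-Uhlenbeck semigroup, at least at the rate given by the
information at the later time. -/
theorem entropy_mehler_add_le {a b : ℝ} {h : E → ℝ} (hβ : 0 < β) (ha : 0 < a) (hb : 0 < b)
    (hab : a ^ 2 + b ^ 2 = 1) (hh : Integrable h (gaussMeasure E β)) (h0 : ∀ x, 0 ≤ h x)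
    (hpos : 0 < ∫ y, h y ∂gaussMeasure E β) :
    entropy β (mehler β a b h) + ENNReal.ofReal (b ^ 2 / (2 * a ^ 2 * β)) *
      information β (mehler β a b h) (mehlerGrad β a b h) ≤ entropy β h := by
  have hm : AEMeasurable (fun v => ENNReal.ofReal (klFun (h v))) (gaussMeasure E β) :=
    (measurable_klFun.comp_aemeasurable hh.aemeasurable).ennreal_ofReal
  have hm' : Measurable (fun v => ENNReal.ofReal (klFun (mehler β a b h v))) :=
    (continuous_klFun.comp (continuous_mehler hβ hb hab hh)).measurable.ennreal_ofReal
  -- Under `γ ⊗ γ` the combination `a v + b x` has law `γ`, so the entropy of `h` is the average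
  -- over `v` of the right sides of the pointwise bound.
  rw [entropy, entropy, information, ← lintegral_lintegral_comb hβ hab hm,
    ← lintegral_const_mul' _ _ ENNReal.ofReal_ne_top, ← lintegral_add_left hm']
  exact lintegral_mono fun v => ofReal_klFun_mehler_add_le hβ ha hb hab hh h0 hpos v

/-- A form of the Cauchy-Schwarz inequality. -/
theorem enorm_integral_sq_div_le {α F : Type*} [MeasurableSpace α] {μ : Measure α}
    [NormedAddCommGroup F] [NormedSpace ℝ F] {g : α → ℝ} {g' : α → F} (hg : Integrable g μ)
    (hpos : ∀ x, 0 < g x) (hg' : AEStronglyMeasurable g' μ) :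
    ‖∫ x, g' x ∂μ‖ₑ ^ 2 / ENNReal.ofReal (∫ x, g x ∂μ) ≤
      ∫⁻ x, ‖g' x‖ₑ ^ 2 / ENNReal.ofReal (g x) ∂μ := by
  have hgm : AEMeasurable (fun x => ENNReal.ofReal (g x)) μ := hg.aemeasurable.ennreal_ofReal
  refine ENNReal.div_le_of_le_mul ?_
  rw [ofReal_integral_eq_lintegral_ofReal hg (.of_forall fun x => (hpos x).le)]
  -- Hölder with exponents `2, 2` for the splitting `|g'| = (|g'|/√g) √g`.
  have h1 : ‖∫ x, g' x ∂μ‖ₑ ≤ ∫⁻ x, (fun x => ‖g' x‖ₑ / ENNReal.ofReal (g x) ^ (1 / 2 : ℝ)) x *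
      (fun x => ENNReal.ofReal (g x) ^ (1 / 2 : ℝ)) x ∂μ := by
    refine (enorm_integral_le_lintegral_enorm _).trans (lintegral_mono fun x => ?_)
    simp only
    rw [ENNReal.div_mul_cancel]
    · simp [hpos x]
    · simp
  have h2 := h1.trans (ENNReal.lintegral_mul_le_Lp_mul_Lq μ Real.HolderConjugate.two_two
    (hg'.enorm.div (hgm.pow_const _)) (hgm.pow_const _))
  have e1 : ∀ x, (‖g' x‖ₑ / ENNReal.ofReal (g x) ^ (1 / 2 : ℝ)) ^ (2 : ℝ) =
      ‖g' x‖ₑ ^ 2 / ENNReal.ofReal (g x) := by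
    intro x
    rw [ENNReal.div_rpow_of_nonneg _ _ (by norm_num), ← ENNReal.rpow_mul]
    norm_num
  have e2 : ∀ x, (ENNReal.ofReal (g x) ^ (1 / 2 : ℝ)) ^ (2 : ℝ) = ENNReal.ofReal (g x) := by
    intro x
    rw [← ENNReal.rpow_mul]
    norm_num
  simp only [e1, e2] at h2
  calc ‖∫ x, g' x ∂μ‖ₑ ^ 2 ≤ ((∫⁻ x, ‖g' x‖ₑ ^ 2 / ENNReal.ofReal (g x) ∂μ) ^ (1 / 2 : ℝ) *
        (∫⁻ x, ENNReal.ofReal (g x) ∂μ) ^ (1 / 2 : ℝ)) ^ 2 := by gcongr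
    _ = _ := by
      rw [mul_pow, ← ENNReal.rpow_natCast, ← ENNReal.rpow_natCast, ← ENNReal.rpow_mul,
        ← ENNReal.rpow_mul]
      norm_num

/-! ### Integration by parts -/

theorem hasGradientAt_maxwell (x : E) :
    HasGradientAt (maxwell β) (-(β * maxwell β x) • x) x := by
  rw [hasGradientAt_iff_hasFDerivAt]
  have h1 : HasFDerivAt (fun v : E => ‖v‖ ^ 2) (2 • innerSL ℝ x) x := by
    simpa using (hasFDerivAt_id (𝕜 := ℝ) x).norm_sq
  have h2 := ((h1.const_mul (-(β / 2))).exp).const_mul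
    ((β / (2 * Real.pi)) ^ ((Module.finrank ℝ E : ℝ) / 2))
  refine h2.congr_fderiv ?_
  ext w
  simp only [maxwell, InnerProductSpace.toDual_apply_apply, smul_apply, innerSL_apply_apply,
    smul_eq_mul, inner_smul_left, nsmul_eq_mul, conj_trivial]
  push_cast
  ring

/-- Gaussian integration by parts, from `∇γ = -β x γ`. -/
theorem integral_mul_inner_gaussMeasure (hβ : 0 < β) {k : E → ℝ} {k' : E → E}
    (hk : ∀ x, HasGradientAt k (k' x) x) (u : E) (hi : Integrable k (gaussMeasure E β))
    (h1 : Integrable (fun x => k x * inner ℝ u x) (gaussMeasure E β))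
    (h2 : Integrable (fun x => inner ℝ u (k' x)) (gaussMeasure E β)) :
    ∫ x, k x * inner ℝ u x ∂gaussMeasure E β =
      β⁻¹ * ∫ x, inner ℝ u (k' x) ∂gaussMeasure E β := by
  have d1 : ∀ x, fderiv ℝ k x u = inner ℝ u (k' x) := fun x => by
    rw [(hk x).fderiv_apply, real_inner_comm]
  have d2 : ∀ x : E, fderiv ℝ (maxwell β) x u = -(β * maxwell β x) * inner ℝ u x := fun x => by
    rw [(hasGradientAt_maxwell x).fderiv_apply, inner_smul_left, real_inner_comm]
    rfl
  rw [integrable_gaussMeasure hβ] at h1 h2 hi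
  simp only [smul_eq_mul] at h1 h2 hi
  have h := integral_mul_fderiv_eq_neg_fderiv_mul_of_integrable (μ := (volume : Measure E))
    (f := k) (g := maxwell β) (v := u)
    (by simp only [d1]; exact h2.congr (.of_forall fun x => mul_comm _ _))
    (by
      simp only [d2]
      exact (h1.const_mul (-β)).congr (.of_forall fun x => by ring))
    (hi.congr (.of_forall fun x => mul_comm _ _))
    (fun x _ => (hk x).differentiableAt) (fun x _ => (hasGradientAt_maxwell x).differentiableAt)
  simp only [d1, d2] at h
  rw [integral_gaussMeasure hβ, integral_gaussMeasure hβ]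
  simp only [smul_eq_mul]
  have e1 : ∫ x, k x * (-(β * maxwell β x) * inner ℝ u x) =
      -β * ∫ x, maxwell β x * (k x * inner ℝ u x) := by
    rw [← integral_const_mul]
    exact integral_congr_ae (.of_forall fun x => by ring)
  have e2 : ∫ x, inner ℝ u (k' x) * maxwell β x = ∫ x, maxwell β x * inner ℝ u (k' x) :=
    integral_congr_ae (.of_forall fun x => mul_comm _ _)
  rw [e1, e2] at h
  rw [eq_inv_mul_iff_mul_eq₀ hβ.ne']
  linarith

end Entropy

section LogSobolev

variable {E : Type*} [NormedAddCommGroup E] [InnerProductSpace ℝ E] [FiniteDimensional ℝ E]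
  [MeasurableSpace E] [BorelSpace E] {β : ℝ}

/-! ### The logarithmic Sobolev inequality -/

theorem HasGradientAt.comp_affine {g : E → ℝ} {g' p x : E} {c : ℝ}
    (hg : HasGradientAt g g' (p + c • x)) :
    HasGradientAt (fun x => g (p + c • x)) (c • g') x := by
  rw [hasGradientAt_iff_hasFDerivAt] at hg ⊢
  have h1 : HasFDerivAt (fun x : E => p + c • x) (c • ContinuousLinearMap.id ℝ E) x :=
    ((hasFDerivAt_id x).const_smul c).const_add p
  refine (hg.comp x h1).congr_fderiv ?_
  ext w
  simp

theorem hasGradientAt_scalar_comp {g : E → ℝ} {g' x : E} {ψ : ℝ → ℝ} {ψ' : ℝ}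
    (hψ : HasDerivAt ψ ψ' (g x)) (hg : HasGradientAt g g' x) :
    HasGradientAt (fun x => ψ (g x)) (ψ' • g') x := by
  rw [hasGradientAt_iff_hasFDerivAt] at hg ⊢
  refine (hψ.comp_hasFDerivAt x hg).congr_fderiv ?_
  ext w
  simp

/-- Continuously differentiable functions with values in `[ε, K]` and a gradient bounded by `C`. -/
structure IsRegular (f : E → ℝ) (f' : E → E) (ε K C : ℝ) : Prop where
  grad : ∀ x, HasGradientAt f (f' x) x
  cont : Continuous f'
  pos : 0 < ε
  lower : ∀ x, ε ≤ f x
  upper : ∀ x, f x ≤ K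
  bound : ∀ x, ‖f' x‖ ≤ C

namespace IsRegular

variable {f : E → ℝ} {f' : E → E} {ε K C : ℝ}

theorem continuous (hf : IsRegular f f' ε K C) : Continuous f :=
  continuous_iff_continuousAt.2 fun x => (hf.grad x).continuousAt

theorem pos' (hf : IsRegular f f' ε K C) (x : E) : 0 < f x := hf.pos.trans_le (hf.lower x)

theorem nonneg_bound (hf : IsRegular f f' ε K C) : 0 ≤ C := (norm_nonneg _).trans (hf.bound 0)

theorem norm_le (hf : IsRegular f f' ε K C) (x : E) : ‖f x‖ ≤ K := by
  rw [Real.norm_of_nonneg (hf.pos' x).le]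
  exact hf.upper x

theorem integrable_comb (hf : IsRegular f f' ε K C) (hβ : 0 < β) (a b : ℝ) (v : E) :
    Integrable (fun x => f (a • v + b • x)) (gaussMeasure E β) := by
  have := isProbabilityMeasure_gaussMeasure (E := E) hβ
  exact .of_bound (hf.continuous.comp (by fun_prop)).aestronglyMeasurable K
    (.of_forall fun x => hf.norm_le _)

theorem integrable_grad_comb (hf : IsRegular f f' ε K C) (hβ : 0 < β) (a b : ℝ) (v : E) :
    Integrable (fun x => f' (a • v + b • x)) (gaussMeasure E β) := by
  have := isProbabilityMeasure_gaussMeasure (E := E) hβ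
  exact .of_bound (hf.cont.comp (by fun_prop)).aestronglyMeasurable C
    (.of_forall fun x => hf.bound _)

theorem lower_mehler (hf : IsRegular f f' ε K C) (hβ : 0 < β) (a b : ℝ) (v : E) :
    ε ≤ mehler β a b f v := by
  have := isProbabilityMeasure_gaussMeasure (E := E) hβ
  have h := integral_mono (integrable_const ε) (hf.integrable_comb hβ a b v)
    (fun x => hf.lower _)
  simpa [mehler] using h

theorem upper_mehler (hf : IsRegular f f' ε K C) (hβ : 0 < β) (a b : ℝ) (v : E) :
    mehler β a b f v ≤ K := by
  have := isProbabilityMeasure_gaussMeasure (E := E) hβ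
  have h := integral_mono (hf.integrable_comb hβ a b v) (integrable_const K)
    (fun x => hf.upper _)
  simpa [mehler] using h

/-- Here the derivative falls on `f`. In contrast to `mehlerGrad` there is no division by `b`, so
the formula includes `b = 0`, the starting point of the rotation. -/
theorem hasGradientAt_mehler (hf : IsRegular f f' ε K C) (hβ : 0 < β) (a b : ℝ) (v : E) :
    HasGradientAt (mehler β a b f) (a • ∫ x, f' (a • v + b • x) ∂gaussMeasure E β) v := by
  have := isProbabilityMeasure_gaussMeasure (E := E) hβ
  rw [← integral_smul]
  refine hasGradientAt_integral_of_dominated (μ := gaussMeasure E β)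
    (F := fun v x => f (a • v + b • x)) (G := fun v x => a • f' (a • v + b • x))
    (bound := fun _ => |a| * C) univ_mem
    (fun w => (hf.integrable_comb hβ a b w).aestronglyMeasurable) (hf.integrable_comb hβ a b v)
    ((hf.integrable_grad_comb hβ a b v).smul a).aestronglyMeasurable
    (.of_forall fun y w _ => ?_) (integrable_const _) (.of_forall fun y w _ => ?_)
  · rw [norm_smul, Real.norm_eq_abs]
    gcongr
    exact hf.bound _
  · have h := HasGradientAt.comp_affine (p := b • y) (c := a) (x := w)
      (hf.grad (b • y + a • w))
    simpa only [add_comm (b • y)] using h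

theorem norm_integral_grad_le (hf : IsRegular f f' ε K C) (hβ : 0 < β) (a b : ℝ) (v : E) :
    ‖∫ x, f' (a • v + b • x) ∂gaussMeasure E β‖ ≤ C := by
  have := isProbabilityMeasure_gaussMeasure (E := E) hβ
  have := norm_integral_le_of_norm_le (μ := gaussMeasure E β) (integrable_const C)
    (.of_forall fun x => hf.bound (a • v + b • x))
  simpa using this

theorem continuous_integral_grad (hf : IsRegular f f' ε K C) (hβ : 0 < β) (a b : ℝ) :
    Continuous (fun v => ∫ x, f' (a • v + b • x) ∂gaussMeasure E β) := by
  have := isProbabilityMeasure_gaussMeasure (E := E) hβ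
  refine continuous_of_dominated (bound := fun _ => C)
    (fun v => (hf.integrable_grad_comb hβ a b v).aestronglyMeasurable)
    (fun v => .of_forall fun x => hf.bound _) (integrable_const C)
    (.of_forall fun x => hf.cont.comp (by fun_prop))

theorem continuous_mehler (hf : IsRegular f f' ε K C) (hβ : 0 < β) (a b : ℝ) :
    Continuous (mehler β a b f) :=
  continuous_iff_continuousAt.2 fun v => (hf.hasGradientAt_mehler hβ a b v).continuousAt

theorem abs_log_mehler_le (hf : IsRegular f f' ε K C) (hβ : 0 < β) (a b : ℝ) (v : E) :
    |Real.log (mehler β a b f v)| ≤ |Real.log ε| + |Real.log K| := by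
  have h1 := Real.log_le_log hf.pos (hf.lower_mehler hβ a b v)
  have h2 := Real.log_le_log (hf.pos.trans_le (hf.lower_mehler hβ a b v))
    (hf.upper_mehler hβ a b v)
  rw [abs_le]
  constructor
  · linarith [neg_abs_le (Real.log ε), abs_nonneg (Real.log K)]
  · linarith [le_abs_self (Real.log K), abs_nonneg (Real.log ε)]

/-- The integrand of the derivative of the average in the rotation angle. -/
def angular (f' : E → E) (θ : ℝ) (v x : E) : ℝ :=
  inner ℝ (f' (Real.cos θ • v + Real.sin θ • x)) (-Real.sin θ • v + Real.cos θ • x)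

theorem continuous_angular (hf : IsRegular f f' ε K C) (θ : ℝ) :
    Continuous (fun p : E × E => angular f' θ p.1 p.2) :=
  (hf.cont.comp (by fun_prop)).inner (by fun_prop)

theorem abs_angular_le (hf : IsRegular f f' ε K C) (θ : ℝ) (v x : E) :
    |angular f' θ v x| ≤ C * (‖v‖ + ‖x‖) := by
  refine (abs_real_inner_le_norm _ _).trans ?_
  have hC := hf.nonneg_bound
  gcongr
  · exact hf.bound _
  · refine (norm_add_le _ _).trans ?_
    rw [norm_smul, norm_smul, norm_neg, Real.norm_eq_abs, Real.norm_eq_abs]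
    have h1 := mul_le_mul_of_nonneg_right (Real.abs_sin_le_one θ) (norm_nonneg v)
    have h2 := mul_le_mul_of_nonneg_right (Real.abs_cos_le_one θ) (norm_nonneg x)
    linarith

theorem integrable_angular_bound (hβ : 0 < β) (C : ℝ) (v : E) :
    Integrable (fun x : E => C * (‖v‖ + ‖x‖)) (gaussMeasure E β) := by
  have := isProbabilityMeasure_gaussMeasure (E := E) hβ
  exact ((integrable_const _).add (integrable_norm_gaussMeasure hβ)).const_mul C

theorem hasDerivAt_mehler_angle (hf : IsRegular f f' ε K C) (hβ : 0 < β) (θ : ℝ) (v : E) :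
    HasDerivAt (fun θ => mehler β (Real.cos θ) (Real.sin θ) f v)
      (∫ x, angular f' θ v x ∂gaussMeasure E β) θ := by
  refine (hasDerivAt_integral_of_dominated_loc_of_deriv_le (μ := gaussMeasure E β)
    (F := fun θ x => f (Real.cos θ • v + Real.sin θ • x))
    (F' := fun θ x => angular f' θ v x) (bound := fun x => C * (‖v‖ + ‖x‖)) univ_mem
    (.of_forall fun w => (hf.integrable_comb hβ _ _ v).aestronglyMeasurable)
    (hf.integrable_comb hβ _ _ v)
    ((hf.continuous_angular θ).comp (Continuous.prodMk_right v)).aestronglyMeasurable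
    (.of_forall fun x θ _ => hf.abs_angular_le θ v x) (integrable_angular_bound hβ C v)
    (.of_forall fun x θ _ => ?_)).2
  have h1 : HasDerivAt (fun θ => Real.cos θ • v + Real.sin θ • x)
      (-Real.sin θ • v + Real.cos θ • x) θ :=
    ((Real.hasDerivAt_cos θ).smul_const v).add ((Real.hasDerivAt_sin θ).smul_const x)
  exact (hf.grad _).hasFDerivAt.comp_hasDerivAt θ h1

/-- The derivative of `klFun` is `log`. The averages stay in `[ε, K]`, which bounds the logarithm
uniformly in `θ`; the angular derivative is dominated by the integrable `‖v‖ + ‖x‖`. -/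
theorem hasDerivAt_integral_klFun (hf : IsRegular f f' ε K C) (hβ : 0 < β) (θ : ℝ) :
    HasDerivAt
      (fun θ => ∫ v, klFun (mehler β (Real.cos θ) (Real.sin θ) f v) ∂gaussMeasure E β)
      (∫ v, Real.log (mehler β (Real.cos θ) (Real.sin θ) f v) *
        ∫ x, angular f' θ v x ∂gaussMeasure E β ∂gaussMeasure E β) θ := by
  have := isProbabilityMeasure_gaussMeasure (E := E) hβ
  set M := ∫ x : E, ‖x‖ ∂gaussMeasure E β with hM
  have hint : ∀ θ, Integrable
      (fun v => klFun (mehler β (Real.cos θ) (Real.sin θ) f v)) (gaussMeasure E β) := by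
    intro θ
    obtain ⟨B, hB⟩ := (isCompact_Icc (a := ε) (b := K)).exists_bound_of_continuousOn
      continuous_klFun.continuousOn
    exact .of_bound (continuous_klFun.comp (hf.continuous_mehler hβ _ _)).aestronglyMeasurable B
      (.of_forall fun v => hB _ ⟨hf.lower_mehler hβ _ _ v, hf.upper_mehler hβ _ _ v⟩)
  refine (hasDerivAt_integral_of_dominated_loc_of_deriv_le (μ := gaussMeasure E β)
    (F := fun θ v => klFun (mehler β (Real.cos θ) (Real.sin θ) f v))
    (F' := fun θ v => Real.log (mehler β (Real.cos θ) (Real.sin θ) f v) *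
        ∫ x, angular f' θ v x ∂gaussMeasure E β)
    (bound := fun v => (|Real.log ε| + |Real.log K|) * (C * (‖v‖ + M))) univ_mem
    (.of_forall fun w => (hint w).aestronglyMeasurable)
    (hint θ) ?_ (.of_forall fun v θ _ => ?_) ?_ (.of_forall fun v θ _ => ?_)).2
  · refine AEStronglyMeasurable.mul ?_ ?_
    · exact ((hf.continuous_mehler hβ _ _).measurable.log).aestronglyMeasurable
    · exact ((hf.continuous_angular θ).stronglyMeasurable.integral_prod_right').aestronglyMeasurable
  · rw [norm_mul]
    gcongr
    · exact hf.abs_log_mehler_le hβ _ _ v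
    · have := norm_integral_le_of_norm_le (f := angular f' θ v) (integrable_angular_bound hβ C v)
        (.of_forall fun x => hf.abs_angular_le θ v x)
      refine this.trans_eq ?_
      rw [integral_const_mul, integral_add (integrable_const _) (integrable_norm_gaussMeasure hβ)]
      simp [hM]
  · exact (((integrable_norm_gaussMeasure hβ).add (integrable_const M)).const_mul C).const_mul _
  · exact (hasDerivAt_klFun (hf.pos.trans_le (hf.lower_mehler hβ _ _ v)).ne').comp θ
      (hf.hasDerivAt_mehler_angle hβ θ v)

end IsRegular

end LogSobolev

/-! ### Rotation of the Gaussian pair and the logarithmic Sobolev inequality for regular functions.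
-/

section LogSobolev

variable {E : Type*} [NormedAddCommGroup E] [InnerProductSpace ℝ E] [FiniteDimensional ℝ E]
  [MeasurableSpace E] [BorelSpace E] {β : ℝ}

theorem integral_comp_measurePreserving {α α' F : Type*} [MeasurableSpace α] [MeasurableSpace α']
    [NormedAddCommGroup F] [NormedSpace ℝ F] {μ : Measure α} {ν : Measure α'} {R : α → α'}
    (hR : MeasurePreserving R μ ν) {g : α' → F} (hg : AEStronglyMeasurable g ν) :
    ∫ x, g (R x) ∂μ = ∫ y, g y ∂ν := by
  rw [← integral_map hR.aemeasurable (hR.map_eq.symm ▸ hg), hR.map_eq]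

namespace IsRegular

variable {f : E → ℝ} {f' : E → E} {ε K C : ℝ}

theorem integrable_prod_of_bound (hβ : 0 < β) {Φ : E × E → ℝ} (hΦ : Continuous Φ) (B : ℝ)
    (h : ∀ p, |Φ p| ≤ B * (‖p.1‖ + ‖p.2‖)) :
    Integrable Φ ((gaussMeasure E β).prod (gaussMeasure E β)) := by
  have := isProbabilityMeasure_gaussMeasure (E := E) hβ
  exact ((((integrable_norm_gaussMeasure hβ).comp_fst _).add
    ((integrable_norm_gaussMeasure hβ).comp_snd _)).const_mul B).mono'
    hΦ.aestronglyMeasurable (.of_forall h)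

/-- In the coordinates `z = c v + s x`, `z' = -s v + c x`, which again have law `γ ⊗ γ`, the angular
derivative is `⟨f'(z), z'⟩`, linear in `z'`. The logarithm depends on `v = c z - s z'`. Integration
by parts in `z'` replaces `z'` by `β⁻¹` times the `z'`-gradient of the logarithm; one factor `-s`
comes from this inner argument and one factor `c` from the gradient of the average. -/
theorem angular_derivative_eq (hf : IsRegular f f' ε K C) (hβ : 0 < β) (θ : ℝ) :
    ∫ v, Real.log (mehler β (Real.cos θ) (Real.sin θ) f v) *
        ∫ x, angular f' θ v x ∂gaussMeasure E β ∂gaussMeasure E β =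
      -(Real.sin θ * Real.cos θ / β) * ∫ v,
        ‖∫ x, f' (Real.cos θ • v + Real.sin θ • x) ∂gaussMeasure E β‖ ^ 2 /
          mehler β (Real.cos θ) (Real.sin θ) f v ∂gaussMeasure E β := by
  have := isProbabilityMeasure_gaussMeasure (E := E) hβ
  set c := Real.cos θ with hc
  set s := Real.sin θ with hs
  have hcs : c ^ 2 + s ^ 2 = 1 := Real.cos_sq_add_sin_sq θ
  set F := mehler β c s f with hF
  set G : E → E := fun v => ∫ x, f' (c • v + s • x) ∂gaussMeasure E β with hG
  set L := |Real.log ε| + |Real.log K| with hL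
  have hFc : Continuous F := hf.continuous_mehler hβ c s
  have hGc : Continuous G := hf.continuous_integral_grad hβ c s
  have hFpos : ∀ v, 0 < F v := fun v => hf.pos.trans_le (hf.lower_mehler hβ c s v)
  have hlogc : Continuous (fun v => Real.log (F v)) := hFc.log fun v => (hFpos v).ne'
  have hLpos : 0 ≤ L := by positivity
  have hC := hf.nonneg_bound
  have hrot := gaussMeasure_rotation (E := E) hβ hcs
  have hrot' : ∀ v x : E, c • (c • v + s • x) - s • (-s • v + c • x) = v := by
    intro v x
    have : c • (c • v + s • x) - s • (-s • v + c • x) = (c ^ 2 + s ^ 2) • v := by module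
    rw [this, hcs, one_smul]
  -- The integrand in rotated coordinates.
  set Ψ : E × E → ℝ := fun p => Real.log (F (c • p.1 - s • p.2)) * inner ℝ (f' p.1) p.2 with hΨ
  have hΨc : Continuous Ψ := (hlogc.comp (by fun_prop)).mul
    ((hf.cont.comp continuous_fst).inner continuous_snd)
  have hΨb : ∀ p, |Ψ p| ≤ L * C * (‖p.1‖ + ‖p.2‖) := by
    intro p
    rw [hΨ, abs_mul, mul_assoc]
    gcongr
    · exact hf.abs_log_mehler_le hβ c s _
    · calc |inner ℝ (f' p.1) p.2| ≤ ‖f' p.1‖ * ‖p.2‖ := abs_real_inner_le_norm _ _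
        _ ≤ C * ‖p.2‖ := by gcongr; exact hf.bound _
        _ ≤ C * (‖p.1‖ + ‖p.2‖) := by gcongr; linarith [norm_nonneg p.1]
  have hΨi := integrable_prod_of_bound hβ hΨc _ hΨb
  set Φ : E × E → ℝ := fun p => Real.log (F p.1) * angular f' θ p.1 p.2 with hΦ
  have hΦΨ : ∀ p : E × E, Φ p = Ψ (c • p.1 + s • p.2, -s • p.1 + c • p.2) := by
    intro p
    simp only [hΦ, hΨ, hrot']
    rfl
  have hΦc : Continuous Φ := (hlogc.comp continuous_fst).mul (hf.continuous_angular θ)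
  have hΦi : Integrable Φ ((gaussMeasure E β).prod (gaussMeasure E β)) := by
    refine integrable_prod_of_bound hβ hΦc (L * C) fun p => ?_
    rw [hΦ, abs_mul, mul_assoc]
    gcongr
    · exact hf.abs_log_mehler_le hβ c s _
    · exact hf.abs_angular_le θ _ _
  set H : E → E := fun v => (F v)⁻¹ • G v with hH
  have hHc : Continuous H := (hFc.inv₀ fun v => (hFpos v).ne').smul hGc
  have hHb : ∀ v, ‖H v‖ ≤ ε⁻¹ * C := by
    intro v
    rw [hH, norm_smul, norm_inv, Real.norm_of_nonneg (hFpos v).le]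
    have := hf.pos
    gcongr
    · exact hf.lower_mehler hβ c s v
    · exact hf.norm_integral_grad_le hβ c s v
  set Θ : E × E → ℝ := fun p => inner ℝ (f' p.1) (H (c • p.1 - s • p.2)) with hΘ
  have hΘc : Continuous Θ := (hf.cont.comp continuous_fst).inner (hHc.comp (by fun_prop))
  have hΘb : ∀ p, ‖Θ p‖ ≤ C * (ε⁻¹ * C) := by
    intro p
    refine (abs_real_inner_le_norm _ _).trans ?_
    gcongr
    · exact hf.bound _
    · exact hHb _
  have hΘi : Integrable Θ ((gaussMeasure E β).prod (gaussMeasure E β)) :=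
    .of_bound hΘc.aestronglyMeasurable _ (.of_forall hΘb)
  have step1 : ∫ v, Real.log (F v) * ∫ x, angular f' θ v x ∂gaussMeasure E β ∂gaussMeasure E β =
      ∫ z, ∫ z', Ψ (z, z') ∂gaussMeasure E β ∂gaussMeasure E β := by
    simp_rw [← integral_const_mul]
    rw [← integral_prod Φ hΦi, ← integral_prod Ψ hΨi,
      ← integral_comp_measurePreserving hrot hΨc.aestronglyMeasurable]
    exact integral_congr_ae (.of_forall hΦΨ)
  -- Integration by parts in `z'` for fixed `z`, where `f' z` is a constant vector.
  have step2 : ∀ z, ∫ z', Ψ (z, z') ∂gaussMeasure E β =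
      -(s * c / β) * ∫ z', Θ (z, z') ∂gaussMeasure E β := by
    intro z
    have hk : ∀ x, HasGradientAt (fun z' => Real.log (F (c • z - s • z')))
        (-(s * c) • H (c • z - s • x)) x := by
      intro x
      have h1 := hf.hasGradientAt_mehler hβ c s (c • z + (-s) • x)
      have h2 := HasGradientAt.comp_affine h1
      have h3 := hasGradientAt_scalar_comp
        (g := fun x => F (c • z + (-s) • x)) (Real.hasDerivAt_log (hFpos _).ne') h2
      have e1 : ∀ x, c • z + (-s) • x = c • z - s • x := fun x => by
        rw [neg_smul, sub_eq_add_neg]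
      simp only [e1] at h3
      convert h3 using 1
      simp only [hH, hG, smul_smul]
      congr 1
      ring
    have h := integral_mul_inner_gaussMeasure hβ hk (f' z)
      (.of_bound (hlogc.comp (by fun_prop)).aestronglyMeasurable L
        (.of_forall fun x => hf.abs_log_mehler_le hβ c s _))
      ((IsRegular.integrable_angular_bound hβ (L * C) z).mono'
        (hΨc.comp (Continuous.prodMk_right z)).aestronglyMeasurable
        (.of_forall fun x => hΨb (z, x)))
      (by
        simp only [inner_smul_right]
        exact (Integrable.of_bound (hΘc.comp (Continuous.prodMk_right z)).aestronglyMeasurable _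
          (.of_forall fun x => hΘb (z, x))).const_mul _)
    simp only [inner_smul_right] at h
    rw [integral_const_mul] at h
    rw [show ∫ z', Ψ (z, z') ∂gaussMeasure E β = _ from h, ← mul_assoc]
    congr 1
    ring
  rw [step1]
  simp_rw [step2]
  -- The rotation is undone; afterwards `H` depends on `v` only and comes out of the integral over
  -- `x`.
  rw [integral_const_mul, ← integral_prod Θ hΘi,
    ← integral_comp_measurePreserving hrot hΘc.aestronglyMeasurable,
    integral_prod (fun p : E × E => Θ (c • p.1 + s • p.2, -s • p.1 + c • p.2))
      (hrot.integrable_comp_of_integrable hΘi)]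
  congr 1
  refine integral_congr_ae (.of_forall fun v => ?_)
  simp only [hΘ, hrot']
  have h1 : ∀ x, inner ℝ (f' (c • v + s • x)) (H v) = inner ℝ (H v) (f' (c • v + s • x)) :=
    fun x => real_inner_comm _ _
  simp_rw [h1]
  rw [integral_inner (hf.integrable_grad_comb hβ c s v)]
  change inner ℝ (H v) (G v) = ‖G v‖ ^ 2 / F v
  rw [hH, inner_smul_left, real_inner_self_eq_norm_sq, conj_trivial, inv_mul_eq_div]

theorem information_ne_top (hf : IsRegular f f' ε K C) (hβ : 0 < β) :
    information β f f' ≠ ⊤ := by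
  have := isProbabilityMeasure_gaussMeasure (E := E) hβ
  have h : information β f f' ≤ ∫⁻ _, ENNReal.ofReal (C ^ 2 / ε) ∂gaussMeasure E β := by
    refine lintegral_mono fun v => ?_
    rw [enorm_sq_div_ofReal _ (hf.pos' v)]
    refine ENNReal.ofReal_le_ofReal ?_
    have := hf.pos
    gcongr
    · exact hf.bound v
    · exact hf.lower v
  refine (h.trans_lt ?_).ne
  simp

/-- Cauchy-Schwarz in `x` for each `v`, then invariance of `γ`. The bound does not depend on the
angle. -/
theorem integral_norm_sq_div_le (hf : IsRegular f f' ε K C) (hβ : 0 < β) {a b : ℝ}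
    (hab : a ^ 2 + b ^ 2 = 1) :
    ∫ v, ‖∫ x, f' (a • v + b • x) ∂gaussMeasure E β‖ ^ 2 / mehler β a b f v ∂gaussMeasure E β ≤
      (information β f f').toReal := by
  refine (ENNReal.ofReal_le_iff_le_toReal (hf.information_ne_top hβ)).1 ?_
  refine (ofReal_integral_le_lintegral _).trans ?_
  have hm : Measurable (fun v => ‖f' v‖ₑ ^ 2 / ENNReal.ofReal (f v)) :=
    (hf.cont.measurable.enorm.pow_const _).div hf.continuous.measurable.ennreal_ofReal
  rw [information, ← lintegral_lintegral_comb hβ hab hm.aemeasurable]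
  refine lintegral_mono fun v => ?_
  rw [← enorm_sq_div_ofReal _ (hf.pos.trans_le (hf.lower_mehler hβ a b v))]
  exact enorm_integral_sq_div_le (hf.integrable_comb hβ a b v) (fun x => hf.pos' _)
    (hf.integrable_grad_comb hβ a b v).aestronglyMeasurable

theorem entropy_le (hf : IsRegular f f' ε K C) (hβ : 0 < β) :
    entropy β f ≤ ENNReal.ofReal (klFun (∫ x, f x ∂gaussMeasure E β)) +
      ENNReal.ofReal (1 / (2 * β)) * information β f f' := by
  have := isProbabilityMeasure_gaussMeasure (E := E) hβ
  set J := (information β f f').toReal with hJ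
  -- Adding `J sin² θ/(2β)` compensates the largest possible rate of decrease, `J sin θ cos θ/β`,
  -- and makes the sum monotone on `[0, π/2]`.
  have hder : ∀ θ, HasDerivAt (fun θ =>
      ∫ v, klFun (mehler β (Real.cos θ) (Real.sin θ) f v) ∂gaussMeasure E β +
        J / (2 * β) * Real.sin θ ^ 2) (-(Real.sin θ * Real.cos θ / β) * ∫ v,
        ‖∫ x, f' (Real.cos θ • v + Real.sin θ • x) ∂gaussMeasure E β‖ ^ 2 /
          mehler β (Real.cos θ) (Real.sin θ) f v ∂gaussMeasure E β +
          J / (2 * β) * (2 * Real.sin θ * Real.cos θ)) θ := by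
    intro θ
    rw [← hf.angular_derivative_eq hβ θ]
    refine (hf.hasDerivAt_integral_klFun hβ θ).add (HasDerivAt.const_mul _ ?_)
    refine ((Real.hasDerivAt_sin θ).fun_pow 2).congr_deriv ?_
    simp
  have hpi := Real.pi_pos
  have hmono := monotoneOn_of_deriv_nonneg (convex_Icc (0 : ℝ) (Real.pi / 2))
    (fun θ _ => (hder θ).continuousAt.continuousWithinAt)
    (fun θ _ => (hder θ).differentiableAt.differentiableWithinAt) (by
      intro θ hθ
      rw [interior_Icc] at hθ
      rw [(hder θ).deriv]
      have hs : 0 ≤ Real.sin θ := Real.sin_nonneg_of_nonneg_of_le_pi hθ.1.le (by linarith [hθ.2])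
      have hc : 0 ≤ Real.cos θ := Real.cos_nonneg_of_neg_pi_div_two_le_of_le
        (by linarith [hθ.1]) hθ.2.le
      have h := hf.integral_norm_sq_div_le hβ (Real.cos_sq_add_sin_sq θ)
      have h' := mul_le_mul_of_nonneg_left h (show 0 ≤ Real.sin θ * Real.cos θ / β by positivity)
      have e : J / (2 * β) * (2 * Real.sin θ * Real.cos θ) =
          Real.sin θ * Real.cos θ / β * J := by field_simp
      rw [e]
      linarith)
  have h := hmono (Set.left_mem_Icc.2 (by positivity)) (Set.right_mem_Icc.2 (by positivity))
    (by positivity : (0 : ℝ) ≤ Real.pi / 2)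
  -- At `θ = 0` the average is `f` itself, at `θ = π/2` it is the constant `∫ f γ`.
  simp only [Real.cos_zero, Real.sin_zero, Real.cos_pi_div_two, Real.sin_pi_div_two] at h
  simp only [mehler, one_smul, zero_smul, add_zero, zero_add, integral_const, probReal_univ] at h
  have hJpos : 0 ≤ J := ENNReal.toReal_nonneg
  have hkl : Integrable (fun v => klFun (f v)) (gaussMeasure E β) := by
    obtain ⟨B, hB⟩ := (isCompact_Icc (a := ε) (b := K)).exists_bound_of_continuousOn
      continuous_klFun.continuousOn
    exact .of_bound (continuous_klFun.comp hf.continuous).aestronglyMeasurable B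
      (.of_forall fun v => hB _ ⟨hf.lower v, hf.upper v⟩)
  rw [entropy, ← ofReal_integral_eq_lintegral_ofReal hkl
    (.of_forall fun v => klFun_nonneg (hf.pos' v).le),
    ← ENNReal.ofReal_toReal (hf.information_ne_top hβ), ← ENNReal.ofReal_mul (by positivity),
    ← ENNReal.ofReal_add (klFun_nonneg (integral_nonneg fun x => (hf.pos' x).le)) (by positivity)]
  refine ENNReal.ofReal_le_ofReal ?_
  rw [← hJ]
  refine le_trans (le_of_eq (by ring)) (h.trans (le_of_eq ?_))
  field_simp

end IsRegular

end LogSobolev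

/-! ### Strong continuity of the semigroup and lower semicontinuity of the entropy. -/

section SmoothApprox

variable {E : Type*} [NormedAddCommGroup E] [InnerProductSpace ℝ E] [FiniteDimensional ℝ E]
  [MeasurableSpace E] [BorelSpace E] {β : ℝ}

theorem lintegral_enorm_mehler_le (hβ : 0 < β) {a b : ℝ} (hab : a ^ 2 + b ^ 2 = 1) {h : E → ℝ}
    (hh : AEStronglyMeasurable h (gaussMeasure E β)) :
    ∫⁻ v, ‖mehler β a b h v‖ₑ ∂gaussMeasure E β ≤ ∫⁻ v, ‖h v‖ₑ ∂gaussMeasure E β := by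
  rw [← lintegral_lintegral_comb hβ hab hh.enorm]
  exact lintegral_mono fun v => enorm_integral_le_lintegral_enorm _

variable {a b : ℕ → ℝ}

theorem tendsto_lintegral_mehler_sub_of_continuous (hβ : 0 < β)
    (ha : Tendsto a atTop (𝓝 1)) (hb : Tendsto b atTop (𝓝 0)) {φ : E → ℝ} (hφ : Continuous φ)
    {B : ℝ} (hB : ∀ x, ‖φ x‖ ≤ B) :
    Tendsto (fun k => ∫⁻ v, ‖mehler β (a k) (b k) φ v - φ v‖ₑ ∂gaussMeasure E β) atTop (𝓝 0) := by
  have := isProbabilityMeasure_gaussMeasure (E := E) hβ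
  have hm : ∀ k, AEStronglyMeasurable (fun v => mehler β (a k) (b k) φ v)
      (gaussMeasure E β) := fun k => by
    have hc : Continuous (fun p : E × E => φ (a k • p.1 + b k • p.2)) := hφ.comp (by fun_prop)
    exact hc.stronglyMeasurable.integral_prod_right'.aestronglyMeasurable
  have h := tendsto_lintegral_of_dominated_convergence' (μ := gaussMeasure E β)
    (F := fun k v => ‖mehler β (a k) (b k) φ v - φ v‖ₑ) (f := fun _ => 0)
    (fun _ => ENNReal.ofReal (B + B))
    (fun k => ((hm k).sub hφ.aestronglyMeasurable).enorm)
    (fun k => .of_forall fun v => by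
      simp only [← ofReal_norm]
      refine ENNReal.ofReal_le_ofReal ((norm_sub_le _ _).trans (add_le_add ?_ (hB v)))
      have := norm_integral_le_of_norm_le (μ := gaussMeasure E β) (integrable_const B)
        (.of_forall fun x => hB (a k • v + b k • x))
      simpa [mehler] using this)
    (by simp) (.of_forall fun v => ?_)
  · simpa using h
  · have h1 : Tendsto (fun k => mehler β (a k) (b k) φ v) atTop
        (𝓝 (∫ _, φ v ∂gaussMeasure E β)) := by
      refine tendsto_integral_of_dominated_convergence (fun _ => B)
        (fun k => (hφ.comp (by fun_prop)).aestronglyMeasurable) (integrable_const B)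
        (fun k => .of_forall fun x => hB _) (.of_forall fun x => ?_)
      have : Tendsto (fun k => a k • v + b k • x) atTop (𝓝 ((1 : ℝ) • v + (0 : ℝ) • x)) :=
        (ha.smul_const v).add (hb.smul_const x)
      rw [one_smul, zero_smul, add_zero] at this
      exact (hφ.tendsto v).comp this
    have h2 := (h1.sub_const (φ v)).enorm
    simpa using h2

/-- The Ornstein-Uhlenbeck semigroup is strongly continuous at `0` in `L¹`. -/
theorem tendsto_lintegral_mehler_sub (hβ : 0 < β) (hab : ∀ k, a k ^ 2 + b k ^ 2 = 1)
    (ha : Tendsto a atTop (𝓝 1)) (hb : Tendsto b atTop (𝓝 0)) {h : E → ℝ}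
    (hh : Integrable h (gaussMeasure E β)) :
    Tendsto (fun k => ∫⁻ v, ‖mehler β (a k) (b k) h v - h v‖ₑ ∂gaussMeasure E β) atTop (𝓝 0) := by
  have := isProbabilityMeasure_gaussMeasure (E := E) hβ
  rw [ENNReal.tendsto_nhds_zero]
  intro ε hε
  have hε3 : ε / 3 ≠ 0 := by simp [hε.ne']
  -- Density of continuous, compactly supported functions, combined with the contraction property of
  -- the average on `L¹(γ)`.
  obtain ⟨φ, hφs, hφ, hφc, hφi⟩ := hh.exists_hasCompactSupport_lintegral_sub_le hε3
  obtain ⟨B, hB⟩ := hφs.exists_bound_of_continuous hφc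
  filter_upwards [ENNReal.tendsto_nhds_zero.1
    (tendsto_lintegral_mehler_sub_of_continuous hβ ha hb hφc hB) (ε / 3)
    (pos_iff_ne_zero.2 hε3)] with k hk
  have hd : Integrable (fun v => h v - φ v) (gaussMeasure E β) := hh.sub hφi
  have hp := measurePreserving_comb (E := E) hβ (hab k)
  have hsub : ∀ᵐ v ∂gaussMeasure E β, mehler β (a k) (b k) h v =
      mehler β (a k) (b k) (fun v => h v - φ v) v + mehler β (a k) (b k) φ v := by
    filter_upwards [(hp.integrable_comp_of_integrable hh).prod_right_ae,
      (hp.integrable_comp_of_integrable hφi).prod_right_ae] with v h1 h2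
    simp only [Function.comp_apply] at h1 h2
    rw [mehler, mehler, mehler, integral_sub h1 h2]
    ring
  calc ∫⁻ v, ‖mehler β (a k) (b k) h v - h v‖ₑ ∂gaussMeasure E β
      ≤ ∫⁻ v, (‖mehler β (a k) (b k) (fun v => h v - φ v) v‖ₑ +
          ‖mehler β (a k) (b k) φ v - φ v‖ₑ) + ‖h v - φ v‖ₑ ∂gaussMeasure E β := by
        refine lintegral_mono_ae (hsub.mono fun v hv => ?_)
        rw [hv]
        have e : mehler β (a k) (b k) (fun v => h v - φ v) v + mehler β (a k) (b k) φ v - h v =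
          mehler β (a k) (b k) (fun v => h v - φ v) v + (mehler β (a k) (b k) φ v - φ v) -
            (h v - φ v) := by ring
        rw [e]
        exact (enorm_sub_le).trans (add_le_add_left (enorm_add_le _ _) _)
    _ = ∫⁻ v, ‖mehler β (a k) (b k) (fun v => h v - φ v) v‖ₑ ∂gaussMeasure E β +
          ∫⁻ v, ‖mehler β (a k) (b k) φ v - φ v‖ₑ ∂gaussMeasure E β +
          ∫⁻ v, ‖h v - φ v‖ₑ ∂gaussMeasure E β := by
        rw [lintegral_add_right' _ hd.aestronglyMeasurable.enorm, lintegral_add_left'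
          (integrable_mehler hβ (hab k) hd).aestronglyMeasurable.enorm]
    _ ≤ ε / 3 + ε / 3 + ε / 3 := by
        gcongr
        exact (lintegral_enorm_mehler_le hβ (hab k) hd.aestronglyMeasurable).trans hφ
    _ = ε := ENNReal.add_thirds ε

/-- Fatou's lemma for the nonnegative integrands, with `klFun` continuous. -/
theorem entropy_le_of_tendsto_ae {h : E → ℝ} {H : ℕ → E → ℝ} {C : ℝ≥0∞}
    (hH : ∀ k, AEMeasurable (H k) (gaussMeasure E β)) (hC : ∀ k, entropy β (H k) ≤ C)
    (hlim : ∀ᵐ v ∂gaussMeasure E β, Tendsto (fun k => H k v) atTop (𝓝 (h v))) :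
    entropy β h ≤ C := by
  have h1 : entropy β h =
      ∫⁻ v, liminf (fun k => ENNReal.ofReal (klFun (H k v))) atTop ∂gaussMeasure E β :=
    lintegral_congr_ae (hlim.mono fun v hv =>
      ((ENNReal.continuous_ofReal.tendsto _).comp
        ((continuous_klFun.tendsto _).comp hv)).liminf_eq.symm)
  rw [h1]
  refine (lintegral_liminf_le' fun k =>
    (measurable_klFun.comp_aemeasurable (hH k)).ennreal_ofReal).trans ?_
  exact liminf_le_of_frequently_le' (.of_forall fun k => hC k)

/-- Lower semicontinuity of the entropy along the Ornstein-Uhlenbeck semigroup. -/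
theorem entropy_le_of_mehler (hβ : 0 < β) (hab : ∀ k, a k ^ 2 + b k ^ 2 = 1)
    (ha : Tendsto a atTop (𝓝 1)) (hb : Tendsto b atTop (𝓝 0)) {h : E → ℝ}
    (hh : Integrable h (gaussMeasure E β)) {C : ℝ≥0∞}
    (hC : ∀ k, entropy β (mehler β (a k) (b k) h) ≤ C) : entropy β h ≤ C := by
  have hm : ∀ k, AEStronglyMeasurable (mehler β (a k) (b k) h) (gaussMeasure E β) :=
    fun k => (integrable_mehler hβ (hab k) hh).aestronglyMeasurable
  -- Convergence in `L¹` gives convergence in measure, hence almost everywhere along a subsequence.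
  have h1 : TendstoInMeasure (gaussMeasure E β) (fun k => mehler β (a k) (b k) h) atTop h := by
    refine tendstoInMeasure_of_tendsto_eLpNorm one_ne_zero hm hh.aestronglyMeasurable ?_
    simp_rw [eLpNorm_one_eq_lintegral_enorm]
    exact tendsto_lintegral_mehler_sub hβ hab ha hb hh
  obtain ⟨ns, -, hns⟩ := h1.exists_seq_tendsto_ae
  exact entropy_le_of_tendsto_ae (fun k => (hm (ns k)).aemeasurable) (fun k => hC (ns k)) hns

/-- The coefficients of the Ornstein-Uhlenbeck semigroup at a time `s`. -/
theorem ou_sq_add_sq {s : ℝ} (hs : 0 ≤ s) :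
    Real.exp (-s) ^ 2 + √(1 - Real.exp (-2 * s)) ^ 2 = 1 := by
  rw [Real.sq_sqrt, ← Real.exp_nat_mul]
  · push_cast; ring_nf
  · have : Real.exp (-2 * s) ≤ 1 := Real.exp_le_one_iff.2 (by linarith)
    linarith

theorem ou_sqrt_pos {s : ℝ} (hs : 0 < s) : 0 < √(1 - Real.exp (-2 * s)) := by
  have : Real.exp (-2 * s) < 1 := Real.exp_lt_one_iff.2 (by linarith)
  exact Real.sqrt_pos.2 (by linarith)

theorem tendsto_exp_neg_one_div :
    Tendsto (fun k : ℕ => Real.exp (-(1 / ((k : ℝ) + 1)))) atTop (𝓝 1) := by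
  have h := (Real.continuous_exp.tendsto _).comp
    (tendsto_one_div_add_atTop_nhds_zero_nat (𝕜 := ℝ)).neg
  simpa [Function.comp_def] using h

theorem tendsto_sqrt_one_div :
    Tendsto (fun k : ℕ => √(1 - Real.exp (-2 * (1 / ((k : ℝ) + 1))))) atTop (𝓝 0) := by
  have hc : Continuous (fun x : ℝ => √(1 - Real.exp (-2 * x))) := by fun_prop
  have h := (hc.tendsto _).comp (tendsto_one_div_add_atTop_nhds_zero_nat (𝕜 := ℝ))
  simpa [Function.comp_def] using h

/-! ### The logarithmic Sobolev inequality for smooth functions without bounds -/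

/-- The gradient of the smoothed function is the average of the gradient. -/
theorem mehlerGrad_eq_integral (hβ : 0 < β) {a b : ℝ} (hb : 0 < b) {g : E → ℝ} {g' : E → E}
    (hg : ∀ x, HasGradientAt g (g' x) x) {B : ℝ} (hB : ∀ x, ‖g x‖ ≤ B) (v : E)
    (hi : Integrable (fun x => g' (a • v + b • x)) (gaussMeasure E β)) :
    mehlerGrad β a b g v = a • ∫ x, g' (a • v + b • x) ∂gaussMeasure E β := by
  have := isProbabilityMeasure_gaussMeasure (E := E) hβ
  have hgc : Continuous g := continuous_iff_continuousAt.2 fun x => (hg x).continuousAt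
  have hgc' : Continuous (fun x : E => g (a • v + b • x)) := hgc.comp (by fun_prop)
  have hix : Integrable (fun x => g (a • v + b • x) • x) (gaussMeasure E β) :=
    ((integrable_norm_gaussMeasure hβ).const_mul B).mono'
      (hgc'.smul continuous_id).aestronglyMeasurable (.of_forall fun x => by
        rw [norm_smul]
        gcongr
        exact hB _)
  -- Gaussian integration by parts in each direction `u` moves the factor `x` of `mehlerGrad` onto
  -- `g`.
  refine ext_inner_left ℝ fun u => ?_
  have h := integral_mul_inner_gaussMeasure hβ
    (fun x => HasGradientAt.comp_affine (p := a • v) (c := b) (hg (a • v + b • x))) u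
    (.of_bound hgc'.aestronglyMeasurable B (.of_forall fun x => hB _))
    ((hix.const_inner u).congr (.of_forall fun x => by simp only [inner_smul_right]))
    ((hi.smul b).const_inner u)
  have e1 : ∫ x, g (a • v + b • x) * inner ℝ u x ∂gaussMeasure E β =
      inner ℝ u (∫ x, g (a • v + b • x) • x ∂gaussMeasure E β) := by
    rw [← integral_inner hix]
    exact integral_congr_ae (.of_forall fun x => by simp only [inner_smul_right])
  have e2 : ∫ x, inner ℝ u (b • g' (a • v + b • x)) ∂gaussMeasure E β =
      b * inner ℝ u (∫ x, g' (a • v + b • x) ∂gaussMeasure E β) := by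
    rw [← integral_inner hi, ← integral_const_mul]
    exact integral_congr_ae (.of_forall fun x => by simp only [inner_smul_right])
  rw [e1, e2] at h
  rw [mehlerGrad, inner_smul_right, inner_smul_right, h]
  field_simp

/-- The gradient commutes with averaging up to the factor `a`. Cauchy-Schwarz then bounds the
integrand at `v` by the average of the old one, times `a² ≤ 1`. -/
theorem information_mehler_le (hβ : 0 < β) {a b : ℝ} (ha1 : a ^ 2 ≤ 1) (hb : 0 < b)
    (hab : a ^ 2 + b ^ 2 = 1) {g : E → ℝ} {g' : E → E}
    (hg : ∀ x, HasGradientAt g (g' x) x) (hg' : Continuous g') (hpos : ∀ x, 0 < g x)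
    {B : ℝ} (hB : ∀ x, ‖g x‖ ≤ B) (hi : Integrable g' (gaussMeasure E β)) :
    information β (mehler β a b g) (mehlerGrad β a b g) ≤ information β g g' := by
  have := isProbabilityMeasure_gaussMeasure (E := E) hβ
  have hgc : Continuous g := continuous_iff_continuousAt.2 fun x => (hg x).continuousAt
  have hgi : Integrable g (gaussMeasure E β) :=
    .of_bound hgc.aestronglyMeasurable B (.of_forall hB)
  have hm : Measurable (fun v => ‖g' v‖ₑ ^ 2 / ENNReal.ofReal (g v)) :=
    (hg'.measurable.enorm.pow_const _).div hgc.measurable.ennreal_ofReal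
  rw [information, information, ← lintegral_lintegral_comb hβ hab hm.aemeasurable]
  refine lintegral_mono_ae ?_
  have hp := measurePreserving_comb (E := E) hβ hab
  filter_upwards [(hp.integrable_comp_of_integrable hi).prod_right_ae] with v hv
  rw [mehlerGrad_eq_integral hβ hb hg hB v hv]
  refine le_trans ?_ (enorm_integral_sq_div_le (integrable_comp_affine hβ hb hab hgi v)
    (fun x => hpos _) hv.aestronglyMeasurable)
  refine ENNReal.div_le_div_right ?_ _
  rw [enorm_smul, mul_pow]
  refine mul_le_of_le_one_left' ?_
  rw [← ofReal_norm, ← ENNReal.ofReal_pow (norm_nonneg _), Real.norm_eq_abs, sq_abs]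
  exact ENNReal.ofReal_le_one.2 ha1

/-- Pointwise `|g'| ≤ |g'|²/g + g`. -/
theorem integrable_of_information_ne_top {g : E → ℝ} {g' : E → E}
    (hg : Integrable g (gaussMeasure E β)) (hg' : AEStronglyMeasurable g' (gaussMeasure E β))
    (hpos : ∀ x, 0 < g x) (hi : information β g g' ≠ ⊤) : Integrable g' (gaussMeasure E β) := by
  refine ⟨hg', ?_⟩
  have h1 : ∀ v, ‖g' v‖ₑ ≤ ‖g' v‖ₑ ^ 2 / ENNReal.ofReal (g v) + ENNReal.ofReal (g v) := by
    intro v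
    have hv := hpos v
    rw [enorm_sq_div_ofReal _ hv, ← ENNReal.ofReal_add (by positivity) hv.le, ← ofReal_norm]
    refine ENNReal.ofReal_le_ofReal ?_
    have : ‖g' v‖ * g v ≤ ‖g' v‖ ^ 2 + g v * g v := by nlinarith [sq_nonneg (‖g' v‖ - g v), sq_nonneg (‖g' v‖), sq_nonneg (g v)]
    calc ‖g' v‖ = ‖g' v‖ * g v / g v := by field_simp
      _ ≤ (‖g' v‖ ^ 2 + g v * g v) / g v := by gcongr
      _ = _ := by field_simp
  refine (lintegral_mono h1).trans_lt ?_
  rw [lintegral_add_right' _ hg.aemeasurable.ennreal_ofReal]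
  refine ENNReal.add_lt_top.2 ⟨hi.lt_top, ?_⟩
  rw [← ofReal_integral_eq_lintegral_ofReal hg (.of_forall fun x => (hpos x).le)]
  exact ENNReal.ofReal_lt_top

/-- The logarithmic Sobolev inequality for functions that are bounded and bounded away from `0`. -/
theorem entropy_le_information_of_bounded (hβ : 0 < β) {g : E → ℝ} {g' : E → E}
    (hg : ∀ x, HasGradientAt g (g' x) x) (hg' : Continuous g') {ε K : ℝ} (hε : 0 < ε)
    (hlo : ∀ x, ε ≤ g x) (hhi : ∀ x, g x ≤ K) :
    entropy β g ≤ ENNReal.ofReal (klFun (∫ x, g x ∂gaussMeasure E β)) +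
      ENNReal.ofReal (1 / (2 * β)) * information β g g' := by
  have := isProbabilityMeasure_gaussMeasure (E := E) hβ
  have hgc : Continuous g := continuous_iff_continuousAt.2 fun x => (hg x).continuousAt
  have hpos : ∀ x, 0 < g x := fun x => hε.trans_le (hlo x)
  have hB : ∀ x, ‖g x‖ ≤ K := fun x => by
    rw [Real.norm_of_nonneg (hpos x).le]; exact hhi x
  have hgi : Integrable g (gaussMeasure E β) :=
    .of_bound hgc.aestronglyMeasurable K (.of_forall hB)
  by_cases hI : information β g g' = ⊤
  · rw [hI, ENNReal.mul_top, add_top]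
    · exact le_top
    · exact (ENNReal.ofReal_pos.2 (by positivity)).ne'
  have hi := integrable_of_information_ne_top hgi hg'.aestronglyMeasurable hpos hI
  have hs : ∀ k : ℕ, (0 : ℝ) < 1 / ((k : ℝ) + 1) := fun k => by positivity
  refine entropy_le_of_mehler hβ (fun k => ou_sq_add_sq (hs k).le) tendsto_exp_neg_one_div
    tendsto_sqrt_one_div hgi fun k => ?_
  set a := Real.exp (-(1 / ((k : ℝ) + 1)))
  set b := √(1 - Real.exp (-2 * (1 / ((k : ℝ) + 1))))
  have hab : a ^ 2 + b ^ 2 = 1 := ou_sq_add_sq (hs k).le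
  have hb : 0 < b := ou_sqrt_pos (hs k)
  have hint : ∀ v, Integrable (fun x => g (a • v + b • x)) (gaussMeasure E β) := fun v =>
    integrable_comp_affine hβ hb hab hgi v
  -- A short time of smoothing supplies the missing gradient bound. It keeps the values in `[ε, K]`,
  -- preserves the mean and does not increase the information, while the entropy is lower
  -- semicontinuous as the time tends to `0`.
  have hreg : IsRegular (mehler β a b g) (mehlerGrad β a b g) ε K
      (|a| * β / b * (K * ∫ x : E, ‖x‖ ∂gaussMeasure E β)) := by
    refine ⟨hasGradientAt_mehler hβ hb hab hgi, continuous_mehlerGrad hβ hb hab hgi, hε,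
      fun v => ?_, fun v => ?_, norm_mehlerGrad_le hβ hb hB⟩
    · simpa [mehler] using integral_mono (integrable_const ε) (hint v) (fun x => hlo _)
    · simpa [mehler] using integral_mono (hint v) (integrable_const K) (fun x => hhi _)
  refine (hreg.entropy_le hβ).trans ?_
  rw [integral_mehler hβ hab hgi]
  gcongr
  exact information_mehler_le hβ (by nlinarith [sq_nonneg b]) hb hab hg hg' hpos hB hi

/-- The logarithmic Sobolev inequality. -/
theorem entropy_le_information (hβ : 0 < β) {g : E → ℝ} {g' : E → E}
    (hg : ∀ x, HasGradientAt g (g' x) x) (hg' : Continuous g') (hpos : ∀ x, 0 < g x)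
    (hgi : Integrable g (gaussMeasure E β)) :
    entropy β g ≤ ENNReal.ofReal (klFun (∫ x, g x ∂gaussMeasure E β)) +
      ENNReal.ofReal (1 / (2 * β)) * information β g g' := by
  have := isProbabilityMeasure_gaussMeasure (E := E) hβ
  have hgc : Continuous g := continuous_iff_continuousAt.2 fun x => (hg x).continuousAt
  -- A smooth truncation: on `(0,∞)` its values lie between `1/(n+1)` and `n+1 + 1/(n+1)`, and `ψ n
  -- x → x`.
  set ψ : ℕ → ℝ → ℝ := fun n x => x / (1 + x / ((n : ℝ) + 1)) + 1 / ((n : ℝ) + 1) with hψ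
  have hN : ∀ n : ℕ, (0 : ℝ) < 1 / ((n : ℝ) + 1) := fun n => by positivity
  have hψc : ∀ n, Continuous (fun v => ψ n (g v)) := fun n => by
    refine (hgc.div (by fun_prop) fun v => ?_).add continuous_const
    have := hpos v
    positivity
  have hψlim : ∀ x, Tendsto (fun n => ψ n x) atTop (𝓝 x) := by
    intro x
    have h0 := tendsto_one_div_add_atTop_nhds_zero_nat (𝕜 := ℝ)
    have h1 : Tendsto (fun n : ℕ => x / (1 + x * (1 / ((n : ℝ) + 1))) + 1 / ((n : ℝ) + 1)) atTop
        (𝓝 (x / (1 + x * 0) + 0)) :=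
      (tendsto_const_nhds.div ((h0.const_mul x).const_add 1) (by simp)).add h0
    simpa [hψ, div_eq_mul_inv] using h1
  have hψpos : ∀ (n : ℕ) (x : ℝ), 0 < x → 1 / ((n : ℝ) + 1) ≤ ψ n x := fun n x hx => by
    have : 0 ≤ x / (1 + x / ((n : ℝ) + 1)) := by positivity
    simp only [hψ]
    linarith
  have hψle : ∀ (n : ℕ) (x : ℝ), 0 < x → ψ n x ≤ x + 1 := fun n x hx => by
    have h1 : x / (1 + x / ((n : ℝ) + 1)) ≤ x := by
      refine div_le_self hx.le ?_
      have : 0 ≤ x / ((n : ℝ) + 1) := by positivity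
      linarith
    have h2 : 1 / ((n : ℝ) + 1) ≤ 1 := by
      rw [div_le_one (by positivity)]
      have : (0 : ℝ) ≤ n := Nat.cast_nonneg n
      linarith
    simp only [hψ]
    linarith
  have hψle' : ∀ (n : ℕ) (x : ℝ), 0 < x → ψ n x ≤ ((n : ℝ) + 1) + 1 / ((n : ℝ) + 1) := fun n x hx => by
    have h1 : x / (1 + x / ((n : ℝ) + 1)) ≤ (n : ℝ) + 1 := by
      rw [div_le_iff₀ (by positivity)]
      have : ((n : ℝ) + 1) * (1 + x / ((n : ℝ) + 1)) = (n : ℝ) + 1 + x := by field_simp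
      rw [this]
      have : (0 : ℝ) ≤ n := Nat.cast_nonneg n
      linarith
    simp only [hψ]
    linarith
  have hψd : ∀ (n : ℕ) x, 0 < x → HasDerivAt (ψ n) (((1 + x / ((n : ℝ) + 1)) ^ 2)⁻¹) x := by
    intro n x hx
    have h1 : HasDerivAt (fun x : ℝ => 1 + x / ((n : ℝ) + 1)) (1 / ((n : ℝ) + 1)) x :=
      ((hasDerivAt_id x).div_const _).const_add 1
    have hne : 1 + x / ((n : ℝ) + 1) ≠ 0 := by positivity
    refine (((hasDerivAt_id x).div h1 hne).add_const _).congr_deriv ?_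
    simp only [id]
    field_simp
    ring
  -- With `y = 1 + g/(n+1) ≥ 1` one has `ψ' = y⁻²` and `ψ ≥ g/y`, so `ψ'²/ψ ≤ y⁻³/g ≤ 1/g`:
  -- truncation does not increase the information.
  have hinfo : ∀ n : ℕ, information β (fun v => ψ n (g v))
      (fun v => ((1 + g v / ((n : ℝ) + 1)) ^ 2)⁻¹ • g' v) ≤ information β g g' := by
    intro n
    refine lintegral_mono fun v => ?_
    have hv := hpos v
    have hψv := (hN n).trans_le (hψpos n _ hv)
    rw [enorm_sq_div_ofReal _ hv, enorm_sq_div_ofReal _ hψv]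
    refine ENNReal.ofReal_le_ofReal ?_
    set y := 1 + g v / ((n : ℝ) + 1) with hy
    have hy1 : 1 ≤ y := by
      have : 0 ≤ g v / ((n : ℝ) + 1) := by positivity
      linarith
    have hlow : g v / y ≤ ψ n (g v) := by
      simp only [hψ, ← hy]
      linarith [hN n]
    rw [norm_smul, Real.norm_of_nonneg (by positivity), mul_pow]
    have hgy : 0 < g v / y := by positivity
    calc ((y ^ 2)⁻¹ ^ 2 * ‖g' v‖ ^ 2) / ψ n (g v) ≤ ((y ^ 2)⁻¹ ^ 2 * ‖g' v‖ ^ 2) / (g v / y) := by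
          gcongr
      _ = (y ^ 3)⁻¹ * (‖g' v‖ ^ 2 / g v) := by field_simp
      _ ≤ 1 * (‖g' v‖ ^ 2 / g v) := by
          gcongr
          exact inv_le_one_of_one_le₀ (one_le_pow₀ hy1)
      _ = _ := one_mul _
  have hent : ∀ n : ℕ, entropy β (fun v => ψ n (g v)) ≤
      ENNReal.ofReal (klFun (∫ x, ψ n (g x) ∂gaussMeasure E β)) +
      ENNReal.ofReal (1 / (2 * β)) * information β g g' := by
    intro n
    refine (entropy_le_information_of_bounded hβ
      (fun x => hasGradientAt_scalar_comp (hψd n _ (hpos x)) (hg x)) ?_ (hN n)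
      (fun x => hψpos n _ (hpos x)) (fun x => hψle' n _ (hpos x))).trans ?_
    · refine Continuous.smul (Continuous.inv₀ (by fun_prop) fun x => ?_) hg'
      have := hpos x
      positivity
    · gcongr
      exact hinfo n
  have hmean : Tendsto (fun n => ∫ x, ψ n (g x) ∂gaussMeasure E β) atTop
      (𝓝 (∫ x, g x ∂gaussMeasure E β)) := by
    refine tendsto_integral_of_dominated_convergence (fun x => g x + 1)
      (fun n => (hψc n).aestronglyMeasurable) (hgi.add (integrable_const 1))
      (fun n => .of_forall fun x => ?_) (.of_forall fun x => hψlim _)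
    rw [Real.norm_of_nonneg ((hN n).le.trans (hψpos n _ (hpos x)))]
    exact hψle n _ (hpos x)
  have hR : Tendsto (fun n => ENNReal.ofReal (klFun (∫ x, ψ n (g x) ∂gaussMeasure E β)) +
      ENNReal.ofReal (1 / (2 * β)) * information β g g') atTop
      (𝓝 (ENNReal.ofReal (klFun (∫ x, g x ∂gaussMeasure E β)) +
      ENNReal.ofReal (1 / (2 * β)) * information β g g')) :=
    ((ENNReal.continuous_ofReal.tendsto _).comp
      ((continuous_klFun.tendsto _).comp hmean)).add tendsto_const_nhds
  have h1 : entropy β g =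
      ∫⁻ v, liminf (fun n => ENNReal.ofReal (klFun (ψ n (g v)))) atTop ∂gaussMeasure E β :=
    lintegral_congr fun v => ((ENNReal.continuous_ofReal.tendsto _).comp
        ((continuous_klFun.tendsto _).comp (hψlim (g v)))).liminf_eq.symm
  rw [h1]
  -- Fatou on the left, convergence of the means by domination by `g + 1` on the right.
  refine (lintegral_liminf_le fun n =>
    (measurable_klFun.comp (hψc n).measurable).ennreal_ofReal).trans ?_
  rw [← hR.liminf_eq]
  exact liminf_le_liminf (.of_forall hent)

/-- The entropy decreases along the Ornstein-Uhlenbeck semigroup, at most at the rate given by the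
information at the earlier time. -/
theorem entropy_le_entropy_mehler_add (hβ : 0 < β) {a b : ℝ} (hb : 0 < b)
    (hab : a ^ 2 + b ^ 2 = 1) {g : E → ℝ} {g' : E → E}
    (hg : ∀ x, HasGradientAt g (g' x) x) (hg' : Continuous g') (hpos : ∀ x, 0 < g x)
    (hgi : Integrable g (gaussMeasure E β)) :
    entropy β g ≤ entropy β (mehler β a b g) +
      ENNReal.ofReal (b ^ 2 / (2 * β)) * information β g g' := by
  have hgc : Continuous g := continuous_iff_continuousAt.2 fun x => (hg x).continuousAt
  have hm : Measurable (fun v => ‖g' v‖ₑ ^ 2 / ENNReal.ofReal (g v)) :=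
    (hg'.measurable.enorm.pow_const _).div hgc.measurable.ennreal_ofReal
  have hm1 : Measurable (fun v => ENNReal.ofReal (klFun (g v))) :=
    (measurable_klFun.comp hgc.measurable).ennreal_ofReal
  have hm2 : Measurable (fun v => ENNReal.ofReal (klFun (mehler β a b g v))) :=
    (continuous_klFun.comp (continuous_mehler hβ hb hab hgi)).measurable.ennreal_ofReal
  rw [information, ← lintegral_lintegral_comb hβ hab hm.aemeasurable, entropy, entropy,
    ← lintegral_lintegral_comb hβ hab hm1.aemeasurable,
    ← lintegral_const_mul' _ _ ENNReal.ofReal_ne_top, ← lintegral_add_left hm2]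
  refine lintegral_mono fun v => ?_
  -- The logarithmic Sobolev inequality for `x ↦ g(a v + b x)` with `v` fixed; its mean is the
  -- smoothed function at `v`, and the chain rule contributes the factor `b²`.
  have h := entropy_le_information hβ
    (fun x => HasGradientAt.comp_affine (p := a • v) (c := b) (hg (a • v + b • x)))
    ((hg'.comp (by fun_prop)).const_smul b) (fun x => hpos _)
    (integrable_comp_affine hβ hb hab hgi v)
  refine h.trans ?_
  refine add_le_add le_rfl ?_
  have e : b ^ 2 / (2 * β) = 1 / (2 * β) * b ^ 2 := by ring
  rw [e, ENNReal.ofReal_mul (by positivity), mul_assoc]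
  gcongr
  rw [information, ← lintegral_const_mul' _ _ ENNReal.ofReal_ne_top]
  refine lintegral_mono fun x => ?_
  rw [enorm_smul, mul_pow, mul_div_assoc]
  gcongr
  rw [← ofReal_norm, ← ENNReal.ofReal_pow (norm_nonneg _), Real.norm_eq_abs, sq_abs]

end SmoothApprox

section WeakGradient

variable {E : Type*} [NormedAddCommGroup E] [InnerProductSpace ℝ E] [FiniteDimensional ℝ E]
  [MeasurableSpace E] [BorelSpace E] {β : ℝ}

/-! ### Weak and classical gradients -/

theorem hasWeakGradient_of_hasGradientAt {h f : E → ℝ} {f' : E → E}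
    (hf : ∀ x, HasGradientAt f (f' x) x) (hf' : Continuous f') (hh : h =ᵐ[volume] f) :
    HasWeakGradient h f' := by
  have hfc : Continuous f := continuous_iff_continuousAt.2 fun x => (hf x).continuousAt
  refine ⟨hfc.locallyIntegrable.congr hh.symm, hf'.locallyIntegrable, fun φ hφ hφs w => ?_⟩
  have e : ∫ x, h x * fderiv ℝ φ x w = ∫ x, f x * fderiv ℝ φ x w :=
    integral_congr_ae (hh.mono fun x hx => by simp only [hx])
  have d1 : ∀ x, fderiv ℝ f x w = inner ℝ (f' x) w := fun x => (hf x).fderiv_apply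
  have hdφ : Continuous (fun x => fderiv ℝ φ x w) :=
    (hφ.continuous_fderiv (by simp)).clm_apply continuous_const
  rw [e, integral_mul_fderiv_eq_neg_fderiv_mul_of_integrable]
  · simp only [d1, mul_comm]
  · simp only [d1]
    exact Continuous.integrable_of_hasCompactSupport
      ((hf'.inner continuous_const).mul hφ.continuous) hφs.mul_left
  · exact Continuous.integrable_of_hasCompactSupport (hfc.mul hdφ)
      ((hφs.fderiv_apply (𝕜 := ℝ) w).mul_left)
  · exact Continuous.integrable_of_hasCompactSupport (hfc.mul hφ.continuous) hφs.mul_left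
  · exact fun x _ => (hf x).differentiableAt
  · exact fun x _ => (hφ.differentiable (by simp)).differentiableAt

theorem HasWeakGradient.ae_eq {h : E → ℝ} {g₁ g₂ : E → E} (h₁ : HasWeakGradient h g₁)
    (h₂ : HasWeakGradient h g₂) : g₁ =ᵐ[volume] g₂ := by
  have hd : LocallyIntegrable (fun x => g₁ x - g₂ x) (volume : Measure E) := h₁.2.1.sub h₂.2.1
  have h := ae_eq_zero_of_integral_contDiff_smul_eq_zero hd fun φ hφ hφs => by
    refine ext_inner_right ℝ fun w => ?_
    have i1 := h₁.2.1.integrable_smul_left_of_hasCompactSupport hφ.continuous hφs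
    have i2 := h₂.2.1.integrable_smul_left_of_hasCompactSupport hφ.continuous hφs
    have e1 := h₁.2.2 φ hφ hφs w
    have e2 := h₂.2.2 φ hφ hφs w
    rw [e1, neg_inj] at e2
    have k : ∀ g : E → E, Integrable (fun x => φ x • g x) (volume : Measure E) →
        inner ℝ (∫ x, φ x • g x) w = ∫ x, φ x * inner ℝ (g x) w := by
      intro g hg
      rw [real_inner_comm, ← integral_inner hg]
      refine integral_congr_ae (.of_forall fun x => ?_)
      simp only [inner_smul_right, real_inner_comm]
    simp only [smul_sub]
    rw [integral_sub i1 i2, inner_sub_left, k _ i1, k _ i2, e2, sub_self, inner_zero_left]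
  exact h.mono fun x hx => sub_eq_zero.1 hx

/-- The weak gradient is unique up to null sets, so the infimum runs over equal values, one of which
is attained by the classical gradient. -/
theorem fisherInfo_eq_information {h f : E → ℝ} {f' : E → E}
    (hf : ∀ x, HasGradientAt f (f' x) x) (hf' : Continuous f') (hh : h =ᵐ[volume] f) :
    fisherInfo β h = information β f f' := by
  have hw := hasWeakGradient_of_hasGradientAt hf hf' hh
  have key : ∀ g : E → E, HasWeakGradient h g →
      ∫⁻ v, ‖g v‖ₑ ^ 2 / ENNReal.ofReal (h v) ∂gaussMeasure E β = information β f f' := by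
    intro g hg
    refine lintegral_congr_ae ?_
    filter_upwards [gaussMeasure_absolutelyContinuous (hg.ae_eq hw),
      gaussMeasure_absolutelyContinuous hh] with v h1 h2
    rw [h1, h2]
  refine le_antisymm ((iInf₂_le f' hw).trans_eq (key f' hw)) (le_iInf₂ fun g hg => (key g hg).ge)

end WeakGradient

section EntropyComparison

variable {E : Type*} [NormedAddCommGroup E] [InnerProductSpace ℝ E] [FiniteDimensional ℝ E]
  [MeasurableSpace E] [BorelSpace E] {β : ℝ}

/-! ### From a bound on the information to a bound on the entropy -/

/-- The Ornstein-Uhlenbeck semigroup on functions. -/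
def ouFun (β s : ℝ) (h : E → ℝ) : E → ℝ :=
  mehler β (Real.exp (-s)) (√(1 - Real.exp (-2 * s))) h

/-- The gradient of `ouFun β s h`. -/
def ouGrad (β s : ℝ) (h : E → ℝ) : E → E :=
  mehlerGrad β (Real.exp (-s)) (√(1 - Real.exp (-2 * s))) h

theorem ouFun_zero (hβ : 0 < β) (h : E → ℝ) : ouFun β 0 h = h := by
  have := isProbabilityMeasure_gaussMeasure (E := E) hβ
  ext v
  simp [ouFun, mehler]

variable {h q : E → ℝ}

theorem integrable_ouFun (hβ : 0 < β) {s : ℝ} (hs : 0 ≤ s)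
    (hh : Integrable h (gaussMeasure E β)) : Integrable (ouFun β s h) (gaussMeasure E β) :=
  integrable_mehler hβ (ou_sq_add_sq hs) hh

theorem integral_ouFun (hβ : 0 < β) {s : ℝ} (hs : 0 ≤ s)
    (hh : Integrable h (gaussMeasure E β)) :
    ∫ v, ouFun β s h v ∂gaussMeasure E β = ∫ v, h v ∂gaussMeasure E β :=
  integral_mehler hβ (ou_sq_add_sq hs) hh

theorem ouFun_nonneg (h0 : ∀ x, 0 ≤ h x) (s : ℝ) (v : E) : 0 ≤ ouFun β s h v :=
  integral_nonneg fun _ => h0 _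

/-- Two independent Gaussian increments add up to one. The increment of size `b` is split by the
invariance `integral_mehler`, applied to `x ↦ h(a v + b x)` at fixed `v`. The kernel exists there
because `s + r > 0`, so the identity holds at every point. -/
theorem ouFun_ouFun (hβ : 0 < β) {s r : ℝ} (hs : 0 ≤ s) (hr : 0 < r)
    (hh : Integrable h (gaussMeasure E β)) :
    ouFun β s (ouFun β r h) = ouFun β (s + r) h := by
  ext v
  simp only [ouFun]
  have hsr : 0 < s + r := by linarith
  have ha : Real.exp (-(s + r)) = Real.exp (-r) * Real.exp (-s) := by
    rw [← Real.exp_add]; ring_nf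
  have h1 := ou_sq_add_sq hs
  have h2 := ou_sq_add_sq hr.le
  have h3 := ou_sq_add_sq hsr.le
  have hb := ou_sqrt_pos hsr
  rw [ha] at h3 ⊢
  generalize √(1 - Real.exp (-2 * (s + r))) = b at *
  generalize √(1 - Real.exp (-2 * s)) = bs at *
  generalize √(1 - Real.exp (-2 * r)) = br at *
  generalize Real.exp (-s) = as at *
  generalize Real.exp (-r) = ar at *
  -- The shares of the two increments in the total `b`.
  have hc : (ar * bs / b) ^ 2 + (br / b) ^ 2 = 1 := by
    field_simp
    linear_combination h2 - h3 + ar ^ 2 * h1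
  have hk := integrable_comp_affine hβ hb h3 hh v
  have := integral_mehler hβ hc hk
  rw [show mehler β (ar * as) b h v = _ from this.symm]
  simp only [mehler]
  refine integral_congr_ae (.of_forall fun x => integral_congr_ae (.of_forall fun y => ?_))
  simp only [smul_add, smul_smul]
  rw [mul_div_cancel₀ _ hb.ne', mul_div_cancel₀ _ hb.ne', add_assoc]

theorem hasGradientAt_ouFun (hβ : 0 < β) {s : ℝ} (hs : 0 < s)
    (hh : Integrable h (gaussMeasure E β)) (v : E) :
    HasGradientAt (ouFun β s h) (ouGrad β s h v) v :=
  hasGradientAt_mehler hβ (ou_sqrt_pos hs) (ou_sq_add_sq hs.le) hh v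

theorem continuous_ouGrad (hβ : 0 < β) {s : ℝ} (hs : 0 < s)
    (hh : Integrable h (gaussMeasure E β)) : Continuous (ouGrad β s h) :=
  continuous_mehlerGrad hβ (ou_sqrt_pos hs) (ou_sq_add_sq hs.le) hh

theorem ouFun_pos (hβ : 0 < β) {s : ℝ} (hs : 0 < s)
    (hh : Integrable h (gaussMeasure E β)) (h0 : ∀ x, 0 ≤ h x)
    (h1 : ∫ x, h x ∂gaussMeasure E β = 1) (v : E) : 0 < ouFun β s h v :=
  mehler_pos hβ (ou_sqrt_pos hs) (ou_sq_add_sq hs.le) hh (.of_forall h0) (by simp [h1]) v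

/-- Starting time `r = 0` is allowed: only the function at the later time has to be differentiable.
-/
theorem entropy_ouFun_add_le (hβ : 0 < β) {r s : ℝ} (hr : 0 ≤ r) (hs : 0 < s)
    (hh : Integrable h (gaussMeasure E β)) (h0 : ∀ x, 0 ≤ h x)
    (h1 : ∫ x, h x ∂gaussMeasure E β = 1) :
    entropy β (ouFun β (r + s) h) + ENNReal.ofReal (s / β) *
      information β (ouFun β (r + s) h) (ouGrad β (r + s) h) ≤ entropy β (ouFun β r h) := by
  have hrs : 0 < r + s := by linarith
  have e1 : ouFun β (r + s) h = ouFun β s (ouFun β r h) := by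
    rcases hr.eq_or_lt with rfl | hr
    · rw [zero_add, ouFun_zero hβ]
    · rw [ouFun_ouFun hβ hs.le hr hh, add_comm]
  have hi := integrable_ouFun hβ hr hh
  -- Both sides are gradients of the same function.
  have e2 : ouGrad β (r + s) h = ouGrad β s (ouFun β r h) := by
    ext1 v
    have g1 := hasGradientAt_ouFun hβ hrs hh v
    rw [e1] at g1
    exact g1.unique (hasGradientAt_ouFun hβ hs hi v)
  have h := entropy_mehler_add_le hβ (Real.exp_pos (-s)) (ou_sqrt_pos hs) (ou_sq_add_sq hs.le) hi
    (fun x => ouFun_nonneg h0 r x) (by rw [integral_ouFun hβ hr hh, h1]; exact one_pos)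
  rw [e1, e2]
  refine le_trans (add_le_add le_rfl (mul_le_mul_left (ENNReal.ofReal_le_ofReal ?_) _)) h
  have hb := Real.sq_sqrt (show 0 ≤ 1 - Real.exp (-2 * s) by
    have : Real.exp (-2 * s) ≤ 1 := Real.exp_le_one_iff.2 (by linarith)
    linarith)
  have ha : Real.exp (-s) ^ 2 = Real.exp (-2 * s) := by
    rw [← Real.exp_nat_mul]; push_cast; ring_nf
  -- The constant `b²/(2a²β)` equals `(e^{2s} - 1)/(2β)`, which is at least `s/β`.
  rw [hb, ha, div_le_div_iff₀ hβ (by positivity)]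
  have h2 : 2 * s + 1 ≤ Real.exp (2 * s) := Real.add_one_le_exp _
  have h3 : Real.exp (2 * s) * Real.exp (-2 * s) = 1 := by
    rw [← Real.exp_add]; simp
  have h4 := mul_le_mul_of_nonneg_right h2 (Real.exp_pos (-2 * s)).le
  rw [h3] at h4
  nlinarith

/-- Here the information is taken at the earlier time, so `r > 0` is needed for smoothness. -/
theorem entropy_ouFun_le (hβ : 0 < β) {r s : ℝ} (hr : 0 < r) (hs : 0 < s)
    (hh : Integrable h (gaussMeasure E β)) (h0 : ∀ x, 0 ≤ h x)
    (h1 : ∫ x, h x ∂gaussMeasure E β = 1) :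
    entropy β (ouFun β r h) ≤ entropy β (ouFun β (r + s) h) + ENNReal.ofReal (s / β) *
      information β (ouFun β r h) (ouGrad β r h) := by
  have h := entropy_le_entropy_mehler_add hβ (ou_sqrt_pos hs) (ou_sq_add_sq hs.le)
    (hasGradientAt_ouFun hβ hr hh) (continuous_ouGrad hβ hr hh) (ouFun_pos hβ hr hh h0 h1)
    (integrable_ouFun hβ hr.le hh)
  rw [add_comm r s, ← ouFun_ouFun hβ hs.le hr hh]
  refine h.trans (add_le_add le_rfl (mul_le_mul_left (ENNReal.ofReal_le_ofReal ?_) _))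
  have hb := Real.sq_sqrt (show 0 ≤ 1 - Real.exp (-2 * s) by
    have : Real.exp (-2 * s) ≤ 1 := Real.exp_le_one_iff.2 (by linarith)
    linarith)
  -- The constant `b²/(2β) = (1 - e^{-2s})/(2β)` is at most `s/β`.
  have h2 : -2 * s + 1 ≤ Real.exp (-2 * s) := Real.add_one_le_exp _
  rw [hb, div_le_div_iff₀ (by positivity) hβ]
  nlinarith

theorem entropy_ouFun_le_information (hβ : 0 < β) {s : ℝ} (hs : 0 < s)
    (hh : Integrable h (gaussMeasure E β)) (h0 : ∀ x, 0 ≤ h x)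
    (h1 : ∫ x, h x ∂gaussMeasure E β = 1) :
    entropy β (ouFun β s h) ≤ ENNReal.ofReal (1 / (2 * β)) *
      information β (ouFun β s h) (ouGrad β s h) := by
  have h := entropy_le_information hβ (hasGradientAt_ouFun hβ hs hh) (continuous_ouGrad hβ hs hh)
    (ouFun_pos hβ hs hh h0 h1) (integrable_ouFun hβ hs.le hh)
  rwa [integral_ouFun hβ hs.le hh, h1, klFun_one, ENNReal.ofReal_zero, zero_add] at h

theorem entropy_le_of_ouFun (hβ : 0 < β) (hh : Integrable h (gaussMeasure E β)) {C : ℝ≥0∞}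
    (hC : ∀ s, 0 < s → entropy β (ouFun β s h) ≤ C) : entropy β h ≤ C :=
  entropy_le_of_mehler hβ (fun k => ou_sq_add_sq (by positivity)) tendsto_exp_neg_one_div
    tendsto_sqrt_one_div hh fun k => hC _ (by positivity)

theorem entropy_le_of_information_eq_zero (hβ : 0 < β) (hh : Integrable h (gaussMeasure E β))
    (h0 : ∀ x, 0 ≤ h x) (h1 : ∫ x, h x ∂gaussMeasure E β = 1)
    (hI : ∀ s, 0 < s → information β (ouFun β s h) (ouGrad β s h) = 0) : entropy β h = 0 := by
  refine le_antisymm (entropy_le_of_ouFun hβ hh fun s hs => ?_) bot_le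
  simpa [hI s hs] using entropy_ouFun_le_information hβ hs hh h0 h1

/-- The discrete form of integrating the information inequality in `s`. The upper sum for `q` runs
over left endpoints of a grid from `δ`, the lower sum for `h` over right endpoints of a grid from
`0`; both use the points `δ, 2δ, …, nδ`. -/
theorem entropy_le_mul_of_information_le (hβ : 0 < β)
    (hq : Integrable q (gaussMeasure E β)) (hq0 : ∀ x, 0 ≤ q x)
    (hq1 : ∫ x, q x ∂gaussMeasure E β = 1)
    (hh : Integrable h (gaussMeasure E β)) (h0 : ∀ x, 0 ≤ h x)
    (h1 : ∫ x, h x ∂gaussMeasure E β = 1) {c : ℝ≥0} (hc : c ≠ 0)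
    (hI : ∀ s, 0 < s → information β (ouFun β s q) (ouGrad β s q) ≤
      c * information β (ouFun β s h) (ouGrad β s h)) :
    entropy β q ≤ c * entropy β h := by
  by_cases htop : entropy β h = ⊤
  · rw [htop, ENNReal.mul_top (by simpa using hc)]
    exact le_top
  refine entropy_le_of_ouFun hβ hq fun δ hδ => ?_
  set κ := ENNReal.ofReal (δ / β)
  set Iq : ℝ → ℝ≥0∞ := fun s => information β (ouFun β s q) (ouGrad β s q)
  set Ih : ℝ → ℝ≥0∞ := fun s => information β (ouFun β s h) (ouGrad β s h)
  have hpos : ∀ n : ℕ, 0 < ((n : ℝ) + 1) * δ := fun n => by positivity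
  have step : ∀ n : ℕ, ((n + 1 : ℕ) : ℝ) * δ = (n : ℝ) * δ + δ := fun n => by push_cast; ring
  -- The dissipation between `δ` and `(n+1)δ`, overestimated at left endpoints.
  have up : ∀ n : ℕ, entropy β (ouFun β δ q) ≤ entropy β (ouFun β ((n + 1 : ℕ) * δ) q) +
      ∑ k ∈ Finset.range n, κ * Iq ((k + 1 : ℕ) * δ) := by
    intro n
    induction n with
    | zero => simp
    | succ n ih =>
      rw [Finset.sum_range_succ, add_comm (Finset.sum _ _), ← add_assoc]
      refine ih.trans (add_le_add ?_ le_rfl)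
      rw [step (n + 1)]
      exact entropy_ouFun_le hβ (by positivity) hδ hq hq0 hq1
  -- The dissipation between `0` and `nδ`, underestimated at right endpoints.
  have low : ∀ n : ℕ, entropy β (ouFun β (n * δ) h) +
      ∑ k ∈ Finset.range n, κ * Ih ((k + 1 : ℕ) * δ) ≤ entropy β h := by
    intro n
    induction n with
    | zero => simp [ouFun_zero hβ]
    | succ n ih =>
      rw [Finset.sum_range_succ, add_comm (Finset.sum _ _), ← add_assoc]
      refine le_trans (add_le_add ?_ le_rfl) ih
      rw [step n]
      exact entropy_ouFun_add_le hβ (by positivity) hδ hh h0 h1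
  -- The logarithmic Sobolev inequality bounds the remaining entropy of `q` by the information,
  -- hence by that of `h` at time `T`. One step of `entropy_ouFun_add_le` from `0` to `T` shows
  -- `(T/β) I(P_T h) ≤ Ent h`, so the tail is `O(1/T)`.
  have tail : ∀ T, 0 < T → entropy β (ouFun β T q) ≤
      ENNReal.ofReal (1 / (2 * T)) * (c * entropy β h) := by
    intro T hT
    have l1 := entropy_ouFun_add_le hβ le_rfl hT hh h0 h1
    rw [zero_add, ouFun_zero hβ] at l1
    have l2 := (le_add_self).trans l1
    calc entropy β (ouFun β T q) ≤ ENNReal.ofReal (1 / (2 * β)) * Iq T :=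
          entropy_ouFun_le_information hβ hT hq hq0 hq1
      _ ≤ ENNReal.ofReal (1 / (2 * β)) * (c * Ih T) := by gcongr; exact hI T hT
      _ = ENNReal.ofReal (1 / (2 * T)) * (c * (ENNReal.ofReal (T / β) * Ih T)) := by
          have e : 1 / (2 * β) = 1 / (2 * T) * (T / β) := by field_simp
          rw [e, ENNReal.ofReal_mul (by positivity)]
          ring
      _ ≤ _ := by gcongr
  have bound : ∀ n : ℕ, entropy β (ouFun β δ q) ≤
      ENNReal.ofReal (1 / (2 * (((n + 1 : ℕ) : ℝ) * δ))) * (c * entropy β h) +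
        c * entropy β h := by
    intro n
    refine (up n).trans (add_le_add (tail _ (by positivity)) ?_)
    calc ∑ k ∈ Finset.range n, κ * Iq ((k + 1 : ℕ) * δ)
        ≤ ∑ k ∈ Finset.range n, c * (κ * Ih ((k + 1 : ℕ) * δ)) := by
          refine Finset.sum_le_sum fun k _ => ?_
          rw [mul_left_comm]
          gcongr
          exact hI _ (by positivity)
      _ = c * ∑ k ∈ Finset.range n, κ * Ih ((k + 1 : ℕ) * δ) := by rw [Finset.mul_sum]
      _ ≤ c * entropy β h := by gcongr; exact le_add_self.trans (low n)
  have hlim : Tendsto (fun n : ℕ => ENNReal.ofReal (1 / (2 * (((n + 1 : ℕ) : ℝ) * δ))) *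
      (c * entropy β h) + c * entropy β h) atTop (𝓝 (0 * (c * entropy β h) + c * entropy β h)) := by
    have h1 : Tendsto (fun n : ℕ => 1 / (2 * (((n + 1 : ℕ) : ℝ) * δ))) atTop (𝓝 0) := by
      have := (tendsto_one_div_add_atTop_nhds_zero_nat (𝕜 := ℝ)).const_mul (1 / (2 * δ))
      rw [mul_zero] at this
      refine this.congr fun n => ?_
      push_cast
      field_simp
    have h2 := (ENNReal.continuous_ofReal.tendsto _).comp h1
    rw [ENNReal.ofReal_zero] at h2
    exact (ENNReal.Tendsto.mul_const h2 (.inr (ENNReal.mul_ne_top ENNReal.coe_ne_top htop))).add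
      tendsto_const_nhds
  rw [zero_mul, zero_add] at hlim
  exact ge_of_tendsto' hlim bound

/-- If the information of `P_s q` is at most `c` times the information of `P_s h` for all `s > 0`,
then the entropy of `q` is at most `c` times the entropy of `h`. -/
theorem entropy_le_mul_of_forall_information_le (hβ : 0 < β)
    (hq : Integrable q (gaussMeasure E β)) (hq0 : ∀ x, 0 ≤ q x)
    (hq1 : ∫ x, q x ∂gaussMeasure E β = 1)
    (hh : Integrable h (gaussMeasure E β)) (h0 : ∀ x, 0 ≤ h x)
    (h1 : ∫ x, h x ∂gaussMeasure E β = 1) (c : ℝ)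
    (hI : ∀ s : ℝ, 0 < s → (information β (ouFun β s q) (ouGrad β s q) : EReal) ≤
      (c : EReal) * (information β (ouFun β s h) (ouGrad β s h) : EReal)) :
    (entropy β q : EReal) ≤ (c : EReal) * (entropy β h : EReal) := by
  -- A negative `c` forces both informations to vanish at every positive time, and `c = 0` forces
  -- that of `q` to vanish. The corresponding entropies are then `0` by the logarithmic Sobolev
  -- inequality and lower semicontinuity.
  rcases lt_trichotomy c 0 with hc | rfl | hc
  · have hIh : ∀ s, 0 < s → information β (ouFun β s h) (ouGrad β s h) = 0 := by
      intro s hs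
      by_contra hne
      have hlt : (c : EReal) * (information β (ouFun β s h) (ouGrad β s h) : EReal) < 0 := by
        refine EReal.mul_neg_iff.2 (.inr ⟨by exact_mod_cast hc, ?_⟩)
        exact_mod_cast pos_iff_ne_zero.2 hne
      exact absurd ((EReal.coe_ennreal_nonneg _).trans (hI s hs)) (not_le.2 hlt)
    have hIq : ∀ s, 0 < s → information β (ouFun β s q) (ouGrad β s q) = 0 := by
      intro s hs
      have := hI s hs
      rw [hIh s hs] at this
      exact EReal.coe_ennreal_eq_zero.1 (le_antisymm (by simpa using this)
        (EReal.coe_ennreal_nonneg _))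
    rw [entropy_le_of_information_eq_zero hβ hh h0 h1 hIh,
      entropy_le_of_information_eq_zero hβ hq hq0 hq1 hIq]
    simp
  · have hIq : ∀ s, 0 < s → information β (ouFun β s q) (ouGrad β s q) = 0 := by
      intro s hs
      exact EReal.coe_ennreal_eq_zero.1 (le_antisymm (by simpa using hI s hs)
        (EReal.coe_ennreal_nonneg _))
    rw [entropy_le_of_information_eq_zero hβ hq hq0 hq1 hIq]
    simp
  · lift c to ℝ≥0 using hc.le
    have hc' : c ≠ 0 := by rintro rfl; simp at hc
    have e : ∀ x : ℝ≥0∞, (((c : ℝ≥0∞) * x : ℝ≥0∞) : EReal) = ((c : ℝ) : EReal) * (x : EReal) := by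
      intro x
      rw [EReal.coe_ennreal_mul]
      rfl
    rw [← e]
    refine EReal.coe_ennreal_le_coe_ennreal_iff.2
      (entropy_le_mul_of_information_le hβ hq hq0 hq1 hh h0 h1 hc' fun s hs => ?_)
    have := hI s hs
    rw [← e] at this
    exact EReal.coe_ennreal_le_coe_ennreal_iff.1 this

end EntropyComparison

section AverageComm

/-! ### Commuting averaging operators -/

variable {X X₁ X₂ Y₁ Y₂ Y₁' Y₂' Z : Type*} [MeasurableSpace X] [MeasurableSpace X₁]
  [MeasurableSpace X₂] [MeasurableSpace Y₁] [MeasurableSpace Y₂] [MeasurableSpace Y₁']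
  [MeasurableSpace Y₂'] [MeasurableSpace Z] {μ : Measure X} {μ₁ : Measure X₁} {μ₂ : Measure X₂}
  {ν₁ : Measure Y₁} {ν₂ : Measure Y₂} {ν₁' : Measure Y₁'} {ν₂' : Measure Y₂'} {κ : Measure Z}
  [SFinite μ] [SFinite μ₁] [SFinite μ₂] [SFinite ν₁] [SFinite ν₂] [SFinite ν₁'] [SFinite ν₂']

theorem measurePreserving_comp_average {A : X₁ × Y₁ → Z} {B : X × Y₂ → X₁}
    (hA : MeasurePreserving A (μ₁.prod ν₁) κ) (hB : MeasurePreserving B (μ.prod ν₂) μ₁) :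
    MeasurePreserving (fun p : X × (Y₂ × Y₁) => A (B (p.1, p.2.1), p.2.2))
      (μ.prod (ν₂.prod ν₁)) κ := by
  have h1 : MeasurePreserving (MeasurableEquiv.prodAssoc.symm : X × (Y₂ × Y₁) → (X × Y₂) × Y₁)
      (μ.prod (ν₂.prod ν₁)) ((μ.prod ν₂).prod ν₁) :=
    (measurePreserving_prodAssoc μ ν₂ ν₁).symm _
  exact hA.comp ((hB.prod (MeasurePreserving.id ν₁)).comp h1)

theorem averageOp_averageOp_ae {A : X₁ × Y₁ → Z} {B : X × Y₂ → X₁}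
    (hA : MeasurePreserving A (μ₁.prod ν₁) κ) (hB : MeasurePreserving B (μ.prod ν₂) μ₁)
    (φ : Lp ℝ 1 κ) :
    averageOp B hB (averageOp A hA φ) =ᵐ[μ]
      fun x => ∫ p, φ (A (B (x, p.1), p.2)) ∂(ν₂.prod ν₁) := by
  have hC := measurePreserving_comp_average hA hB
  have hint := hC.integrable_comp_of_integrable (L1.integrable_coeFn φ)
  have h1 := hB.quasiMeasurePreserving.ae_eq_comp (averageOp_ae A hA φ)
  filter_upwards [averageOp_ae B hB (averageOp A hA φ), Measure.ae_ae_of_ae_prod h1,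
    hint.prod_right_ae] with x hx hx1 hx2
  rw [hx, integral_prod (fun p => φ (A (B (x, p.1), p.2))) hx2]
  exact integral_congr_ae hx1

/-- Each side is one integral over a pair of auxiliary variables. They agree once a
measure-preserving change `T` of these variables matches the integrands; for almost every `x` both
iterated averages are such integrals. -/
theorem averageOp_averageOp_comm {A : X₁ × Y₁ → Z} {B : X × Y₂ → X₁}
    (hA : MeasurePreserving A (μ₁.prod ν₁) κ) (hB : MeasurePreserving B (μ.prod ν₂) μ₁)
    {A' : X₂ × Y₁' → Z} {B' : X × Y₂' → X₂}
    (hA' : MeasurePreserving A' (μ₂.prod ν₁') κ) (hB' : MeasurePreserving B' (μ.prod ν₂') μ₂)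
    {T : Y₂ × Y₁ → Y₂' × Y₁'} (hT : MeasurePreserving T (ν₂.prod ν₁) (ν₂'.prod ν₁'))
    (h : ∀ x y, A' (B' (x, (T y).1), (T y).2) = A (B (x, y.1), y.2)) (φ : Lp ℝ 1 κ) :
    averageOp B hB (averageOp A hA φ) = averageOp B' hB' (averageOp A' hA' φ) := by
  apply Lp.ext
  have hC' := measurePreserving_comp_average hA' hB'
  filter_upwards [averageOp_averageOp_ae hA hB φ, averageOp_averageOp_ae hA' hB' φ]
    with x h1 h2
  rw [h1, h2]
  have hm : AEStronglyMeasurable (fun p : Y₂' × Y₁' => φ (A' (B' (x, p.1), p.2)))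
      (ν₂'.prod ν₁') :=
    ((Lp.stronglyMeasurable φ).comp_measurable
      (hC'.measurable.comp measurable_prodMk_left)).aestronglyMeasurable
  rw [← integral_comp_measurePreserving hT hm]
  simp only [h]

theorem averageOp_nonneg {A : X₁ × Y₁ → Z} (hA : MeasurePreserving A (μ₁.prod ν₁) κ)
    {φ : Lp ℝ 1 κ} (hφ : 0 ≤ φ) : 0 ≤ averageOp A hA φ := by
  rw [← Lp.coeFn_nonneg] at hφ ⊢
  have h1 := Measure.ae_ae_of_ae_prod (hA.quasiMeasurePreserving.ae hφ)
  filter_upwards [averageOp_ae A hA φ, h1] with x hx hx1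
  rw [hx]
  exact integral_nonneg_of_ae hx1

theorem integral_averageOp {A : X₁ × Y₁ → Z} (hA : MeasurePreserving A (μ₁.prod ν₁) κ)
    (φ : Lp ℝ 1 κ) : ∫ x, averageOp A hA φ x ∂μ₁ = ∫ z, φ z ∂κ := by
  rw [integral_congr_ae (averageOp_ae A hA φ),
    ← integral_prod (fun p => φ (A p)) (integrable_comp_prod A hA φ)]
  exact integral_comp_measurePreserving hA (Lp.stronglyMeasurable φ).aestronglyMeasurable

end AverageComm

/-! ### The ground state transformation and the relative entropy. -/

section GroundState

variable {E : Type*} [NormedAddCommGroup E] [InnerProductSpace ℝ E] [FiniteDimensional ℝ E]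
  [MeasurableSpace E] [BorelSpace E] {β : ℝ}

theorem groundState_ae (hβ : 0 < β) (f : Lp ℝ 1 (volume : Measure E)) :
    groundState hβ f =ᵐ[gaussMeasure E β] fun v => f v / maxwell β v :=
  Integrable.coeFn_toL1 _

/-- The ground state transformation as a bounded operator. -/
def groundStateCLM (hβ : 0 < β) :
    Lp ℝ 1 (volume : Measure E) →L[ℝ] Lp ℝ 1 (gaussMeasure E β) :=
  LinearMap.mkContinuous
    { toFun := groundState hβ
      map_add' := by
        intro f g
        apply Lp.ext
        filter_upwards [groundState_ae hβ (f + g), groundState_ae hβ f, groundState_ae hβ g,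
          Lp.coeFn_add (groundState hβ f) (groundState hβ g),
          gaussMeasure_absolutelyContinuous (Lp.coeFn_add f g)] with v h1 h2 h3 h4 h5
        rw [h1, h4, Pi.add_apply, h2, h3, h5, Pi.add_apply, add_div]
      map_smul' := by
        intro c f
        apply Lp.ext
        filter_upwards [groundState_ae hβ (c • f), groundState_ae hβ f,
          Lp.coeFn_smul c (groundState hβ f),
          gaussMeasure_absolutelyContinuous (Lp.coeFn_smul c f)] with v h1 h2 h3 h4
        rw [h1, RingHom.id_apply, h3, Pi.smul_apply, h2, h4, Pi.smul_apply, smul_eq_mul,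
          smul_eq_mul, mul_div_assoc] }
    1 (by
      intro f
      change ‖groundState hβ f‖ ≤ 1 * ‖f‖
      rw [one_mul, L1.norm_eq_integral_norm, L1.norm_eq_integral_norm,
        integral_congr_ae (g := fun v => ‖f v / maxwell β v‖)
          ((groundState_ae hβ f).mono fun v hv => by simp only [hv]), integral_gaussMeasure hβ]
      refine (integral_congr_ae (.of_forall fun v => ?_)).le
      have := maxwell_pos hβ v
      simp only [norm_div, smul_eq_mul, Real.norm_of_nonneg this.le]
      field_simp)

theorem groundStateCLM_apply (hβ : 0 < β) (f : Lp ℝ 1 (volume : Measure E)) :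
    groundStateCLM hβ f = groundState hβ f := rfl

theorem groundState_nonneg (hβ : 0 < β) {f : Lp ℝ 1 (volume : Measure E)}
    (hf : ∀ᵐ v, 0 ≤ f v) : 0 ≤ groundState hβ f := by
  rw [← Lp.coeFn_nonneg]
  filter_upwards [groundState_ae hβ f, gaussMeasure_absolutelyContinuous.ae_le hf] with v h1 h2
  rw [h1]
  exact div_nonneg h2 (maxwell_pos hβ v).le

theorem integral_groundState (hβ : 0 < β) (f : Lp ℝ 1 (volume : Measure E)) :
    ∫ v, groundState hβ f v ∂gaussMeasure E β = ∫ v, f v := by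
  rw [integral_congr_ae (groundState_ae hβ f), integral_gaussMeasure hβ]
  refine integral_congr_ae (.of_forall fun v => ?_)
  have := maxwell_pos hβ v
  simp only [smul_eq_mul]
  field_simp

/-- The integrands `h ln h` and `klFun h` differ by `1 - h`, which has integral `0` because `γ` and
`h γ` both have mass `1`. -/
theorem relEntropy_eq_entropy (hβ : 0 < β) {f : Lp ℝ 1 (volume : Measure E)}
    (hf : ∀ᵐ v, 0 ≤ f v) (hf1 : ∫ v, f v = 1) :
    relEntropy f (maxwell β) = (entropy β (groundState hβ f) : EReal) := by
  have := isProbabilityMeasure_gaussMeasure (E := E) hβ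
  set h := groundState hβ f with hh
  set x : E → ℝ := fun v => h v * Real.log (h v) with hx
  have h0 : ∀ᵐ v ∂gaussMeasure E β, 0 ≤ h v := (Lp.coeFn_nonneg h).2 (groundState_nonneg hβ hf)
  have h1 : ∫ v, h v ∂gaussMeasure E β = 1 := (integral_groundState hβ f).trans hf1
  have hi : Integrable h (gaussMeasure E β) := L1.integrable_coeFn h
  have hfm : Measurable (f : E → ℝ) := (Lp.stronglyMeasurable f).measurable
  have hhm : Measurable (h : E → ℝ) := (Lp.stronglyMeasurable h).measurable
  have hxm : Measurable x := hhm.mul hhm.log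
  have hγm : Measurable (maxwell (E := E) β) := (maxwell_continuous β).measurable
  -- The sign `σ = ±1` treats the positive and the negative part at once.
  have key : ∀ σ : ℝ, ∫⁻ v, ENNReal.ofReal (σ * (f v * Real.log (f v / maxwell β v))) =
      ∫⁻ v, ENNReal.ofReal (σ * x v) ∂gaussMeasure E β := by
    intro σ
    have e1 : ∫⁻ v, ENNReal.ofReal (σ * x v) ∂gaussMeasure E β =
        ∫⁻ v, ENNReal.ofReal (σ * (f v / maxwell β v * Real.log (f v / maxwell β v)))
          ∂gaussMeasure E β :=
      lintegral_congr_ae ((groundState_ae hβ f).mono fun v hv => by simp only [hx, hh, hv])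
    have hm : Measurable (fun v =>
        ENNReal.ofReal (σ * (f v / maxwell β v * Real.log (f v / maxwell β v)))) :=
      (((hfm.div hγm).mul (hfm.div hγm).log).const_mul σ).ennreal_ofReal
    rw [e1, lintegral_gaussMeasure _ hm]
    refine lintegral_congr fun v => ?_
    have hv := maxwell_pos hβ v
    rw [← ENNReal.ofReal_mul hv.le]
    congr 1
    field_simp
  have k1 := key 1
  have k2 := key (-1)
  simp only [one_mul, neg_one_mul] at k1 k2
  rw [relEntropy, k1, k2]
  -- The bound `h ln h ≥ h - 1 ≥ -1` keeps the negative part finite, so the difference in `EReal` is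
  -- never `∞ - ∞`.
  have hneg : ∫⁻ v, ENNReal.ofReal (-x v) ∂gaussMeasure E β ≤ 1 := by
    refine (lintegral_mono_ae (g := fun _ => 1) (h0.mono fun v hv => ?_)).trans_eq (by simp)
    have h2 := klFun_nonneg hv
    rw [klFun_apply] at h2
    exact ENNReal.ofReal_le_one.2 (by simp only [hx]; linarith)
  have hneg' : ∫⁻ v, ENNReal.ofReal (-x v) ∂gaussMeasure E β ≠ ⊤ :=
    ne_top_of_le_ne_top ENNReal.one_ne_top hneg
  by_cases htop : entropy β h = ⊤
  · have hpos : ∫⁻ v, ENNReal.ofReal (x v) ∂gaussMeasure E β = ⊤ := by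
      by_contra hne
      refine (lt_top_iff_ne_top.1 (lt_of_le_of_lt (b := ∫⁻ v, (ENNReal.ofReal (x v) + 1)
        ∂gaussMeasure E β) (lintegral_mono_ae (h0.mono fun v hv => ?_)) ?_)) htop
      · refine le_trans (b := ENNReal.ofReal (x v + 1)) (ENNReal.ofReal_le_ofReal ?_)
          (ENNReal.ofReal_add_le.trans_eq (by rw [ENNReal.ofReal_one]))
        rw [klFun_apply]
        simp only [hx]
        linarith
      · rw [lintegral_add_right _ measurable_const]
        simpa using lt_top_iff_ne_top.2 hne
    rw [hpos, htop]
    lift ∫⁻ v, ENNReal.ofReal (-x v) ∂gaussMeasure E β to ℝ≥0 using hneg' with y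
    rfl
  · have hkl0 : 0 ≤ᵐ[gaussMeasure E β] fun v => klFun (h v) := h0.mono fun v hv => klFun_nonneg hv
    have hkl : Integrable (fun v => klFun (h v)) (gaussMeasure E β) :=
      (lintegral_ofReal_ne_top_iff_integrable
        (measurable_klFun.comp hhm).aestronglyMeasurable hkl0).1 htop
    have e : x = fun v => klFun (h v) - 1 + h v := by
      ext v
      simp only [hx, klFun_apply]
      ring
    have hsub : Integrable (fun v => klFun (h v) - 1) (gaussMeasure E β) :=
      hkl.sub (integrable_const 1)
    have hxi : Integrable x (gaussMeasure E β) := by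
      rw [e]
      exact hsub.add hi
    have hxint : ∫ v, x v ∂gaussMeasure E β = ∫ v, klFun (h v) ∂gaussMeasure E β := by
      rw [e, integral_add hsub hi, integral_sub hkl (integrable_const 1), h1]
      simp
    have hpart := integral_eq_lintegral_pos_part_sub_lintegral_neg_part hxi
    have hent : entropy β h = ENNReal.ofReal (∫ v, klFun (h v) ∂gaussMeasure E β) :=
      (ofReal_integral_eq_lintegral_ofReal hkl hkl0).symm
    have hpos' : ∫⁻ v, ENNReal.ofReal (x v) ∂gaussMeasure E β ≠ ⊤ :=
      hxi.lintegral_lt_top.ne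
    rw [hent, ← hxint]
    have hxnn : 0 ≤ ∫ v, x v ∂gaussMeasure E β := hxint ▸ integral_nonneg_of_ae hkl0
    rw [EReal.coe_ennreal_ofReal, max_eq_left hxnn, hpart]
    rw [← EReal.coe_ennreal_toReal hpos', ← EReal.coe_ennreal_toReal hneg']
    rfl

end GroundState

section Model

/-! ### The Kac evolution and the Ornstein-Uhlenbeck semigroup commute -/

variable {d N M : ℕ} {β : ℝ}

section

variable {ι : Type} [Fintype ι] [DecidableEq ι]

/-- The change of variables that moves a collision past `P_s`: the Gaussian variable is rotated by
`M_σ`, and the order of the variables is exchanged. -/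
theorem measurePreserving_collide_skew (μ : Measure (State d ι)) [SFinite μ] [RotationInvariant μ]
    (ρ : Measure (ScatSphere d)) [IsProbabilityMeasure ρ] (i j : ι) :
    MeasurePreserving (fun p : State d ι × ScatSphere d => (p.2, collide i j p.2 p.1))
      (μ.prod ρ) (ρ.prod μ) := by
  have h1 : MeasurePreserving
      (fun p : ScatSphere d × State d ι => (id p.1, collide i j p.1 p.2))
      (ρ.prod μ) (ρ.prod μ) := by
    refine (MeasurePreserving.id ρ).skew_product (g := fun σ u => collide i j σ u) ?_ ?_
    · exact ((collideMap_continuous i j).comp continuous_swap).measurable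
    · exact .of_forall fun σ =>
        (RotationInvariant.measurePreserving (μ := μ) (collideIsometry i j σ)).map_eq
  exact h1.comp Measure.measurePreserving_swap

theorem collide_ouMap (i j : ι) (σ : ScatSphere d) (s : ℝ≥0) (u x : State d ι) :
    collide i j σ (ouMap s (u, x)) = ouMap s (collide i j σ u, collide i j σ x) := by
  have h := map_add (collideIsometry i j σ).toLinearEquiv (Real.exp (-(s : ℝ)) • u)
    (√(1 - Real.exp (-2 * (s : ℝ))) • x)
  rw [map_smul, map_smul] at h
  exact h

theorem ornsteinUhlenbeck_collisionOp (hβ : 0 < β) (ρ : Measure (ScatSphere d))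
    [IsProbabilityMeasure ρ] (i j : ι) (s : ℝ≥0) (φ : Lp ℝ 1 (gaussMeasure (State d ι) β)) :
    ornsteinUhlenbeck hβ s (collisionOp (gaussMeasure (State d ι) β) ρ i j φ) =
      collisionOp (gaussMeasure (State d ι) β) ρ i j (ornsteinUhlenbeck hβ s φ) :=
  averageOp_averageOp_comm _ _ _ _
    (measurePreserving_collide_skew (gaussMeasure (State d ι) β) ρ i j)
    (fun u p => (collide_ouMap i j p.2 s u p.1).symm) φ

theorem maxwell_collide (i j : ι) (σ : ScatSphere d) (u : State d ι) :
    maxwell β (collide i j σ u) = maxwell β u := by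
  simp only [maxwell, collide_norm]

/-- `γ` depends on `u` only through its norm, which collisions preserve. -/
theorem groundState_collisionOp (hβ : 0 < β) (ρ : Measure (ScatSphere d))
    [IsProbabilityMeasure ρ] (i j : ι) (f : Lp ℝ 1 (volume : Measure (State d ι))) :
    groundStateCLM hβ (collisionOp volume ρ i j f) =
      collisionOp (gaussMeasure (State d ι) β) ρ i j (groundStateCLM hβ f) := by
  apply Lp.ext
  have hpres := collideMap_measurePreserving (gaussMeasure (State d ι) β) ρ i j
  filter_upwards [groundState_ae hβ (collisionOp volume ρ i j f),
    gaussMeasure_absolutelyContinuous.ae_le (averageOp_ae (collideMap i j)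
      (collideMap_measurePreserving volume ρ i j) f),
    averageOp_ae (collideMap i j) hpres (groundState hβ f),
    Measure.ae_ae_of_ae_prod (hpres.quasiMeasurePreserving.ae_eq_comp (groundState_ae hβ f))]
    with u h1 h2 h3 h4
  simp only [Function.comp_apply] at h4
  rw [groundStateCLM_apply, h1, collisionOp, h2, collisionOp, groundStateCLM_apply, h3,
    integral_congr_ae h4, ← integral_div]
  refine integral_congr_ae (.of_forall fun σ => ?_)
  simp only [collideMap, maxwell_collide]

end

theorem measurePreserving_split (hβ : 0 < β) :
    MeasurePreserving (fun u : FullState d N M => (kacPart u, reservoirPart u))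
      (gaussMeasure _ β) ((gaussMeasure _ β).prod (gaussMeasure _ β)) := by
  have h1 := (gaussMeasure_prod (E := State d (Fin N)) (F := State d (Fin M)) hβ).symm
    (MeasurableEquiv.toLp 2 (State d (Fin N) × State d (Fin M)))
  exact h1.comp (gaussMeasure_isometry β (joinIsometry (d := d) (N := N) (M := M)).symm)

/-- The change of variables for `Π_γ P_s = P_s Π_γ`: the reservoir variable `w` and the reservoir
half of the noise combine into a new variable of law `γ`, independent of the half that acts on the
Kac system. -/
theorem measurePreserving_reservoir_ou (hβ : 0 < β) (s : ℝ≥0) :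
    MeasurePreserving (fun p : State d (Fin M) × FullState d N M =>
      (kacPart p.2, ouMap s (p.1, reservoirPart p.2)))
      ((gaussMeasure _ β).prod (gaussMeasure _ β))
      ((gaussMeasure _ β).prod (gaussMeasure _ β)) := by
  set γN := gaussMeasure (State d (Fin N)) β
  set γM := gaussMeasure (State d (Fin M)) β
  have h1 := (MeasurePreserving.id γM).prod (measurePreserving_split (d := d) (N := N) (M := M) hβ)
  have h2 : MeasurePreserving (MeasurableEquiv.prodAssoc : (_ × _) × _ → _ × (_ × _))
      ((γN.prod γM).prod γM) (γN.prod (γM.prod γM)) := measurePreserving_prodAssoc γN γM γM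
  have h3 := (MeasurePreserving.id γN).prod
    ((ouMap_measurePreserving (E := State d (Fin M)) hβ s).comp
      (Measure.measurePreserving_swap (μ := γM) (ν := γM)))
  exact h3.comp (h2.comp ((Measure.measurePreserving_swap (μ := γM) (ν := γN.prod γM)).comp h1))

theorem joinState_ouMap (s : ℝ≥0) (v : State d (Fin N)) (w : State d (Fin M))
    (x : FullState d N M) :
    joinState (ouMap s (v, kacPart x), ouMap s (w, reservoirPart x)) =
      ouMap s (joinState (v, w), x) := by
  ext1 k
  cases k <;> rfl

theorem ornsteinUhlenbeck_gaussMarginal (hβ : 0 < β) (s : ℝ≥0)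
    (φ : Lp ℝ 1 (gaussMeasure (FullState d N M) β)) :
    gaussMarginal hβ (ornsteinUhlenbeck hβ s φ) = ornsteinUhlenbeck hβ s (gaussMarginal hβ φ) :=
  have := isProbabilityMeasure_gaussMeasure (E := State d (Fin M)) hβ
  averageOp_averageOp_comm _ _ _ _ (measurePreserving_reservoir_ou hβ s)
    (fun v p => joinState_ouMap s v p.1 p.2) φ

theorem extendState_ae (hβ : 0 < β) (h : Lp ℝ 1 (gaussMeasure (State d (Fin N)) β)) :
    extendState M hβ h =ᵐ[gaussMeasure (FullState d N M) β] fun u => h (kacPart u) :=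
  Lp.coeFn_compMeasurePreserving h (kacPart_gauss hβ)

/-- A function of `v` alone sees only the Kac half of the noise, and that half has law `γ`. -/
theorem ornsteinUhlenbeck_extendState (hβ : 0 < β) (s : ℝ≥0)
    (h : Lp ℝ 1 (gaussMeasure (State d (Fin N)) β)) :
    extendState M hβ (ornsteinUhlenbeck hβ s h) = ornsteinUhlenbeck hβ s (extendState M hβ h) := by
  apply Lp.ext
  have hk := kacPart_gauss (d := d) (N := N) (M := M) hβ
  have hou := ouMap_measurePreserving (E := FullState d N M) hβ s
  have e1 := hk.quasiMeasurePreserving.ae_eq_comp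
    (averageOp_ae (ouMap s) (ouMap_measurePreserving hβ s) h)
  filter_upwards [extendState_ae (M := M) hβ (ornsteinUhlenbeck hβ s h), e1,
    averageOp_ae (ouMap s) hou (extendState M hβ h),
    Measure.ae_ae_of_ae_prod (hou.quasiMeasurePreserving.ae_eq_comp (extendState_ae hβ h))]
    with u h1 h2 h3 h4
  simp only [Function.comp_apply] at h2 h4
  rw [h1, ornsteinUhlenbeck, h2, ornsteinUhlenbeck, h3, integral_congr_ae h4]
  have hm : AEStronglyMeasurable (fun x => h (ouMap s (kacPart u, x)))
      (gaussMeasure (State d (Fin N)) β) :=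
    ((Lp.stronglyMeasurable h).comp_measurable
      ((ouMap_measurePreserving hβ s).measurable.comp measurable_prodMk_left)).aestronglyMeasurable
  rw [← integral_comp_measurePreserving hk hm]
  rfl

theorem map_kacGenerator {μ ν : Measure (FullState d N M)} [SFinite μ] [RotationInvariant μ]
    [SFinite ν] [RotationInvariant ν] (lamS lamR mu0 : ℝ) (ρ : Measure (ScatSphere d))
    [IsProbabilityMeasure ρ] (T : Lp ℝ 1 μ →L[ℝ] Lp ℝ 1 ν)
    (hT : ∀ i j φ, T (collisionOp μ ρ i j φ) = collisionOp ν ρ i j (T φ)) (φ : Lp ℝ 1 μ) :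
    T (kacGenerator lamS lamR mu0 μ ρ φ) = kacGenerator lamS lamR mu0 ν ρ (T φ) := by
  simp only [kacGenerator, add_apply, smul_apply, sub_apply, sum_apply,
    one_apply_eq_self, map_add, map_smul, map_sum, map_sub, hT]

theorem map_kacSemigroup {μ : Measure (FullState d N M)} [SFinite μ] [RotationInvariant μ]
    (lamS lamR mu0 : ℝ) (ρ : Measure (ScatSphere d))
    [IsProbabilityMeasure ρ] (T : Lp ℝ 1 μ →L[ℝ] Lp ℝ 1 μ)
    (hT : ∀ i j φ, T (collisionOp μ ρ i j φ) = collisionOp μ ρ i j (T φ)) (t : ℝ) (φ : Lp ℝ 1 μ) :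
    T (kacSemigroup lamS lamR mu0 μ ρ t φ) = kacSemigroup lamS lamR mu0 μ ρ t (T φ) := by
  have h : Commute T (kacGenerator lamS lamR mu0 μ ρ) :=
    ContinuousLinearMap.ext fun ψ => map_kacGenerator lamS lamR mu0 ρ T hT ψ
  exact DFunLike.congr_fun (h.smul_right t).exp_right.eq φ

/-! ### Positivity and conservation of mass -/

theorem Lp_smul_nonneg {α : Type*} [MeasurableSpace α] {μ : Measure α} {a : ℝ} (ha : 0 ≤ a)
    {φ : Lp ℝ 1 μ} (hφ : 0 ≤ φ) : 0 ≤ a • φ := by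
  rw [← Lp.coeFn_nonneg] at hφ ⊢
  filter_upwards [hφ, Lp.coeFn_smul a φ] with x h1 h2
  rw [h2]
  exact mul_nonneg ha h1

theorem exp_apply_nonneg_of_nonneg {α : Type*} [MeasurableSpace α] {μ : Measure α}
    {A : Lp ℝ 1 μ →L[ℝ] Lp ℝ 1 μ} (hA : ∀ φ, 0 ≤ φ → 0 ≤ A φ) {φ : Lp ℝ 1 μ} (hφ : 0 ≤ φ) :
    0 ≤ NormedSpace.exp A φ := by
  have hpow : ∀ n : ℕ, 0 ≤ (A ^ n) φ := by
    intro n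
    induction n with
    | zero => simpa using hφ
    | succ n ih =>
      rw [pow_succ']
      exact hA _ ih
  have h := (ContinuousLinearMap.apply ℝ (Lp ℝ 1 μ) φ).hasSum
    (NormedSpace.exp_series_hasSum_exp' (𝕂 := ℝ) A)
  exact h.nonneg fun n => Lp_smul_nonneg (by positivity) (hpow n)

/-- Operators that are nonnegative up to a multiple of the identity. -/
def IsQuasiPositive {α : Type*} [MeasurableSpace α] {μ : Measure α}
    (A : Lp ℝ 1 μ →L[ℝ] Lp ℝ 1 μ) : Prop := ∃ c : ℝ, ∀ φ, 0 ≤ φ → 0 ≤ A φ + c • φ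

namespace IsQuasiPositive

variable {α : Type*} [MeasurableSpace α] {μ : Measure α} {A B : Lp ℝ 1 μ →L[ℝ] Lp ℝ 1 μ}

theorem add (hA : IsQuasiPositive A) (hB : IsQuasiPositive B) : IsQuasiPositive (A + B) := by
  obtain ⟨a, ha⟩ := hA
  obtain ⟨b, hb⟩ := hB
  refine ⟨a + b, fun φ hφ => ?_⟩
  have : (A + B) φ + (a + b) • φ = (A φ + a • φ) + (B φ + b • φ) := by
    rw [add_apply, add_smul]; abel
  rw [this]
  exact add_nonneg (ha φ hφ) (hb φ hφ)

theorem smul (hA : IsQuasiPositive A) {r : ℝ} (hr : 0 ≤ r) : IsQuasiPositive (r • A) := by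
  obtain ⟨a, ha⟩ := hA
  refine ⟨r * a, fun φ hφ => ?_⟩
  have : (r • A) φ + (r * a) • φ = r • (A φ + a • φ) := by
    rw [smul_apply, smul_add, smul_smul]
  rw [this]
  exact Lp_smul_nonneg hr (ha φ hφ)

theorem zero : IsQuasiPositive (0 : Lp ℝ 1 μ →L[ℝ] Lp ℝ 1 μ) :=
  ⟨0, fun φ _ => by simp⟩

theorem sum {κ : Type*} (s : Finset κ) {A : κ → Lp ℝ 1 μ →L[ℝ] Lp ℝ 1 μ}
    (hA : ∀ k, IsQuasiPositive (A k)) : IsQuasiPositive (∑ k ∈ s, A k) :=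
  Finset.sum_induction _ _ (fun _ _ => add) zero fun k _ => hA k

/-- Write `e^A = e^{-c} e^{A + c}`; the exponential series of the nonnegative operator `A + c` has
nonnegative terms. -/
theorem exp_nonneg (hA : IsQuasiPositive A) {φ : Lp ℝ 1 μ} (hφ : 0 ≤ φ) :
    0 ≤ NormedSpace.exp A φ := by
  obtain ⟨c, hc⟩ := hA
  have e : A = (-c) • (1 : Lp ℝ 1 μ →L[ℝ] Lp ℝ 1 μ) + (A + c • 1) := by
    rw [neg_smul]; abel
  have hcomm : Commute ((-c) • (1 : Lp ℝ 1 μ →L[ℝ] Lp ℝ 1 μ)) (A + c • 1) :=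
    (Commute.one_left _).smul_left _
  have hs : NormedSpace.exp ((-c) • (1 : Lp ℝ 1 μ →L[ℝ] Lp ℝ 1 μ)) = Real.exp (-c) • 1 := by
    rw [← Algebra.algebraMap_eq_smul_one, ← NormedSpace.algebraMap_exp_comm, ← Real.exp_eq_exp_ℝ,
      Algebra.algebraMap_eq_smul_one]
  let +nondep : NormedAlgebra ℚ (Lp ℝ 1 μ →L[ℝ] Lp ℝ 1 μ) := NormedAlgebra.restrictScalars ℚ ℝ _
  rw [e, NormedSpace.exp_add_of_commute hcomm, hs]
  refine Lp_smul_nonneg (Real.exp_pos _).le (exp_apply_nonneg_of_nonneg (fun ψ hψ => ?_) hφ)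
  exact hc ψ hψ

end IsQuasiPositive

theorem isQuasiPositive_kacGenerator {lamS lamR mu0 : ℝ} {μ : Measure (FullState d N M)} [SFinite μ]
    [RotationInvariant μ] (ρ : Measure (ScatSphere d)) [IsProbabilityMeasure ρ] (hN : 1 ≤ N)
    (hM : 1 ≤ M) (hlamS : 0 ≤ lamS) (hlamR : 0 ≤ lamR) (hmu0 : 0 ≤ mu0) :
    IsQuasiPositive (kacGenerator lamS lamR mu0 μ ρ) := by
  have hR : ∀ i j, IsQuasiPositive (collisionOp μ ρ i j - 1) := by
    intro i j
    refine ⟨1, fun φ hφ => ?_⟩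
    rw [sub_apply, one_apply_eq_self, one_smul, sub_add_cancel]
    exact averageOp_nonneg _ hφ
  -- For `N = 1` the coefficient is `lamS / 0 = 0` and the sum is empty, so this case needs no
  -- separate treatment; likewise for `M`.
  have hN' : (0 : ℝ) ≤ (N : ℝ) - 1 := by
    have : (1 : ℝ) ≤ N := by exact_mod_cast hN
    linarith
  have hM' : (0 : ℝ) ≤ (M : ℝ) - 1 := by
    have : (1 : ℝ) ≤ M := by exact_mod_cast hM
    linarith
  refine ((IsQuasiPositive.smul ?_ (by positivity)).add
    (IsQuasiPositive.smul ?_ (by positivity))).add (IsQuasiPositive.smul ?_ (by positivity)) <;>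
  exact IsQuasiPositive.sum _ fun i => IsQuasiPositive.sum _ fun j => hR _ _

theorem kacSemigroup_nonneg {lamS lamR mu0 : ℝ} {μ : Measure (FullState d N M)} [SFinite μ]
    [RotationInvariant μ] (ρ : Measure (ScatSphere d)) [IsProbabilityMeasure ρ] (hN : 1 ≤ N)
    (hM : 1 ≤ M) (hlamS : 0 ≤ lamS) (hlamR : 0 ≤ lamR) (hmu0 : 0 ≤ mu0) {t : ℝ} (ht : 0 ≤ t)
    {φ : Lp ℝ 1 μ} (hφ : 0 ≤ φ) : 0 ≤ kacSemigroup lamS lamR mu0 μ ρ t φ :=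
  ((isQuasiPositive_kacGenerator ρ hN hM hlamS hlamR hmu0).smul ht).exp_nonneg hφ

/-- Each `R_ij` preserves the integral, so the integral annihilates the range of the generator and
only the zeroth term of the exponential series survives. -/
theorem integral_kacSemigroup {lamS lamR mu0 : ℝ} {μ : Measure (FullState d N M)} [SFinite μ]
    [RotationInvariant μ] (ρ : Measure (ScatSphere d)) [IsProbabilityMeasure ρ] (t : ℝ)
    (φ : Lp ℝ 1 μ) : ∫ u, kacSemigroup lamS lamR mu0 μ ρ t φ u ∂μ = ∫ u, φ u ∂μ := by
  set ℓ : Lp ℝ 1 μ →L[ℝ] ℝ := L1.integralCLM with hℓ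
  have hint : ∀ ψ : Lp ℝ 1 μ, ∫ u, ψ u ∂μ = ℓ ψ := fun ψ => by
    rw [hℓ, ← L1.integral_eq, L1.integral_eq_integral]
  have hR : ∀ i j ψ, ℓ (collisionOp μ ρ i j ψ) = ℓ ψ := by
    intro i j ψ
    rw [← hint, ← hint]
    exact integral_averageOp _ ψ
  have hgen : ∀ ψ, ℓ (kacGenerator lamS lamR mu0 μ ρ ψ) = 0 := by
    intro ψ
    simp [kacGenerator, add_apply, smul_apply, sub_apply, hR]
  rw [hint, hint, kacSemigroup]
  have h := ℓ.hasSum ((ContinuousLinearMap.apply ℝ (Lp ℝ 1 μ) φ).hasSum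
    (NormedSpace.exp_series_hasSum_exp' (𝕂 := ℝ) (t • kacGenerator lamS lamR mu0 μ ρ)))
  have h0 := hasSum_single (f := fun n : ℕ => ℓ (ContinuousLinearMap.apply ℝ (Lp ℝ 1 μ) φ
    (((n.factorial : ℝ)⁻¹) • (t • kacGenerator lamS lamR mu0 μ ρ) ^ n))) 0 (by
      intro n hn
      obtain ⟨m, rfl⟩ := Nat.exists_eq_succ_of_ne_zero hn
      rw [pow_succ']
      simp [hgen])
  refine (h.unique h0).trans ?_
  simp

/-! ### The evolution relative to the equilibrium -/

/-- Both sides solve the same linear differential equation in `L¹(γ du)` with the same initial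
value, and the generator is bounded, hence Lipschitz. -/
theorem groundState_eq_kacSemigroup (hβ : 0 < β) {lamS lamR mu0 : ℝ} (ρ : Measure (ScatSphere d))
    [IsProbabilityMeasure ρ] {F : ℝ → Lp ℝ 1 (volume : Measure (FullState d N M))}
    (hF : IsKacSolution lamS lamR mu0 ρ F) {t : ℝ} (ht : 0 ≤ t) :
    groundState hβ (F t) =
      kacSemigroup lamS lamR mu0 (gaussMeasure (FullState d N M) β) ρ t
        (groundState hβ (F 0)) := by
  set L := kacGenerator lamS lamR mu0 (gaussMeasure (FullState d N M) β) ρ with hL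
  have hcomm : ∀ f, groundStateCLM hβ (kacGenerator lamS lamR mu0 volume ρ f) =
      L (groundStateCLM hβ f) := fun f =>
    map_kacGenerator lamS lamR mu0 ρ (groundStateCLM hβ)
      (fun i j f => groundState_collisionOp hβ ρ i j f) f
  have hd : ∀ r, 0 ≤ r → HasDerivWithinAt (fun r => groundStateCLM hβ (F r))
      (L (groundStateCLM hβ (F r))) (Set.Ici 0) r := fun r hr => by
    rw [← hcomm]
    exact (groundStateCLM hβ).hasFDerivAt.comp_hasDerivWithinAt r (hF r hr)
  have he : ∀ r : ℝ, HasDerivAt (fun r : ℝ => NormedSpace.exp (r • L) (groundStateCLM hβ (F 0)))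
      (L (NormedSpace.exp (r • L) (groundStateCLM hβ (F 0)))) r := fun r => by
    have h := (hasDerivAt_exp_smul_const' L r).clm_apply
      (hasDerivAt_const r (groundStateCLM hβ (F 0)))
    rw [map_zero, add_zero] at h
    exact h
  have h := ODE_solution_unique (v := fun _ => L) (K := ‖L‖₊) (a := 0) (b := t)
    (fun _ => L.lipschitz)
    (fun r hr => ((hd r hr.1).mono (Set.Icc_subset_Ici_self)).continuousWithinAt)
    (fun r hr => (hd r hr.1).mono (Set.Ici_subset_Ici.2 hr.1))
    (fun r _ => (he r).continuousAt.continuousWithinAt)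
    (fun r _ => (he r).hasDerivWithinAt) (by simp)
  exact h (Set.right_mem_Icc.2 ht)

theorem maxwell_split (hβ : 0 < β) (u : FullState d N M) :
    maxwell β u = maxwell β (kacPart u) * maxwell β (reservoirPart u) := by
  have hfin : Module.finrank ℝ (FullState d N M) =
      Module.finrank ℝ (State d (Fin N)) + Module.finrank ℝ (State d (Fin M)) := by
    rw [← (joinIsometry (d := d) (N := N) (M := M)).toLinearEquiv.finrank_eq,
      (WithLp.linearEquiv 2 ℝ _).finrank_eq, Module.finrank_prod]
  have hnorm : ‖u‖ ^ 2 = ‖kacPart u‖ ^ 2 + ‖reservoirPart u‖ ^ 2 := by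
    rw [← (joinIsometry (d := d) (N := N) (M := M)).symm.norm_map u,
      WithLp.prod_norm_sq_eq_of_L2]
    rfl
  have hp : 0 < β / (2 * Real.pi) := by positivity
  simp only [maxwell]
  rw [hfin, hnorm, mul_mul_mul_comm, ← Real.rpow_add hp, ← Real.exp_add]
  push_cast
  congr 2
  · ring
  · ring

theorem groundState_initial (hβ : 0 < β) {F₀ : Lp ℝ 1 (volume : Measure (FullState d N M))}
    {f₀ : Lp ℝ 1 (volume : Measure (State d (Fin N)))}
    (hF₀ : ∀ᵐ u, F₀ u = f₀ (kacPart u) * maxwell β (reservoirPart u)) :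
    groundState hβ F₀ = extendState M hβ (groundState hβ f₀) := by
  apply Lp.ext
  filter_upwards [groundState_ae hβ F₀, gaussMeasure_absolutelyContinuous.ae_le hF₀,
    extendState_ae (M := M) hβ (groundState hβ f₀),
    (kacPart_gauss hβ).quasiMeasurePreserving.ae_eq_comp (groundState_ae hβ f₀)] with u h1 h2 h3 h4
  simp only [Function.comp_apply] at h4
  rw [h1, h2, h3, h4, maxwell_split hβ]
  have := maxwell_pos hβ (kacPart u)
  have := maxwell_pos hβ (reservoirPart u)
  field_simp

/-- Since `γ(v, w) = γ(v) γ(w)`, the Gaussian weight in `w` cancels the reservoir part of the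
denominator. -/
theorem gaussMarginal_groundState (hβ : 0 < β)
    (f : Lp ℝ 1 (volume : Measure (FullState d N M))) :
    gaussMarginal hβ (groundState hβ f) = groundState hβ (marginal f) := by
  apply Lp.ext
  have hj := joinState_gauss (d := d) (N := N) (M := M) hβ
  filter_upwards [averageOp_ae joinState hj (groundState hβ f),
    groundState_ae hβ (marginal f),
    gaussMeasure_absolutelyContinuous (averageOp_ae joinState joinState_volume f),
    Measure.ae_ae_of_ae_prod (hj.quasiMeasurePreserving.ae_eq_comp (groundState_ae hβ f))]
    with v h1 h2 h3 h4
  simp only [Function.comp_apply] at h4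
  rw [gaussMarginal, h1, h2, marginal, h3, integral_congr_ae h4, integral_gaussMeasure hβ,
    ← integral_div]
  refine integral_congr_ae (.of_forall fun w => ?_)
  have hs := maxwell_split hβ (joinState (v, w))
  rw [show kacPart (joinState (v, w)) = v from rfl,
    show reservoirPart (joinState (v, w)) = w from rfl] at hs
  simp only [hs, smul_eq_mul]
  have := maxwell_pos hβ v
  have := maxwell_pos hβ w
  field_simp

/-- For `s > 0` the class `P_s φ` has the smooth representative `ouFun β s h`. Any representative
`h` of `φ` may be used, for instance one that is nonnegative everywhere. -/
theorem fisherInfo_ornsteinUhlenbeck {E : Type*} [NormedAddCommGroup E] [InnerProductSpace ℝ E]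
    [FiniteDimensional ℝ E] [MeasurableSpace E] [BorelSpace E] (hβ : 0 < β) {s : ℝ≥0} (hs : 0 < s)
    (φ : Lp ℝ 1 (gaussMeasure E β)) {h : E → ℝ} (hφ : φ =ᵐ[gaussMeasure E β] h) :
    fisherInfo β (ornsteinUhlenbeck hβ s φ) =
      information β (ouFun β s h) (ouGrad β s h) := by
  have hs' : (0 : ℝ) < s := hs
  have hi : Integrable h (gaussMeasure E β) := (L1.integrable_coeFn φ).congr hφ
  refine fisherInfo_eq_information (hasGradientAt_ouFun hβ hs' hi) (continuous_ouGrad hβ hs' hi) ?_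
  have h1 : ouFun β s φ = ouFun β s h :=
    mehler_congr_ae hβ (ou_sqrt_pos hs') (ou_sq_add_sq hs'.le) hφ
  rw [← h1]
  exact absolutelyContinuous_gaussMeasure hβ
    (averageOp_ae (ouMap s) (ouMap_measurePreserving hβ s) φ)

end Model

end

end KacModel

/-! ### Proof of the theorem. -/

open KacModel

theorem mainTheorem7 (d N M : ℕ) (hN : 1 ≤ N) (hM : 1 ≤ M)
    (β lamS lamR mu0 : ℝ) (hβ : 0 < β) (hlamS : 0 ≤ lamS) (hlamR : 0 ≤ lamR) (hmu0 : 0 ≤ mu0)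
    (ρ : Measure (ScatSphere d)) [IsProbabilityMeasure ρ] (hρ : IsSymmetricScattering ρ)
    (F : ℝ → Lp ℝ 1 (volume : Measure (FullState d N M)))
    (hF : IsKacSolution lamS lamR mu0 ρ F)
    (f₀ : Lp ℝ 1 (volume : Measure (State d (Fin N))))
    (hf₀_nonneg : ∀ᵐ v, 0 ≤ f₀ v) (hf₀_one : ∫ v, f₀ v = 1)
    (hF₀ : ∀ᵐ u, F 0 u = f₀ (kacPart u) * maxwell β (reservoirPart u))
    (hf₀_H1 : MemH1 (fun v => √(f₀ v)))
    (hE : kineticEnergy (F 0) < ⊤)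
    (c : ℝ → ℝ) (t : ℝ) (ht : 0 ≤ t)
    (hc : ∀ s : ℝ≥0,
      (fisherInfo β (gaussMarginal hβ
        (kacSemigroup lamS lamR mu0 (gaussMeasure (FullState d N M) β) ρ t
          (extendState M hβ (ornsteinUhlenbeck hβ s (groundState hβ f₀))))) : EReal)
        ≤ (c t : EReal) * (fisherInfo β (ornsteinUhlenbeck hβ s (groundState hβ f₀)) : EReal)) :
    relEntropy (marginal (F t)) (maxwell β) ≤ (c t : EReal) * relEntropy f₀ (maxwell β) := by
  set h₀ := groundState hβ f₀ with hh₀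
  set q := gaussMarginal hβ (kacSemigroup lamS lamR mu0 (gaussMeasure (FullState d N M) β) ρ t
    (extendState M hβ h₀)) with hq
  have hqF : q = groundState hβ (marginal (F t)) := by
    rw [hq, hh₀, ← groundState_initial hβ hF₀, ← groundState_eq_kacSemigroup hβ ρ hF ht,
      gaussMarginal_groundState]
  -- `P_s` is moved outward through the extension, the evolution and the Gaussian marginal.
  have hcomm : ∀ s : ℝ≥0, gaussMarginal hβ
      (kacSemigroup lamS lamR mu0 (gaussMeasure (FullState d N M) β) ρ t
        (extendState M hβ (ornsteinUhlenbeck hβ s h₀))) = ornsteinUhlenbeck hβ s q := by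
    intro s
    rw [ornsteinUhlenbeck_extendState, ← map_kacSemigroup lamS lamR mu0 ρ
      (ornsteinUhlenbeck hβ s) (fun i j φ => ornsteinUhlenbeck_collisionOp hβ ρ i j s φ),
      ornsteinUhlenbeck_gaussMarginal]
  have hh₀0 : 0 ≤ h₀ := groundState_nonneg hβ hf₀_nonneg
  have hh₀1 : ∫ v, h₀ v ∂gaussMeasure (State d (Fin N)) β = 1 :=
    (integral_groundState hβ f₀).trans hf₀_one
  have hext0 : 0 ≤ extendState M hβ h₀ := by
    rw [← Lp.coeFn_nonneg] at hh₀0 ⊢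
    filter_upwards [extendState_ae (M := M) hβ h₀,
      (kacPart_gauss hβ).quasiMeasurePreserving.ae hh₀0] with u h1 h2
    rw [h1]
    exact h2
  have hext1 : ∫ u, extendState M hβ h₀ u ∂gaussMeasure (FullState d N M) β = 1 := by
    rw [integral_congr_ae (extendState_ae hβ h₀), integral_comp_measurePreserving
      (kacPart_gauss hβ) (Lp.stronglyMeasurable h₀).aestronglyMeasurable, hh₀1]
  have hq0 : 0 ≤ q :=
    averageOp_nonneg _ (kacSemigroup_nonneg ρ hN hM hlamS hlamR hmu0 ht hext0)
  have hq1 : ∫ v, q v ∂gaussMeasure (State d (Fin N)) β = 1 := by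
    rw [hq, gaussMarginal, integral_averageOp, integral_kacSemigroup, hext1]
  have hmarg0 : ∀ᵐ v, 0 ≤ (marginal (F t)) v := by
    have h := (Lp.coeFn_nonneg q).2 hq0
    rw [hqF] at h
    refine (absolutelyContinuous_gaussMeasure hβ).ae_le ?_
    filter_upwards [h, groundState_ae hβ (marginal (F t))] with v h1 h2
    rw [h2] at h1
    have hv := maxwell_pos hβ v
    have := mul_nonneg h1 hv.le
    rwa [div_mul_cancel₀ _ hv.ne'] at this
  have hmarg1 : ∫ v, (marginal (F t)) v = 1 := by
    rw [← integral_groundState hβ, ← hqF, hq1]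
  rw [relEntropy_eq_entropy hβ hmarg0 hmarg1, relEntropy_eq_entropy hβ hf₀_nonneg hf₀_one, ← hqF]
  -- Elements of `L¹` are nonnegative only almost everywhere, while the comparison lemma asks for
  -- nonnegativity at every point; the positive part is a suitable representative.
  have hpart : ∀ φ : Lp ℝ 1 (gaussMeasure (State d (Fin N)) β), 0 ≤ φ →
      φ =ᵐ[gaussMeasure (State d (Fin N)) β] fun v => max (φ v) 0 := fun φ hφ =>
    ((Lp.coeFn_nonneg φ).2 hφ).mono fun v hv => (max_eq_left hv).symm
  have hent : ∀ φ : Lp ℝ 1 (gaussMeasure (State d (Fin N)) β), 0 ≤ φ →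
      entropy β φ = entropy β (fun v => max (φ v) 0) := fun φ hφ =>
    lintegral_congr_ae ((hpart φ hφ).mono fun v hv => by simp only [← hv])
  rw [hent q hq0, hent h₀ hh₀0]
  have hi := fun φ : Lp ℝ 1 (gaussMeasure (State d (Fin N)) β) => L1.integrable_coeFn φ
  refine entropy_le_mul_of_forall_information_le hβ ((hi q).congr (hpart q hq0))
    (fun v => le_max_right _ _) ((integral_congr_ae (hpart q hq0)).symm.trans hq1)
    ((hi h₀).congr (hpart h₀ hh₀0)) (fun v => le_max_right _ _)
    ((integral_congr_ae (hpart h₀ hh₀0)).symm.trans hh₀1) (c t) fun s hs => ?_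
  lift s to ℝ≥0 using hs.le
  have hs' : 0 < s := hs
  have h := hc s
  rwa [hcomm s, fisherInfo_ornsteinUhlenbeck hβ hs' q (hpart q hq0),
    fisherInfo_ornsteinUhlenbeck hβ hs' h₀ (hpart h₀ hh₀0)] at h
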